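/- For integers $r,s,t$ put $S_{r,s,t}:=\sum_{s\le i_1<\dots<i_r\le t}\frac{1}{i_1\cdots i_r}$, with $S_{0,s,t}:=1$ if $t\ge s-1$, and $S_{r,s,t}:=0$ if $r<0$ or $t<r+s-1$. Let $B_k$ be the Bernoulli numbers (with $B_1=-\tfrac12$), $\gamma$ Euler's constant, $H_q=\sum_{j=1}^q \frac1j$, $\zeta$ the Riemann zeta function and $\zeta^{(p)}$ its $p$-th derivative. All asymptotic statements are for $n\to\infty$ with the other parameters fixed. (1) For every integer $q\ge 2$ and every integer $m\ge 0$, $$\sum_{k=1}^{n-1}\frac{\log k}{(n-k)^q}=\zeta(q)\log n-\sum_{i=1}^{q-2}\frac{\zeta(q-i)}{i\,n^i}-\frac{2\log n+C_{q-1}}{(q-1)\,n^{q-1}}+\sum_{k=1}^m\Big(\frac{(-1)^kB_k}{k(k+q-1)}-\binom{k+q-2}{q-1}\zeta'(1-k)\Big)\frac1{n^{k+q-1}}+O\Big(\frac1{n^{m+q}}\Big),$$ where $C_q:=\gamma-H_q+\frac2q$. In particular there is no constant term: $\sum_{k=1}^{n-1}\frac{\log k}{(n-k)^q}-\zeta(q)\log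 n\to 0$. (2) For all integers $q\ge2$, $p\ge1$ and $m\ge 0$, \begin{align*} \sum_{k=1}^{n-1}\frac{(\log k)^p}{(n-k)^q}&=\zeta(q)(\log n)^p+\sum_{i=1}^{q-2}\frac{\zeta(q-i)}{i\,n^i}\sum_{r=1}^{\min(i,p)}c_{p,i,r}(\log n)^{p-r}+\frac{1}{(q-1)\,n^{q-1}}\sum_{r=0}^p d_{p,q,r}(\log n)^{p-r}\\ &\quad-\sum_{k=1}^m\bigg(\frac{(-1)^kB_k}{k(k+q-1)}\sum_{r=1}^p c_{p,k+q-1,r}(\log n)^{p-r}-(-1)^p\binom{k+q-2}{q-1}\zeta^{(p)}(1-k)\bigg)\frac1{n^{k+q-1}}+O\Big(\frac{(\log n)^{p-1}}{n^{m+q}}\Big), \end{align*} where $c_{p,i,r}:=\frac{(-1)^rp!}{(p-r)!}S_{r-1,1,i-1}$ and $$d_{p,q,r}:=\frac{(-1)^rp!}{(p-r)!}\times\begin{cases}D_{r,q}-(p-r)S_{r,1,q-2}+S_{r-1,1,q-2}\,\gamma+\sum_{s=2}^rS_{r-s,1,q-2}\,\zeta(s)&\text{for }0\le r\le q-1,\\[2pt]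 \sum_{s=r-q+2}^rS_{r-s,1,q-2}\,\zeta(s)&\text{for } q\le r\le p,\end{cases}$$ with the rational numbers $$D_{r,q}:=\sum_{u=0}^{r-2}\sum_{j=1}^{q-r+u}\frac{S_{u,1,j-1}}{j}\bigg(\frac{S_{r-2-u,1,q-j-2}}{j}-\sum_{v=1}^{q-j-2}\frac{\sum_{i=0}^{v-1}(-1)^iS_{i,1,v-1}\,S_{r-3-u-i,1,q-j-2-v}}{v(v+j)}\bigg)+\frac{S_{r-1,1,q-2}}{q-1}-S_{r,1,q-2}.$$ In particular there is no constant term: $\sum_{k=1}^{n-1}\frac{(\log k)^p}{(n-k)^q}-\zeta(q)(\log n)^p\to0$. -/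

import Mathlib

open Filter Asymptotics
open scoped Nat

noncomputable section

/-- `S_{r,s,t} = ∑_{s ≤ i₁ < ⋯ < i_r ≤ t} 1 / (i₁ ⋯ i_r)`, with `S_{0,s,t} = 1` for `t ≥ s - 1`,
and the value `0` for `r < 0` and for `t < s - 1`. -/
def multHarm (r s t : ℤ) : ℚ :=
  if r < 0 ∨ t < s - 1 then 0
  else ∑ A ∈ (Finset.Icc s t).powersetCard r.toNat, ∏ i ∈ A, 1 / (i : ℚ)

/-- `c_{p,i,r} = (-1)^r p! / (p-r)! · S_{r-1,1,i-1}`, for `r ≤ p`. -/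
def coeffC (p i r : ℕ) : ℚ :=
  (-1) ^ r * ((p ! : ℚ) / ((p - r)! : ℚ)) * multHarm ((r : ℤ) - 1) 1 ((i : ℤ) - 1)

/-- The rational numbers `D_{r,q}`. -/
def ratD (r q : ℤ) : ℚ :=
  (∑ u ∈ Finset.Icc 0 (r - 2), ∑ j ∈ Finset.Icc 1 (q - r + u),
    multHarm u 1 (j - 1) / (j : ℚ) *
      (multHarm (r - 2 - u) 1 (q - j - 2) / (j : ℚ) -
        ∑ v ∈ Finset.Icc 1 (q - j - 2),
          (∑ i ∈ Finset.Icc 0 (v - 1),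
            (-1) ^ i * multHarm i 1 (v - 1) * multHarm (r - 3 - u - i) 1 (q - j - 2 - v)) /
          ((v : ℚ) * ((v : ℚ) + (j : ℚ)))))
  + multHarm (r - 1) 1 (q - 2) / ((q : ℚ) - 1) - multHarm r 1 (q - 2)

/-- `d_{p,q,r}`, for `r ≤ p` and `q ≥ 2`. -/
def coeffD (p q r : ℕ) : ℂ :=
  (-1) ^ r * ((p ! : ℂ) / ((p - r)! : ℂ)) *
    if r < q then
      (ratD r q : ℂ) - ((p : ℂ) - (r : ℂ)) * (multHarm r 1 ((q : ℤ) - 2) : ℂ)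
        + (multHarm ((r : ℤ) - 1) 1 ((q : ℤ) - 2) : ℂ) * (Real.eulerMascheroniConstant : ℂ)
        + ∑ s ∈ Finset.Icc 2 r, (multHarm ((r : ℤ) - (s : ℤ)) 1 ((q : ℤ) - 2) : ℂ) * riemannZeta s
    else
      ∑ s ∈ Finset.Icc (r - q + 2) r,
        (multHarm ((r : ℤ) - (s : ℤ)) 1 ((q : ℤ) - 2) : ℂ) * riemannZeta s

/-- `C_q = γ - H_q + 2 / q`. -/
def constC (q : ℕ) : ℝ :=
  Real.eulerMascheroniConstant - (harmonic q : ℝ) + 2 / (q : ℝ)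

/-- `∑_{k=1}^{n-1} (log k)^p / (n-k)^q`. -/
def logPowSum (p q n : ℕ) : ℝ :=
  ∑ k ∈ Finset.Ico 1 n, Real.log (k : ℝ) ^ p / ((n : ℝ) - (k : ℝ)) ^ q

/-- `ζ^{(p)}(s)`. -/
def zetaDeriv (p : ℕ) (s : ℂ) : ℂ := iteratedDeriv p riemannZeta s

end

/-!
Up to the factor `(-1) ^ p * p!`, the sum `logPowSum p q n` is the `p`-th Taylor coefficient at
`s = 0` of the convolution `∑_{k < n} k ^ (-s) / (n - k) ^ q`. This convolution has an asymptotic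
expansion in powers of `1 / n`, uniform for `s` in bounded sets, whose error terms pass to the
Taylor coefficients by the Cauchy estimates.

For `Re s` very negative, subtract from `k ^ (-s) = n ^ (-s) * (1 - (n - k) / n) ^ (-s)` a Taylor
polynomial in `(n - k) / n`: the polynomial contributes truncated zeta sums, the remainder a
Riemann sum, and Euler–Maclaurin applies to both. The identity `1 = (n - (n - k)) / k` relates the
convolutions at `(q + 1, s)`, `(q + 1, s - 1)` and `(q, s)`, and its iteration removes the
restriction on `s`.

The rising factorials in the coefficients of the expansion have multiple harmonic sums as Taylor
coefficients. At the exponent `q - 1` a pole of `ζ` is met, which produces the additional `log n`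
and the terms `ζ(s)` of `d_{p,q,r}`; the numbers `D_{r,q}` are what remains, after an identity
between the products `∏ (1 + X / j)`.
-/

section EulerMaclaurin

open MeasureTheory intervalIntegral Set

variable {E : Type*} [NormedAddCommGroup E] [NormedSpace ℝ E] [CompleteSpace E]

theorem integral_bernoulliFun_smul_deriv {g g' : ℝ → E} {a : ℝ} (j : ℕ)
    (hg : ContinuousOn g (Icc a (a + 1))) (hg' : ContinuousOn g' (Icc a (a + 1)))
    (hderiv : ∀ x ∈ Ioo a (a + 1), HasDerivAt g (g' x) x) :
    ∫ x in a..(a + 1), bernoulliFun (j + 1) (x - a) • g' x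
      = bernoulliFun (j + 1) 1 • g (a + 1) - bernoulliFun (j + 1) 0 • g a
        - (j + 1 : ℝ) • ∫ x in a..(a + 1), bernoulliFun j (x - a) • g x := by
  have ha : a ≤ a + 1 := by linarith
  have hB : ∀ m, Continuous fun x : ℝ => bernoulliFun m (x - a) := fun m =>
    (continuous_bernoulliFun m).comp (continuous_sub_right a)
  have hB' : ∀ x, HasDerivAt (fun x => bernoulliFun (j + 1) (x - a))
      ((j + 1 : ℕ) * bernoulliFun j (x - a)) x := fun x => by
    simpa using (hasDerivAt_bernoulliFun (j + 1) (x - a)).comp_sub_const x a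
  rw [← uIcc_of_le ha] at hg hg'
  rw [integral_smul_deriv_eq_deriv_smul_of_hasDerivAt (hB _).continuousOn hg (fun x _ => hB' x)
    (by simpa [ha] using hderiv) ((hB j).const_mul _).continuousOn.intervalIntegrable
    hg'.intervalIntegrable, ← intervalIntegral.integral_smul]
  simp [mul_smul]

theorem neg_one_pow_mul_bernoulli_add_two (k : ℕ) :
    (-1) ^ k * bernoulli (k + 2) = bernoulli (k + 2) := by
  nth_rw 2 [bernoulli_eq_bernoulli'_of_ne_one (by lia)]
  rw [bernoulli, ← mul_assoc, ← pow_add, Even.neg_one_pow ⟨k + 1, by ring⟩, one_mul]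

theorem eulerMaclaurin_unit_interval (f : ℕ → ℝ → E) (a : ℝ) (K : ℕ)
    (hcont : ∀ j ≤ K + 1, ContinuousOn (f j) (Icc a (a + 1)))
    (hderiv : ∀ j ≤ K, ∀ x ∈ Ioo a (a + 1), HasDerivAt (f j) (f (j + 1) x) x) :
    f 0 a = (∫ x in a..(a + 1), f 0 x)
      + ∑ j ∈ Finset.range (K + 1), ((bernoulli (j + 1) : ℝ) / (j + 1)!) • (f j (a + 1) - f j a)
      + ((-1) ^ K / (K + 1)! : ℝ) •
          ∫ x in a..(a + 1), bernoulliFun (K + 1) (x - a) • f (K + 1) x := by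
  have parts : ∀ j ≤ K, _ := fun j hj => integral_bernoulliFun_smul_deriv j
    (hcont j (by lia)) (hcont (j + 1) (by lia)) (hderiv j hj)
  induction K with
  | zero =>
    have h := parts 0 le_rfl
    simp only [zero_add, bernoulliFun_eval_one, bernoulliFun_eval_zero, bernoulliFun_zero,
      bernoulli_one, one_smul, if_true] at h
    simp only [zero_add, Finset.range_one, Finset.sum_singleton, bernoulli_one, h,
      Nat.factorial_one]
    push_cast
    module
  | succ K ih =>
    have hstep := parts (K + 1) le_rfl
    have hbern : (-1 : ℝ) ^ K * bernoulli (K + 2) = bernoulli (K + 2) := by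
      exact_mod_cast neg_one_pow_mul_bernoulli_add_two K
    have hfact : ((K + 1 + 1)! : ℝ) = (K + 2) * (K + 1)! := by
      rw [Nat.factorial_succ]; push_cast; ring
    have hne : ((K + 1)! : ℝ) ≠ 0 := by positivity
    rw [bernoulliFun_endpoints_eq_of_ne_one (by lia), bernoulliFun_eval_zero] at hstep
    conv_lhs => rw [ih (fun j hj => hcont j (by lia)) (fun j hj => hderiv j (by lia))
      (fun j hj => parts j (by lia))]
    rw [Finset.sum_range_succ _ (K + 1), hstep, hfact]
    push_cast
    match_scalars <;> field_simp
    · ring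
    · linear_combination hbern
    · linear_combination -hbern

theorem exists_norm_eulerMaclaurin_unit_interval_le (K : ℕ) : ∃ C, 0 ≤ C ∧
    ∀ (f : ℕ → ℝ → E) (a : ℝ), (∀ j ≤ K + 1, ContinuousOn (f j) (Icc a (a + 1))) →
    (∀ j ≤ K, ∀ x ∈ Ioo a (a + 1), HasDerivAt (f j) (f (j + 1) x) x) →
    ‖f 0 a - (∫ x in a..(a + 1), f 0 x) - ∑ j ∈ Finset.range (K + 1),
        ((bernoulli (j + 1) : ℝ) / (j + 1)!) • (f j (a + 1) - f j a)‖
      ≤ C * ∫ x in a..(a + 1), ‖f (K + 1) x‖ := by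
  obtain ⟨C, hC⟩ := isCompact_Icc.exists_bound_of_continuousOn
    (f := bernoulliFun (K + 1)) (s := Icc (0 : ℝ) 1) (continuous_bernoulliFun _).continuousOn
  refine ⟨C, (norm_nonneg _).trans (hC 0 (by simp)), fun f a hcont hderiv => ?_⟩
  have ha : a ≤ a + 1 := by linarith
  have hfact : ‖((-1) ^ K / (K + 1)! : ℝ)‖ ≤ 1 := by
    rw [norm_div, norm_pow, norm_neg, norm_one, one_pow, RCLike.norm_natCast]
    exact div_le_one_of_le₀ (by exact_mod_cast Nat.succ_le_of_lt (Nat.factorial_pos _))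
      (by positivity)
  have hInt : IntervalIntegrable (f (K + 1)) volume a (a + 1) :=
    (uIcc_of_le ha ▸ hcont _ le_rfl : ContinuousOn _ (uIcc a (a + 1))).intervalIntegrable
  conv_lhs => rw [eulerMaclaurin_unit_interval f a K hcont hderiv]
  rw [sub_sub, add_sub_cancel_left, norm_smul, ← intervalIntegral.integral_const_mul]
  refine (mul_le_of_le_one_left (norm_nonneg _) hfact).trans
    (norm_integral_le_of_norm_le ha (ae_of_all _ fun x hx => ?_) (hInt.norm.const_mul C))
  rw [norm_smul]
  gcongr
  exact hC _ ⟨by linarith [hx.1], by linarith [hx.2]⟩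

theorem exists_norm_eulerMaclaurin_le (K : ℕ) : ∃ C, 0 ≤ C ∧
    ∀ (f : ℕ → ℝ → E) (A B : ℕ), A ≤ B → (∀ j ≤ K + 1, ContinuousOn (f j) (Icc (A : ℝ) B)) →
    (∀ j ≤ K, ∀ x ∈ Ioo (A : ℝ) B, HasDerivAt (f j) (f (j + 1) x) x) →
    ‖(∑ k ∈ Finset.Ico A B, f 0 k) - (∫ x in (A : ℝ)..B, f 0 x) - ∑ j ∈ Finset.range (K + 1),
        ((bernoulli (j + 1) : ℝ) / (j + 1)!) • (f j B - f j A)‖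
      ≤ C * ∫ x in (A : ℝ)..B, ‖f (K + 1) x‖ := by
  obtain ⟨C, hC0, hC⟩ := exists_norm_eulerMaclaurin_unit_interval_le (E := E) K
  refine ⟨C, hC0, fun f A B hAB hcont hderiv => ?_⟩
  have hsub : ∀ k ∈ Ico A B, (A : ℝ) ≤ k ∧ (k : ℝ) + 1 ≤ B := fun k hk =>
    ⟨by exact_mod_cast hk.1, by exact_mod_cast hk.2⟩
  have hcont' : ∀ k ∈ Ico A B, ∀ j ≤ K + 1, ContinuousOn (f j) (Icc (k : ℝ) (k + 1)) :=
    fun k hk j hj => (hcont j hj).mono (Icc_subset_Icc (hsub k hk).1 (hsub k hk).2)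
  have hderiv' : ∀ k ∈ Ico A B, ∀ j ≤ K, ∀ x ∈ Ioo (k : ℝ) (k + 1),
      HasDerivAt (f j) (f (j + 1) x) x := fun k hk j hj x hx =>
    hderiv j hj x ⟨(hsub k hk).1.trans_lt hx.1, hx.2.trans_le (hsub k hk).2⟩
  have hInt : ∀ j ≤ K + 1, ∀ k ∈ Ico A B,
      IntervalIntegrable (f j) volume (k : ℝ) (k + 1 : ℕ) := fun j hj k hk => by
    refine ContinuousOn.intervalIntegrable ?_
    rw [uIcc_of_le (by simp)]
    exact_mod_cast hcont' k hk j hj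
  have htele : ∀ j, f j B - f j A = ∑ k ∈ Finset.Ico A B, (f j (k + 1) - f j k) := fun j => by
    exact_mod_cast (Finset.sum_Ico_sub (fun k : ℕ => f j k) hAB).symm
  rw [← sum_integral_adjacent_intervals_Ico hAB (hInt 0 (by lia)),
    ← sum_integral_adjacent_intervals_Ico hAB fun k hk => (hInt (K + 1) le_rfl k hk).norm,
    Finset.mul_sum]
  simp only [htele, Finset.smul_sum, Nat.cast_add, Nat.cast_one]
  rw [Finset.sum_comm, ← Finset.sum_sub_distrib, ← Finset.sum_sub_distrib]
  refine norm_sum_le_of_le _ fun k hk => ?_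
  rw [Finset.mem_Ico] at hk
  exact hC f k (hcont' k hk) (hderiv' k hk)

end EulerMaclaurin

section RisingCoeff

/-- The coefficient `s (s + 1) ⋯ (s + i - 1) / i!` of `y ^ i` in `(1 - y) ^ (-s)`. -/
noncomputable def risingCoeff (i : ℕ) (s : ℂ) : ℂ := ∏ l ∈ Finset.range i, (s + l) / (l + 1)

@[simp] theorem risingCoeff_zero (s : ℂ) : risingCoeff 0 s = 1 := by simp [risingCoeff]

theorem add_one_mul_risingCoeff_succ (i : ℕ) (s : ℂ) :
    (i + 1) * risingCoeff (i + 1) s = (s + i) * risingCoeff i s := by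
  have : (i : ℂ) + 1 ≠ 0 := by exact_mod_cast i.succ_ne_zero
  rw [risingCoeff, Finset.prod_range_succ, ← risingCoeff]
  field_simp

theorem add_one_mul_risingCoeff_succ' (i : ℕ) (s : ℂ) :
    (i + 1) * risingCoeff (i + 1) s = s * risingCoeff i (s + 1) := by
  induction i with
  | zero => simp [risingCoeff]
  | succ i ih =>
    have hs := add_one_mul_risingCoeff_succ (i + 1) s
    have hs1 := add_one_mul_risingCoeff_succ i (s + 1)
    have : (i : ℂ) + 1 ≠ 0 := by exact_mod_cast i.succ_ne_zero
    apply mul_left_cancel₀ this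
    push_cast at *
    linear_combination ((i : ℂ) + 1) * hs - s * hs1 + (s + i + 1) * ih

theorem risingCoeff_succ_eq_add (i : ℕ) (s : ℂ) :
    risingCoeff (i + 1) s = risingCoeff (i + 1) (s - 1) + risingCoeff i s := by
  have : (i : ℂ) + 1 ≠ 0 := by exact_mod_cast i.succ_ne_zero
  apply mul_left_cancel₀ this
  have hs := add_one_mul_risingCoeff_succ i s
  have hs1 := add_one_mul_risingCoeff_succ' i (s - 1)
  rw [sub_add_cancel] at hs1
  linear_combination hs - hs1

theorem differentiable_risingCoeff (i : ℕ) : Differentiable ℂ (risingCoeff i) := by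
  unfold risingCoeff
  fun_prop

theorem bernoulli_div_factorial_smul (j : ℕ) (z : ℂ) :
    ((bernoulli (j + 1) : ℝ) / (j + 1)!) • ((-1) ^ j * (j ! : ℂ) * z) = riemannZeta (-j) * z := by
  rw [riemannZeta_neg_nat_eq_bernoulli, Nat.factorial_succ, Complex.real_smul]
  have hfact : (j ! : ℂ) ≠ 0 := by exact_mod_cast j.factorial_ne_zero
  have hsucc : (j : ℂ) + 1 ≠ 0 := by exact_mod_cast j.succ_ne_zero
  push_cast
  field_simp

theorem hasDerivAt_ofReal_cpow_neg (s : ℂ) {x : ℝ} (hx : 0 < x) :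
    HasDerivAt (fun x : ℝ => (x : ℂ) ^ (-s)) (-s * (x : ℂ) ^ (-s - 1)) x := by
  simpa using (Complex.hasStrictDerivAt_cpow_const (c := -s)
    (Or.inl (by simpa using hx) : (x : ℂ) ∈ Complex.slitPlane)).hasDerivAt.comp_ofReal

theorem hasDerivAt_risingCoeff_mul_cpow (s : ℂ) (j : ℕ) {x : ℝ} (hx : 0 < x) :
    HasDerivAt (fun x : ℝ => (-1) ^ j * (j ! : ℂ) * (risingCoeff j s * (x : ℂ) ^ (-s - j)))
      ((-1) ^ (j + 1) * ((j + 1)! : ℂ) *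
        (risingCoeff (j + 1) s * (x : ℂ) ^ (-s - (j + 1 : ℕ)))) x := by
  have h := ((hasDerivAt_ofReal_cpow_neg (s + j) hx).const_mul (risingCoeff j s)).const_mul
    ((-1) ^ j * (j ! : ℂ))
  rw [neg_add', show -s - (j : ℂ) - 1 = -s - (j + 1 : ℕ) by push_cast; ring] at h
  refine h.congr_deriv ?_
  rw [Nat.factorial_succ]
  push_cast
  linear_combination (-(-1) ^ (j + 1) * (j ! : ℂ) * (x : ℂ) ^ (-s - (j + 1 : ℂ))) *
    add_one_mul_risingCoeff_succ j s

end RisingCoeff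

section ZetaPartialSums

open MeasureTheory intervalIntegral Set Topology

theorem exists_norm_sum_Ico_cpow_sub_le (K : ℕ) : ∃ C : ℝ, 0 ≤ C ∧ ∀ (s : ℂ) (n N : ℕ),
    1 ≤ n → n ≤ N →
    ‖(∑ k ∈ Finset.Ico n N, (k : ℂ) ^ (-s)) - (∫ x in (n : ℝ)..N, (x : ℂ) ^ (-s))
      - ∑ j ∈ Finset.range (K + 1), riemannZeta (-j) * risingCoeff j s *
          ((N : ℂ) ^ (-s - j) - (n : ℂ) ^ (-s - j))‖
      ≤ C * ‖risingCoeff (K + 1) s‖ * ∫ x in (n : ℝ)..N, x ^ (-s.re - (K + 1)) := by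
  obtain ⟨C, hC, hEM⟩ := exists_norm_eulerMaclaurin_le (E := ℂ) K
  refine ⟨C * ((K + 1)! : ℝ), by positivity, fun s n N hn hnN => ?_⟩
  have hn0 : (0 : ℝ) < n := by exact_mod_cast hn
  refine le_trans (le_of_eq ?_) ((hEM
    (fun j x => (-1) ^ j * (j ! : ℂ) * (risingCoeff j s * (x : ℂ) ^ (-s - j))) n N hnN
    (fun j _ x hx => (hasDerivAt_risingCoeff_mul_cpow s j
      (hn0.trans_le hx.1)).continuousAt.continuousWithinAt)
    (fun j _ x hx => hasDerivAt_risingCoeff_mul_cpow s j (hn0.trans hx.1))).trans (le_of_eq ?_))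
  · simp only [smul_sub, bernoulli_div_factorial_smul]
    simp [mul_sub, mul_assoc]
  · rw [mul_assoc C, mul_assoc C]
    congr 1
    rw [← intervalIntegral.integral_const_mul]
    refine integral_congr fun x hx => ?_
    rw [uIcc_of_le (by exact_mod_cast hnN)] at hx
    simp [Complex.norm_cpow_eq_rpow_re_of_pos (hn0.trans_le hx.1), mul_assoc]

theorem integral_rpow_neg_sub_one_le {a x y : ℝ} (ha : 1 ≤ a) (hx : 0 < x) (hxy : x ≤ y) :
    ∫ t in x..y, t ^ (-a - 1) ≤ x ^ (-a) := by
  have h0 : (0 : ℝ) ∉ uIcc x y := by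
    rw [uIcc_of_le hxy]
    exact fun h => absurd h.1 (not_le.2 hx)
  rw [integral_rpow (Or.inr ⟨by linarith, h0⟩), sub_add_cancel, div_neg, ← neg_div, neg_sub]
  refine (div_le_self (sub_nonneg.2 (Real.rpow_le_rpow_of_nonpos hx hxy (by linarith))) ha).trans ?_
  exact sub_le_self _ (Real.rpow_nonneg (hx.le.trans hxy) _)

/-- `s - 1` times the partial sum of the zeta series, corrected by its Euler–Maclaurin terms. For
`1 < Re s + K` it converges to `(s - 1) ζ(s)` as `n → ∞`. -/
noncomputable def correctedZetaSum (K n : ℕ) (s : ℂ) : ℂ :=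
  (s - 1) * (∑ k ∈ Finset.Ico 1 n, (k : ℂ) ^ (-s)
    - ∑ j ∈ Finset.range (K + 1), riemannZeta (-j) * risingCoeff j s * (n : ℂ) ^ (-s - j))
  + (n : ℂ) ^ (1 - s)

theorem exists_norm_correctedZetaSum_sub_le (K : ℕ) : ∃ C : ℝ, 0 ≤ C ∧ ∀ (s : ℂ) (n N : ℕ),
    1 ≤ s.re + K → 1 ≤ n → n ≤ N →
    ‖correctedZetaSum K N s - correctedZetaSum K n s‖
      ≤ ‖s - 1‖ * (C * ‖risingCoeff (K + 1) s‖ * (n : ℝ) ^ (-(s.re + K))) := by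
  obtain ⟨C, hC, hsum⟩ := exists_norm_sum_Ico_cpow_sub_le K
  refine ⟨C, hC, fun s n N hs hn hnN => ?_⟩
  rcases eq_or_ne s 1 with rfl | hs1
  · simp [correctedZetaSum]
  have hn0 : (0 : ℝ) < n := by exact_mod_cast hn
  have hle : (n : ℝ) ≤ N := by exact_mod_cast hnN
  have hInt := integral_rpow_neg_sub_one_le hs hn0 hle
  rw [show -(s.re + (K : ℝ)) - 1 = -s.re - (K + 1) by ring] at hInt
  refine le_trans (le_of_eq ?_) (mul_le_mul_of_nonneg_left
    ((hsum s n N hn hnN).trans (mul_le_mul_of_nonneg_left hInt (by positivity))) (norm_nonneg _))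
  have h0 : (0 : ℝ) ∉ uIcc (n : ℝ) N := by
    rw [uIcc_of_le hle]
    exact fun h => absurd h.1 (not_le.2 hn0)
  have hs0 : 1 - s ≠ 0 := sub_ne_zero.2 hs1.symm
  rw [integral_cpow (Or.inr ⟨fun h => hs1 (by simpa using congrArg Neg.neg h), h0⟩), ← norm_mul,
    show -s + 1 = 1 - s by ring]
  simp only [correctedZetaSum, mul_sub, Finset.sum_sub_distrib, Complex.ofReal_natCast,
    ← Finset.sum_Ico_consecutive (fun k : ℕ => (k : ℂ) ^ (-s)) hn hnN]
  congr 1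
  field_simp
  ring

theorem differentiable_natCast_cpow {k : ℕ} (hk : 1 ≤ k) {g : ℂ → ℂ} (hg : Differentiable ℂ g) :
    Differentiable ℂ fun s => (k : ℂ) ^ g s :=
  hg.const_cpow (Or.inl (by exact_mod_cast (by lia : k ≠ 0)))

theorem differentiable_sum_Ico_cpow_neg (n : ℕ) :
    Differentiable ℂ fun s : ℂ => ∑ k ∈ Finset.Ico 1 n, (k : ℂ) ^ (-s) :=
  Differentiable.fun_sum fun _ hk =>
    differentiable_natCast_cpow (Finset.mem_Ico.1 hk).1 differentiable_neg

theorem differentiable_sum_zeta_mul_risingCoeff_mul_cpow (K : ℕ) {n : ℕ} (hn : 1 ≤ n) :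
    Differentiable ℂ fun s : ℂ => ∑ j ∈ Finset.range (K + 1),
      riemannZeta (-j) * risingCoeff j s * (n : ℂ) ^ (-s - j) :=
  Differentiable.fun_sum fun j _ => ((differentiable_risingCoeff j).const_mul _).mul
    (differentiable_natCast_cpow hn (differentiable_neg.sub_const _))

theorem differentiable_correctedZetaSum (K : ℕ) {n : ℕ} (hn : 1 ≤ n) :
    Differentiable ℂ (correctedZetaSum K n) :=
  ((differentiable_id.sub_const 1).mul ((differentiable_sum_Ico_cpow_neg n).sub
    (differentiable_sum_zeta_mul_risingCoeff_mul_cpow K hn))).add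
      (differentiable_natCast_cpow hn (differentiable_id.const_sub 1))

theorem differentiable_update_sub_one_mul_riemannZeta :
    Differentiable ℂ (Function.update (fun s : ℂ => (s - 1) * riemannZeta s) 1 1) := by
  rw [← differentiableOn_univ,
    ← Complex.differentiableOn_compl_singleton_and_continuousAt_iff (c := 1) univ_mem]
  refine ⟨fun s hs => ?_, continuousAt_update_same.2 riemannZeta_residue_one⟩
  have hs1 : s ≠ 1 := hs.2
  refine (((differentiableAt_id.sub_const 1).mul (differentiableAt_riemannZeta
    hs1)).congr_of_eventuallyEq ?_).differentiableWithinAt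
  filter_upwards [isOpen_ne.mem_nhds hs1] with t ht
  exact Function.update_of_ne ht _ _

theorem tendsto_natCast_cpow_zero {s : ℂ} (hs : s.re < 0) :
    Tendsto (fun n : ℕ => (n : ℂ) ^ s) atTop (𝓝 0) := by
  rw [tendsto_zero_iff_norm_tendsto_zero]
  refine ((tendsto_rpow_neg_atTop (y := -s.re) (by linarith)).comp
    tendsto_natCast_atTop_atTop).congr' ?_
  filter_upwards [eventually_ge_atTop 1] with n hn
  simp [Complex.norm_natCast_cpow_of_pos (by lia : 0 < n)]

theorem tendsto_sum_Ico_cpow_neg {s : ℂ} (hs : 1 < s.re) :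
    Tendsto (fun n : ℕ => ∑ k ∈ Finset.Ico 1 n, (k : ℂ) ^ (-s)) atTop (𝓝 (riemannZeta s)) := by
  have hsum := (Complex.summable_one_div_nat_cpow.2 hs).hasSum.tendsto_sum_nat
  rw [← zeta_eq_tsum_one_div_nat_cpow hs] at hsum
  refine hsum.congr' ?_
  filter_upwards [eventually_ge_atTop 1] with n hn
  have hs0 : s ≠ 0 := by rintro rfl; simp at hs; linarith
  rw [Finset.range_eq_Ico, Finset.sum_eq_sum_Ico_succ_bot (by lia)]
  simp [Complex.zero_cpow hs0, Complex.cpow_neg]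

theorem tendsto_correctedZetaSum_of_one_lt_re (K : ℕ) {s : ℂ} (hs : 1 < s.re) :
    Tendsto (fun n => correctedZetaSum K n s) atTop (𝓝 ((s - 1) * riemannZeta s)) := by
  have hcorr : Tendsto (fun n : ℕ => ∑ j ∈ Finset.range (K + 1),
      riemannZeta (-j) * risingCoeff j s * (n : ℂ) ^ (-s - j)) atTop
      (𝓝 (∑ j ∈ Finset.range (K + 1), riemannZeta (-j) * risingCoeff j s * 0)) :=
    tendsto_finsetSum _ fun j _ => (tendsto_natCast_cpow_zero (by
      simp only [Complex.sub_re, Complex.neg_re, Complex.natCast_re]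
      linarith [Nat.cast_nonneg (α := ℝ) j])).const_mul _
  simpa only [correctedZetaSum, mul_zero, Finset.sum_const_zero, sub_zero, add_zero] using
    (((tendsto_sum_Ico_cpow_neg hs).sub hcorr).const_mul (s - 1)).add
      (tendsto_natCast_cpow_zero (by simpa using hs))

theorem tendsto_of_uniformCauchySeqOn_of_eventually_nhds {E : Type*} [NormedAddCommGroup E]
    [NormedSpace ℂ E] [CompleteSpace E] {F : ℕ → ℂ → E} {g : ℂ → E} {U : Set ℂ} {z₀ z : ℂ}
    (hU : IsOpen U) (hUc : IsPreconnected U) (hF : ∀ᶠ n in atTop, DifferentiableOn ℂ (F n) U)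
    (hg : DifferentiableOn ℂ g U) (hcauchy : UniformCauchySeqOn F atTop U) (hz₀ : z₀ ∈ U)
    (hlim : ∀ᶠ w in 𝓝 z₀, Tendsto (fun n => F n w) atTop (𝓝 (g w))) (hz : z ∈ U) :
    Tendsto (fun n => F n z) atTop (𝓝 (g z)) := by
  choose! f hf using fun w (hw : w ∈ U) => cauchySeq_tendsto_of_complete (hcauchy.cauchySeq hw)
  have hfd : DifferentiableOn ℂ f U :=
    (hcauchy.tendstoUniformlyOn_of_tendsto hf).tendstoLocallyUniformlyOn.differentiableOn hF hU
  have heq : EqOn f g U := by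
    refine (hfd.analyticOnNhd hU).eqOn_of_preconnected_of_eventuallyEq (hg.analyticOnNhd hU) hUc
      hz₀ ?_
    filter_upwards [hlim, hU.mem_nhds hz₀] with w hw hwU
    exact tendsto_nhds_unique (hf w hwU) hw
  exact heq hz ▸ hf z hz

theorem uniformCauchySeqOn_correctedZetaSum (K : ℕ) (R : ℝ) :
    UniformCauchySeqOn (correctedZetaSum K) atTop ({w | 1 - (K : ℝ) < w.re} ∩ Metric.ball 0 R) := by
  obtain ⟨C, hC, hsub⟩ := exists_norm_correctedZetaSum_sub_le K
  obtain ⟨P, hP⟩ := (isCompact_closedBall (0 : ℂ) R).exists_bound_of_continuousOn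
    (differentiable_risingCoeff (K + 1)).continuous.continuousOn
  have hbound : ∀ n N : ℕ, 1 ≤ n → n ≤ N → ∀ w ∈ {w | 1 - (K : ℝ) < w.re} ∩ Metric.ball 0 R,
      dist (correctedZetaSum K N w) (correctedZetaSum K n w) ≤ (R + 1) * (C * P) / n := by
    rintro n N hn hnN w ⟨hwre, hwR⟩
    rw [mem_ofPred_eq] at hwre
    rw [mem_ball_zero_iff] at hwR
    have hP0 : 0 ≤ P := (norm_nonneg _).trans (hP w (by simpa using hwR.le))
    have hw1 : ‖w - 1‖ ≤ R + 1 := (norm_sub_le _ _).trans (by simpa using hwR.le)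
    have hwn : (n : ℝ) ^ (-(w.re + K)) ≤ (n : ℝ)⁻¹ := by
      rw [← Real.rpow_neg_one]
      exact Real.rpow_le_rpow_of_exponent_le (by exact_mod_cast hn) (by linarith)
    rw [dist_eq_norm, div_eq_mul_inv, mul_assoc (R + 1)]
    refine (hsub w n N (by linarith) hn hnN).trans ?_
    gcongr
    · exact (norm_nonneg _).trans hw1
    · exact hP w (by simpa using hwR.le)
  rw [Metric.uniformCauchySeqOn_iff]
  intro ε hε
  obtain ⟨n, hn, hnε⟩ := ((eventually_ge_atTop 1).and ((tendsto_const_div_atTop_nhds_zero_nat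
    ((R + 1) * (C * P))).eventually_lt_const (half_pos hε))).exists
  refine ⟨n, fun i hi j hj w hw => ?_⟩
  have := dist_triangle_right (correctedZetaSum K i w) (correctedZetaSum K j w)
    (correctedZetaSum K n w)
  linarith [hbound n i hn hi w hw, hbound n j hn hj w hw]

theorem tendsto_correctedZetaSum (K : ℕ) {s : ℂ} (hs : 1 < s.re + K) (hs1 : s ≠ 1) :
    Tendsto (fun n => correctedZetaSum K n s) atTop (𝓝 ((s - 1) * riemannZeta s)) := by
  have hopen : IsOpen ({w : ℂ | 1 - (K : ℝ) < w.re} ∩ Metric.ball 0 (‖s‖ + 3)) :=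
    (isOpen_lt continuous_const Complex.continuous_re).inter Metric.isOpen_ball
  have hconv : Convex ℝ ({w : ℂ | 1 - (K : ℝ) < w.re} ∩ Metric.ball 0 (‖s‖ + 3)) :=
    (convex_halfSpace_re_gt _).inter (convex_ball 0 _)
  have htwo : (2 : ℂ) ∈ {w : ℂ | 1 - (K : ℝ) < w.re} ∩ Metric.ball 0 (‖s‖ + 3) :=
    ⟨by simp only [mem_ofPred_eq, Complex.re_ofNat]; linarith [Nat.cast_nonneg (α := ℝ) K],
      by simp; linarith [norm_nonneg s]⟩
  have hlim : ∀ᶠ w : ℂ in 𝓝 2, Tendsto (fun n => correctedZetaSum K n w) atTop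
      (𝓝 (Function.update (fun s : ℂ => (s - 1) * riemannZeta s) 1 1 w)) := by
    filter_upwards [(isOpen_lt continuous_const Complex.continuous_re).mem_nhds
      (by simp : (1 : ℝ) < (2 : ℂ).re)] with w hw
    rw [Function.update_of_ne (by rintro rfl; simp at hw)]
    exact tendsto_correctedZetaSum_of_one_lt_re K hw
  have hmem : s ∈ {w : ℂ | 1 - (K : ℝ) < w.re} ∩ Metric.ball 0 (‖s‖ + 3) :=
    ⟨by simp only [mem_ofPred_eq]; linarith, by simp⟩
  rw [← Function.update_of_ne hs1 1 fun s : ℂ => (s - 1) * riemannZeta s]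
  exact tendsto_of_uniformCauchySeqOn_of_eventually_nhds
    hopen hconv.isPreconnected
    ((eventually_ge_atTop 1).mono fun n hn =>
      (differentiable_correctedZetaSum K hn).differentiableOn)
    differentiable_update_sub_one_mul_riemannZeta.differentiableOn
    (uniformCauchySeqOn_correctedZetaSum K _) htwo hlim hmem

/-- The main term `ζ(s) + n ^ (1 - s) / (1 - s)` of `∑_{k < n} k ^ (-s)`, continued to `s = 1`. -/
noncomputable def zetaSumMain (n : ℕ) (s : ℂ) : ℂ :=
  if s = 1 then (Real.log n : ℂ) + Real.eulerMascheroniConstant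
  else riemannZeta s + (n : ℂ) ^ (1 - s) / (1 - s)

theorem tendsto_zetaSumMain_one {n : ℕ} (hn : 1 ≤ n) :
    Tendsto (zetaSumMain n) (𝓝[≠] 1) (𝓝 (zetaSumMain n 1)) := by
  have hn0 : (n : ℂ) ≠ 0 := by exact_mod_cast (by lia : n ≠ 0)
  have hslope : Tendsto (fun s : ℂ => ((n : ℂ) ^ (1 - s) - 1) / (1 - s)) (𝓝[≠] 1)
      (𝓝 (Real.log n)) := by
    have hderiv : HasDerivAt (fun s : ℂ => (n : ℂ) ^ (1 - s)) (-(Real.log n : ℂ)) 1 := by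
      simpa [Complex.natCast_log] using ((hasDerivAt_id (1 : ℂ)).const_sub 1).const_cpow
        (c := (n : ℂ)) (Or.inl hn0)
    have h := (hasDerivAt_iff_tendsto_slope.1 hderiv).neg
    rw [neg_neg] at h
    refine h.congr fun s => ?_
    rw [slope_def_field, sub_self, Complex.cpow_zero, ← div_neg, neg_sub]
  have h := hslope.add tendsto_riemannZeta_sub_one_div
  rw [zetaSumMain, if_pos rfl]
  refine h.congr' ?_
  filter_upwards [self_mem_nhdsWithin] with s hs
  have hs1 : 1 - s ≠ 0 := sub_ne_zero.2 (Ne.symm hs)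
  rw [zetaSumMain, if_neg (by simpa using hs), ← neg_sub 1 s]
  field_simp
  ring

theorem exists_norm_sum_Ico_cpow_sub_riemannZeta_le (K : ℕ) : ∃ C : ℝ, 0 ≤ C ∧
    ∀ (s : ℂ) (n : ℕ), 1 < s.re + K → s ≠ 1 → 1 ≤ n →
    ‖(∑ k ∈ Finset.Ico 1 n, (k : ℂ) ^ (-s)) - (riemannZeta s + (n : ℂ) ^ (1 - s) / (1 - s)
      + ∑ j ∈ Finset.range (K + 1), riemannZeta (-j) * risingCoeff j s * (n : ℂ) ^ (-s - j))‖
      ≤ C * ‖risingCoeff (K + 1) s‖ * (n : ℝ) ^ (-(s.re + K)) := by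
  obtain ⟨C, hC, hsub⟩ := exists_norm_correctedZetaSum_sub_le K
  refine ⟨C, hC, fun s n hs hs1 hn => ?_⟩
  have hlim := le_of_tendsto
    ((tendsto_correctedZetaSum K hs hs1).sub_const (correctedZetaSum K n s)).norm
    ((eventually_ge_atTop n).mono fun N hN => hsub s n N hs.le hn hN)
  have hs0 : 1 - s ≠ 0 := sub_ne_zero.2 hs1.symm
  refine le_of_mul_le_mul_left (hlim.trans' (le_of_eq ?_)) (norm_pos_iff.2 (sub_ne_zero.2 hs1))
  rw [← norm_mul, ← norm_neg, correctedZetaSum]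
  congr 1
  field_simp
  ring

theorem exists_norm_sum_Ico_cpow_sub_zetaSumMain_le (K : ℕ) : ∃ C : ℝ, 0 ≤ C ∧
    ∀ (s : ℂ) (n : ℕ), 1 < s.re + K → 1 ≤ n →
    ‖(∑ k ∈ Finset.Ico 1 n, (k : ℂ) ^ (-s)) - (zetaSumMain n s
      + ∑ j ∈ Finset.range (K + 1), riemannZeta (-j) * risingCoeff j s * (n : ℂ) ^ (-s - j))‖
      ≤ C * ‖risingCoeff (K + 1) s‖ * (n : ℝ) ^ (-(s.re + K)) := by
  obtain ⟨C, hC, hzeta⟩ := exists_norm_sum_Ico_cpow_sub_riemannZeta_le K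
  refine ⟨C, hC, fun s n hs hn => ?_⟩
  rcases ne_or_eq s 1 with hs1 | rfl
  · simpa only [zetaSumMain, if_neg hs1] using hzeta s n hs hs1 hn
  have hn0 : (n : ℝ) ≠ 0 := by exact_mod_cast (by lia : n ≠ 0)
  have hleft := (((differentiable_sum_Ico_cpow_neg n).continuous.tendsto 1).mono_left
    nhdsWithin_le_nhds).sub ((tendsto_zetaSumMain_one hn).add
      (((differentiable_sum_zeta_mul_risingCoeff_mul_cpow K hn).continuous.tendsto 1).mono_left
        nhdsWithin_le_nhds))
  have hright : Continuous fun s : ℂ => C * ‖risingCoeff (K + 1) s‖ * (n : ℝ) ^ (-(s.re + K)) :=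
    (continuous_const.mul (differentiable_risingCoeff _).continuous.norm).mul
      (continuous_const.rpow (by fun_prop) fun _ => Or.inl hn0)
  refine le_of_tendsto_of_tendsto hleft.norm ((hright.tendsto 1).mono_left nhdsWithin_le_nhds) ?_
  have hre : ∀ᶠ s : ℂ in 𝓝[≠] 1, 1 < s.re + K := nhdsWithin_le_nhds
    ((isOpen_lt continuous_const (by fun_prop)).mem_nhds hs)
  filter_upwards [hre, self_mem_nhdsWithin] with s hs hs1
  simpa only [zetaSumMain, if_neg (show s ≠ 1 from hs1)] using hzeta s n hs hs1 hn

end ZetaPartialSums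

section BinomialRemainder

open Set Topology

/-- The Taylor remainder of order `a` at `y = 0` of `(1 - y) ^ (-s)`. -/
noncomputable def binomRem (a : ℕ) (s : ℂ) (y : ℝ) : ℂ :=
  ((1 - y : ℝ) : ℂ) ^ (-s) - ∑ i ∈ Finset.range a, risingCoeff i s * (y : ℂ) ^ i

/-- The Taylor remainder of order `a` of `(1 - y) ^ (-s)` divided by `y ^ a`, continued to
`y = 0`. -/
noncomputable def binomQuot (a : ℕ) (s : ℂ) (y : ℝ) : ℂ :=
  if y = 0 then risingCoeff a s else binomRem a s y / (y : ℂ) ^ a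

theorem binomRem_eq_add (a : ℕ) (s : ℂ) (y : ℝ) :
    binomRem a s y = binomRem (a + 1) s y + risingCoeff a s * (y : ℂ) ^ a := by
  simp only [binomRem, Finset.sum_range_succ]
  ring

theorem binomRem_succ_zero_right (a : ℕ) (s : ℂ) : binomRem (a + 1) s 0 = 0 := by
  simp [binomRem, Finset.sum_range_succ']

theorem binomQuot_zero_right (a : ℕ) (s : ℂ) : binomQuot a s 0 = risingCoeff a s := if_pos rfl

theorem binomQuot_of_ne_zero (a : ℕ) (s : ℂ) {y : ℝ} (hy : y ≠ 0) :
    binomQuot a s y = binomRem a s y / (y : ℂ) ^ a := if_neg hy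

theorem binomQuot_eventuallyEq (a : ℕ) (s : ℂ) {y : ℝ} (hy : y ≠ 0) :
    binomQuot a s =ᶠ[𝓝 y] fun y => binomRem a s y / (y : ℂ) ^ a :=
  (isOpen_ne.eventually_mem hy).mono fun _ ht => binomQuot_of_ne_zero a s ht

theorem binomQuot_one_right (a : ℕ) {s : ℂ} (hs : s ≠ 0) :
    binomQuot a s 1 = -∑ i ∈ Finset.range a, risingCoeff i s := by
  simp [binomQuot, binomRem, Complex.zero_cpow (neg_ne_zero.2 hs)]

theorem binomQuot_eq_add (a : ℕ) (s : ℂ) (y : ℝ) :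
    binomQuot a s y = risingCoeff a s + y * binomQuot (a + 1) s y := by
  rcases eq_or_ne y 0 with rfl | hy
  · simp [binomQuot_zero_right]
  · have hyc : (y : ℂ) ≠ 0 := by exact_mod_cast hy
    rw [binomQuot_of_ne_zero a s hy, binomQuot_of_ne_zero _ s hy, binomRem_eq_add a]
    field_simp
    ring

theorem hasDerivAt_one_sub_cpow_neg (s : ℂ) {y : ℝ} (hy : y < 1) :
    HasDerivAt (fun y : ℝ => ((1 - y : ℝ) : ℂ) ^ (-s))
      (s * ((1 - y : ℝ) : ℂ) ^ (-(s + 1))) y := by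
  refine ((hasDerivAt_ofReal_cpow_neg s (sub_pos.2 hy)).scomp y
    ((hasDerivAt_id y).const_sub 1)).congr_deriv ?_
  rw [neg_add', neg_smul, one_smul, neg_mul, neg_neg]

theorem hasDerivAt_binomRem_succ (a : ℕ) (s : ℂ) {y : ℝ} (hy : y < 1) :
    HasDerivAt (binomRem (a + 1) s) (s * binomRem a (s + 1) y) y := by
  have hpoly : HasDerivAt
      (fun y : ℝ => ∑ i ∈ Finset.range (a + 1), risingCoeff i s * (y : ℂ) ^ i)
      (∑ i ∈ Finset.range (a + 1), risingCoeff i s * (i * (y : ℂ) ^ (i - 1))) y :=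
    HasDerivAt.fun_sum fun i _ => ((hasDerivAt_pow i (y : ℂ)).comp_ofReal).const_mul _
  refine ((hasDerivAt_one_sub_cpow_neg s hy).sub hpoly).congr_deriv ?_
  simp only [Finset.sum_range_succ', binomRem, mul_sub, Finset.mul_sum, Nat.cast_zero, zero_mul,
    mul_zero, add_zero]
  congr 1
  refine Finset.sum_congr rfl fun i _ => ?_
  push_cast
  linear_combination (y : ℂ) ^ i * add_one_mul_risingCoeff_succ' i s

theorem hasDerivAt_binomQuot_succ (a : ℕ) (s : ℂ) {y : ℝ} (hy0 : y ≠ 0) (hy : y < 1) :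
    HasDerivAt (binomQuot (a + 1) s)
      (-(a + 1 : ℕ) * binomQuot (a + 2) s y + s * binomQuot (a + 1) (s + 1) y) y := by
  have hyc : (y : ℂ) ≠ 0 := by exact_mod_cast hy0
  refine (((hasDerivAt_binomRem_succ a s hy).div ((hasDerivAt_pow (a + 1) (y : ℂ)).comp_ofReal)
    (pow_ne_zero _ hyc)).congr_of_eventuallyEq (binomQuot_eventuallyEq _ s hy0)).congr_deriv ?_
  simp only [binomQuot_of_ne_zero _ _ hy0]
  rw [binomRem_eq_add a (s + 1), binomRem_eq_add (a + 1) s]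
  push_cast
  field_simp
  linear_combination (-y ^ (3 * a + 3) : ℂ) * add_one_mul_risingCoeff_succ' a s

theorem norm_one_sub_cpow_neg_le_one {s : ℂ} (hs : s.re ≤ 0) {y : ℝ} (hy : y ∈ Icc (0 : ℝ) 1) :
    ‖((1 - y : ℝ) : ℂ) ^ (-s)‖ ≤ 1 := by
  refine (Complex.norm_cpow_le _ _).trans ?_
  rw [Complex.arg_ofReal_of_nonneg (by linarith [hy.2]), Complex.norm_real,
    Real.norm_of_nonneg (by linarith [hy.2])]
  simpa using Real.rpow_le_one (by linarith [hy.2]) (by linarith [hy.1]) (by simpa using hs)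

theorem continuous_binomRem (a : ℕ) {s : ℂ} (hs : s.re < 0) : Continuous (binomRem a s) := by
  have hpow : Continuous fun y : ℝ => ((1 - y : ℝ) : ℂ) ^ (-s) :=
    (Complex.continuous_ofReal_cpow_const (by simpa using hs)).comp (continuous_sub_left 1)
  unfold binomRem
  fun_prop

theorem norm_binomRem_le (a : ℕ) {s : ℂ} (hs : s.re + a ≤ 0) {y : ℝ} (hy : y ∈ Icc (0 : ℝ) 1) :
    ‖binomRem a s y‖ ≤ (∏ l ∈ Finset.range a, ‖s + l‖) * y ^ a := by
  induction a generalizing s y with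
  | zero => simpa [binomRem] using norm_one_sub_cpow_neg_le_one (by simpa using hs) hy
  | succ a ih =>
    push_cast at hs
    have hderiv : ∀ t ∈ Ico (0 : ℝ) y,
        ‖s * binomRem a (s + 1) t‖ ≤ ‖s‖ * ((∏ l ∈ Finset.range a, ‖s + 1 + l‖) * y ^ a) := by
      intro t ht
      rw [norm_mul]
      have hrem := ih (s := s + 1) (by rw [Complex.add_re, Complex.one_re]; linarith)
        ⟨ht.1, ht.2.le.trans hy.2⟩
      have ht0 := ht.1
      have hty := ht.2.le
      exact mul_le_mul_of_nonneg_left (hrem.trans (by gcongr)) (norm_nonneg _)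
    have hsre : s.re < 0 := by linarith [Nat.cast_nonneg (α := ℝ) a]
    have hmvt := norm_image_sub_le_of_norm_deriv_right_le_segment
      (continuous_binomRem (a + 1) hsre).continuousOn
      (fun t ht => (hasDerivAt_binomRem_succ a s (ht.2.trans_le hy.2)).hasDerivWithinAt)
      hderiv y ⟨hy.1, le_rfl⟩
    rw [binomRem_succ_zero_right, sub_zero, sub_zero] at hmvt
    refine hmvt.trans (le_of_eq ?_)
    have hshift : ∀ l : ℕ, s + 1 + l = s + (l + 1 : ℕ) := fun l => by push_cast; ring
    simp only [Finset.prod_range_succ', hshift, Nat.cast_zero, add_zero]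
    ring

theorem norm_risingCoeff_le_prod (a : ℕ) (s : ℂ) :
    ‖risingCoeff a s‖ ≤ ∏ l ∈ Finset.range a, ‖s + l‖ := by
  rw [risingCoeff, norm_prod]
  refine Finset.prod_le_prod (fun _ _ => norm_nonneg _) fun l _ => ?_
  rw [norm_div]
  refine div_le_self (norm_nonneg _) ?_
  rw [← Nat.cast_add_one, Complex.norm_natCast]
  simp

theorem norm_binomQuot_le (a : ℕ) {s : ℂ} (hs : s.re + a ≤ 0) {y : ℝ} (hy : y ∈ Icc (0 : ℝ) 1) :
    ‖binomQuot a s y‖ ≤ ∏ l ∈ Finset.range a, ‖s + l‖ := by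
  rcases hy.1.eq_or_lt with rfl | hy0
  · simpa [binomQuot_zero_right] using norm_risingCoeff_le_prod a s
  · rw [binomQuot_of_ne_zero a s hy0.ne', norm_div, norm_pow, Complex.norm_real,
      Real.norm_of_nonneg hy.1, div_le_iff₀ (by positivity)]
    exact norm_binomRem_le a hs hy

theorem continuousOn_binomQuot (a : ℕ) {s : ℂ} (hs : s.re + a + 1 ≤ 0) :
    ContinuousOn (binomQuot a s) (Icc 0 1) := by
  intro y hy
  rcases hy.1.eq_or_lt with rfl | hy0
  · have hlip : ∀ t ∈ Icc (0 : ℝ) 1, ‖binomQuot a s t - binomQuot a s 0‖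
        ≤ t * ∏ l ∈ Finset.range (a + 1), ‖s + l‖ := fun t ht => by
      rw [binomQuot_zero_right, binomQuot_eq_add, add_sub_cancel_left, norm_mul, Complex.norm_real,
        Real.norm_of_nonneg ht.1]
      exact mul_le_mul_of_nonneg_left (norm_binomQuot_le (a + 1) (by push_cast; linarith) ht) ht.1
    have hzero : Tendsto (fun t : ℝ => t * ∏ l ∈ Finset.range (a + 1), ‖s + l‖) (𝓝[Icc 0 1] 0)
        (𝓝 0) := by
      have h := (tendsto_id (α := ℝ) (x := 𝓝 0)).mul_const (∏ l ∈ Finset.range (a + 1), ‖s + l‖)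
      rw [zero_mul] at h
      exact h.mono_left nhdsWithin_le_nhds
    rw [ContinuousWithinAt, tendsto_iff_norm_sub_tendsto_zero]
    exact squeeze_zero' (Eventually.of_forall fun _ => norm_nonneg _)
      (eventually_mem_nhdsWithin.mono hlip) hzero
  · have hsre : s.re < 0 := by linarith [Nat.cast_nonneg (α := ℝ) a]
    exact (((continuous_binomRem a hsre).continuousAt.div (by fun_prop)
      (pow_ne_zero _ (by exact_mod_cast hy0.ne'))).congr
        (binomQuot_eventuallyEq a s hy0.ne').symm).continuousWithinAt

/-- The `j`-th derivative of `binomQuot a s`, defined by a recursion that stays within the family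
`binomQuot a s`. -/
noncomputable def binomQuotDeriv : ℕ → ℕ → ℂ → ℝ → ℂ
  | 0, a, s, y => binomQuot a s y
  | j + 1, a, s, y => -(a : ℂ) * binomQuotDeriv j (a + 1) s y + s * binomQuotDeriv j a (s + 1) y

theorem hasDerivAt_binomQuotDeriv_succ (j a : ℕ) (s : ℂ) {y : ℝ} (hy0 : y ≠ 0) (hy : y < 1) :
    HasDerivAt (binomQuotDeriv j (a + 1) s) (binomQuotDeriv (j + 1) (a + 1) s y) y := by
  induction j generalizing a s with
  | zero => exact hasDerivAt_binomQuot_succ a s hy0 hy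
  | succ j ih => exact ((ih (a + 1) s).const_mul _).add ((ih a (s + 1)).const_mul _)

theorem continuousOn_binomQuotDeriv (j a : ℕ) {s : ℂ} (hs : s.re + a + j + 1 ≤ 0) :
    ContinuousOn (binomQuotDeriv j a s) (Icc 0 1) := by
  induction j generalizing a s with
  | zero => exact continuousOn_binomQuot a (by simpa using hs)
  | succ j ih =>
    push_cast at hs
    exact ((ih (a + 1) (by push_cast; linarith)).const_mul _).add
      ((ih a (by rw [Complex.add_re, Complex.one_re]; linarith)).const_mul _)

theorem exists_norm_binomQuotDeriv_le (j a : ℕ) (R : ℝ) : ∃ C : ℝ, ∀ s : ℂ, ‖s‖ ≤ R →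
    s.re + a + j ≤ 0 → ∀ y ∈ Icc (0 : ℝ) 1, ‖binomQuotDeriv j a s y‖ ≤ C := by
  induction j generalizing a R with
  | zero =>
    refine ⟨∏ l ∈ Finset.range a, (R + l), fun s hs hre y hy =>
      (norm_binomQuot_le a (by simpa using hre) hy).trans ?_⟩
    exact Finset.prod_le_prod (fun _ _ => norm_nonneg _) fun l _ =>
      (norm_add_le _ _).trans (by simpa using hs)
  | succ j ih =>
    obtain ⟨C₁, hC₁⟩ := ih (a + 1) R
    obtain ⟨C₂, hC₂⟩ := ih a (R + 1)
    refine ⟨a * C₁ + R * C₂, fun s hs hre y hy => (norm_add_le _ _).trans ?_⟩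
    push_cast at hre
    have h₁ := hC₁ s hs (by push_cast; linarith) y hy
    have h₂ := hC₂ (s + 1) ((norm_add_le _ _).trans (by simpa using hs))
      (by rw [Complex.add_re, Complex.one_re]; linarith) y hy
    have hR := (norm_nonneg s).trans hs
    rw [norm_mul, norm_mul, norm_neg, Complex.norm_natCast]
    gcongr

theorem binomQuotDeriv_zero_right (j a : ℕ) (s : ℂ) :
    binomQuotDeriv j a s 0 = (j ! : ℂ) * risingCoeff (a + j) s := by
  induction j generalizing a s with
  | zero => simp [binomQuotDeriv, binomQuot_zero_right]
  | succ j ih =>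
    rw [binomQuotDeriv, ih, ih, Nat.factorial_succ, add_right_comm, ← add_assoc]
    have h := add_one_mul_risingCoeff_succ' (a + j) s
    push_cast at *
    linear_combination (-(j ! : ℂ)) * h

theorem binomQuotDeriv_one_right (j a : ℕ) {s : ℂ} (hs : s.re + j < 0) :
    binomQuotDeriv j a s 1 = -∑ i ∈ Finset.range a,
      risingCoeff i s * ((-1) ^ j * (j ! : ℂ) * risingCoeff j ((a : ℂ) - i)) := by
  induction j generalizing a s with
  | zero =>
    have hs0 : s ≠ 0 := by rintro rfl; simp at hs
    simp [binomQuotDeriv, binomQuot_one_right a hs0]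
  | succ j ih =>
    push_cast at hs
    have hshift : ∑ i ∈ Finset.range a, s * (risingCoeff i (s + 1) *
          ((-1) ^ j * (j ! : ℂ) * risingCoeff j ((a : ℂ) - i)))
        = ∑ i ∈ Finset.range (a + 1), i * (risingCoeff i s *
          ((-1) ^ j * (j ! : ℂ) * risingCoeff j ((a : ℂ) + 1 - i))) := by
      rw [Finset.sum_range_succ', Nat.cast_zero, zero_mul, add_zero]
      refine Finset.sum_congr rfl fun i _ => ?_
      rw [show (a : ℂ) + 1 - (i + 1 : ℕ) = a - i by push_cast; ring]
      push_cast
      linear_combination (-((-1) ^ j * (j ! : ℂ) * risingCoeff j ((a : ℂ) - i))) *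
        add_one_mul_risingCoeff_succ' i s
    rw [binomQuotDeriv, ih _ (by linarith),
      ih _ (by rw [Complex.add_re, Complex.one_re]; linarith), mul_neg s, Finset.mul_sum, hshift,
      neg_mul_neg, Finset.mul_sum, ← sub_eq_add_neg, Nat.cast_add_one, ← Finset.sum_sub_distrib,
      Finset.sum_range_succ, ← Finset.sum_neg_distrib, add_eq_left.2 (by ring)]
    refine Finset.sum_congr rfl fun i _ => ?_
    have h := add_one_mul_risingCoeff_succ' j ((a : ℂ) - i)
    rw [show (a : ℂ) - i + 1 = a + 1 - i by ring] at h
    rw [Nat.factorial_succ]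
    push_cast
    linear_combination (-risingCoeff i s * ((-1) ^ j * (j ! : ℂ))) * h

end BinomialRemainder

section HarmonicSeries

open Topology

/-- `∑_{k ≥ 1} (1 / (k - s) - 1 / k)`, the interpolation of the harmonic numbers by
`harmonicSeries (-n) = -H_n`. -/
noncomputable def harmonicSeries (s : ℂ) : ℂ :=
  ∑' k : ℕ, (1 / ((k : ℂ) + 1 - s) - 1 / ((k : ℂ) + 1))

theorem half_mul_le_norm_add_one_sub {s : ℂ} (hs : s.re ≤ 1 / 2) (k : ℕ) :
    ((k : ℝ) + 1) / 2 ≤ ‖(k : ℂ) + 1 - s‖ := by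
  refine le_trans ?_ (Complex.re_le_norm _)
  simp only [Complex.sub_re, Complex.add_re, Complex.natCast_re, Complex.one_re]
  linarith [Nat.cast_nonneg (α := ℝ) k]

theorem add_one_sub_ne_zero {s : ℂ} (hs : s.re ≤ 1 / 2) (k : ℕ) : (k : ℂ) + 1 - s ≠ 0 :=
  norm_pos_iff.1 ((by positivity : 0 < ((k : ℝ) + 1) / 2).trans_le
    (half_mul_le_norm_add_one_sub hs k))

theorem norm_one_div_add_one_sub_le {s : ℂ} (hs : s.re ≤ 1 / 2) (k : ℕ) :
    ‖1 / ((k : ℂ) + 1 - s)‖ ≤ 2 * (1 / ((k : ℝ) + 1)) := by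
  rw [norm_div, norm_one]
  calc 1 / ‖(k : ℂ) + 1 - s‖ ≤ 1 / (((k : ℝ) + 1) / 2) := by
        gcongr
        exact half_mul_le_norm_add_one_sub hs k
    _ = 2 * (1 / ((k : ℝ) + 1)) := by field_simp

theorem norm_harmonicSeries_term_le {s : ℂ} (hs : s.re ≤ 1 / 2) (k : ℕ) :
    ‖1 / ((k : ℂ) + 1 - s) - 1 / ((k : ℂ) + 1)‖ ≤ 2 * ‖s‖ * (1 / ((k + 1 : ℕ) : ℝ) ^ 2) := by
  have hk : (k : ℂ) + 1 ≠ 0 := by exact_mod_cast k.succ_ne_zero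
  have hks := add_one_sub_ne_zero hs k
  have hterm : 1 / ((k : ℂ) + 1 - s) - 1 / ((k : ℂ) + 1)
      = s * (1 / ((k : ℂ) + 1 - s)) * (1 / ((k + 1 : ℕ) : ℂ)) := by
    push_cast
    field_simp
    ring
  rw [hterm, norm_mul, norm_mul, norm_div 1 ((k + 1 : ℕ) : ℂ), norm_one, Complex.norm_natCast]
  push_cast
  calc _ ≤ ‖s‖ * (2 * (1 / ((k : ℝ) + 1))) * (1 / ((k : ℝ) + 1)) := by
        gcongr
        exact norm_one_div_add_one_sub_le hs k
    _ = _ := by field_simp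

theorem summable_const_mul_one_div_succ_sq (c : ℝ) :
    Summable fun k : ℕ => c * (1 / ((k + 1 : ℕ) : ℝ) ^ 2) :=
  ((summable_nat_add_iff 1).2 (Real.summable_one_div_nat_pow.2 one_lt_two)).mul_left c

theorem hasSum_harmonicSeries {s : ℂ} (hs : s.re ≤ 1 / 2) :
    HasSum (fun k : ℕ => 1 / ((k : ℂ) + 1 - s) - 1 / ((k : ℂ) + 1)) (harmonicSeries s) :=
  (Summable.of_norm_bounded (summable_const_mul_one_div_succ_sq _)
    (norm_harmonicSeries_term_le hs)).hasSum

theorem harmonicSeries_sub_one {s : ℂ} (hs : s.re ≤ 1 / 2) :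
    harmonicSeries (s - 1) = harmonicSeries s - 1 / (1 - s) := by
  have hshift := (hasSum_harmonicSeries (s := s - 1)
    (by rw [Complex.sub_re, Complex.one_re]; linarith)).tendsto_sum_nat
  have hzero : Tendsto (fun k : ℕ => 1 / ((k : ℂ) + 1 - s)) atTop (𝓝 0) :=
    squeeze_zero_norm (norm_one_div_add_one_sub_le hs)
      (by simpa using (tendsto_one_div_add_atTop_nhds_zero_nat (𝕜 := ℝ)).const_mul 2)
  have hlim := ((hasSum_harmonicSeries hs).tendsto_sum_nat.add hzero).sub_const (1 / (1 - s))
  rw [add_zero] at hlim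
  refine tendsto_nhds_unique hshift (hlim.congr fun n => ?_)
  induction n with
  | zero => simp
  | succ n ih =>
    rw [Finset.sum_range_succ, Finset.sum_range_succ, ← ih,
      show (n : ℂ) + 1 - (s - 1) = (n + 1 : ℕ) + 1 - s by push_cast; ring]
    ring

theorem differentiableOn_harmonicSeries :
    DifferentiableOn ℂ harmonicSeries (Metric.ball 0 (1 / 2)) := by
  have hre : ∀ w ∈ Metric.ball (0 : ℂ) (1 / 2), w.re ≤ 1 / 2 := fun w hw =>
    (Complex.re_le_norm w).trans (mem_ball_zero_iff.1 hw).le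
  refine Complex.differentiableOn_tsum_of_summable_norm (summable_const_mul_one_div_succ_sq 1)
    (fun k w hw => ?_) Metric.isOpen_ball fun k w hw => ?_
  · exact ((DifferentiableAt.div (by fun_prop) (by fun_prop)
      (add_one_sub_ne_zero (hre w hw) k)).sub_const _).differentiableWithinAt
  · refine (norm_harmonicSeries_term_le (hre w hw) k).trans ?_
    have : 2 * ‖w‖ ≤ 1 := by linarith [mem_ball_zero_iff.1 hw]
    gcongr

end HarmonicSeries

section IntegralBinomQuot

open MeasureTheory Set Topology

theorem integral_one_sub_cpow {z : ℂ} (hz : -1 < z.re) :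
    ∫ y in (0 : ℝ)..1, ((1 - y : ℝ) : ℂ) ^ z = 1 / (z + 1) := by
  have hz1 : z + 1 ≠ 0 := by
    intro h
    have := congrArg Complex.re h
    simp only [Complex.add_re, Complex.one_re, Complex.zero_re] at this
    linarith
  rw [intervalIntegral.integral_comp_sub_left (fun x : ℝ => (x : ℂ) ^ z), sub_self, sub_zero,
    integral_cpow (Or.inl hz), Complex.ofReal_one, Complex.one_cpow, Complex.ofReal_zero,
    Complex.zero_cpow hz1, sub_zero]

theorem intervalIntegrable_one_sub_pow_mul_binomQuot (n a : ℕ) {s : ℂ} (hs : s.re + a + 1 ≤ 0) :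
    IntervalIntegrable (fun y : ℝ => ((1 - y : ℝ) : ℂ) ^ n * binomQuot a s y) volume 0 1 := by
  refine ContinuousOn.intervalIntegrable ?_
  rw [uIcc_of_le zero_le_one]
  exact ContinuousOn.mul (by fun_prop) (continuousOn_binomQuot a hs)

theorem integral_one_sub_pow_mul_binomQuot_one_sub {s : ℂ} (hs : s.re + 2 ≤ 0) (n : ℕ) :
    (∫ y in (0 : ℝ)..1, ((1 - y : ℝ) : ℂ) ^ n * binomQuot 1 s y)
      - ∫ y in (0 : ℝ)..1, ((1 - y : ℝ) : ℂ) ^ (n + 1) * binomQuot 1 s y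
      = 1 / ((n : ℂ) + 1 - s) - 1 / ((n : ℂ) + 1) := by
  have hn : -1 < (n : ℂ).re := by simpa using by linarith [Nat.cast_nonneg (α := ℝ) n]
  have hns : -1 < ((n : ℂ) - s).re := by rw [Complex.sub_re]; linarith
  have hre : s.re + (1 : ℕ) + 1 ≤ 0 := by push_cast; linarith
  have hInt : ∀ {z : ℂ}, -1 < z.re →
      IntervalIntegrable (fun y : ℝ => ((1 - y : ℝ) : ℂ) ^ z) volume 0 1 := fun hz => by
    simpa using (intervalIntegral.intervalIntegrable_cpow' (a := 1) (b := 0) hz).comp_sub_left 1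
      (by simp)
  rw [← intervalIntegral.integral_sub (intervalIntegrable_one_sub_pow_mul_binomQuot n 1 hre)
    (intervalIntegrable_one_sub_pow_mul_binomQuot (n + 1) 1 hre),
    show (n : ℂ) + 1 - s = n - s + 1 by ring, ← integral_one_sub_cpow hn,
    ← integral_one_sub_cpow hns, ← intervalIntegral.integral_sub (hInt hns) (hInt hn)]
  refine intervalIntegral.integral_congr_Ioo_of_le zero_le_one fun y hy => ?_
  have hy0 : (y : ℂ) ≠ 0 := by exact_mod_cast hy.1.ne'
  have hy1 : ((1 - y : ℝ) : ℂ) ≠ 0 := by exact_mod_cast (sub_pos.2 hy.2).ne'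
  rw [sub_eq_add_neg (n : ℂ), Complex.cpow_add _ _ hy1, Complex.cpow_natCast,
    binomQuot_of_ne_zero 1 s hy.1.ne', binomRem]
  push_cast
  field_simp
  simp
  ring

theorem norm_integral_one_sub_pow_mul_binomQuot_one_le {s : ℂ} (hs : s.re + 1 ≤ 0) (n : ℕ) :
    ‖∫ y in (0 : ℝ)..1, ((1 - y : ℝ) : ℂ) ^ n * binomQuot 1 s y‖ ≤ ‖s‖ * (1 / ((n : ℝ) + 1)) := by
  have hpow : ∫ y in (0 : ℝ)..1, ‖s‖ * (1 - y) ^ n = ‖s‖ * (1 / ((n : ℝ) + 1)) := by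
    rw [intervalIntegral.integral_const_mul,
      intervalIntegral.integral_comp_sub_left (fun x : ℝ => x ^ n)]
    simp
  rw [← hpow]
  refine intervalIntegral.norm_integral_le_of_norm_le zero_le_one (ae_of_all _ fun y hy => ?_)
    (Continuous.intervalIntegrable (by fun_prop) _ _)
  have hquot := norm_binomQuot_le 1 (by exact_mod_cast hs) (Ioc_subset_Icc_self hy)
  simp only [Finset.prod_range_one, Nat.cast_zero, add_zero] at hquot
  have hy1 : 0 ≤ 1 - y := sub_nonneg.2 hy.2
  rw [norm_mul, norm_pow, Complex.norm_real, Real.norm_of_nonneg hy1, mul_comm]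
  gcongr

theorem integral_binomQuot_one {s : ℂ} (hs : s.re + 2 ≤ 0) :
    ∫ y in (0 : ℝ)..1, binomQuot 1 s y = harmonicSeries s := by
  have hpartial : ∀ n : ℕ, ∑ k ∈ Finset.range n, (1 / ((k : ℂ) + 1 - s) - 1 / ((k : ℂ) + 1))
      = (∫ y in (0 : ℝ)..1, binomQuot 1 s y)
        - ∫ y in (0 : ℝ)..1, ((1 - y : ℝ) : ℂ) ^ n * binomQuot 1 s y := fun n => by
    simp only [← integral_one_sub_pow_mul_binomQuot_one_sub hs, Finset.sum_range_sub', pow_zero,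
      one_mul]
  have htail : Tendsto (fun n : ℕ => ∫ y in (0 : ℝ)..1, ((1 - y : ℝ) : ℂ) ^ n * binomQuot 1 s y)
      atTop (𝓝 0) :=
    squeeze_zero_norm (norm_integral_one_sub_pow_mul_binomQuot_one_le (by linarith))
      (by simpa using (tendsto_one_div_add_atTop_nhds_zero_nat (𝕜 := ℝ)).const_mul ‖s‖)
  have hlim := (hasSum_harmonicSeries (by linarith : s.re ≤ 1 / 2)).tendsto_sum_nat
  simp only [hpartial] at hlim
  refine tendsto_nhds_unique ?_ hlim
  simpa using htail.const_sub (∫ y in (0 : ℝ)..1, binomQuot 1 s y)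

theorem add_one_mul_deriv_risingCoeff_succ (N : ℕ) (s : ℂ) :
    (N + 1) * deriv (risingCoeff (N + 1)) s
      = risingCoeff N (s + 1) + s * deriv (risingCoeff N) (s + 1) := by
  have hleft := ((differentiable_risingCoeff (N + 1)) s).hasDerivAt.const_mul ((N : ℂ) + 1)
  have hright := (hasDerivAt_id s).mul
    (((differentiable_risingCoeff N) (s + 1)).hasDerivAt.comp_add_const s 1)
  rw [one_mul] at hright
  refine hleft.unique (hright.congr_of_eventuallyEq (Eventually.of_forall fun s => ?_))
  exact add_one_mul_risingCoeff_succ' N s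

theorem add_one_mul_integral_binomQuot_add_two (N : ℕ) {s : ℂ} (hs : s.re + N + 3 ≤ 0) :
    (N + 1) * ∫ y in (0 : ℝ)..1, binomQuot (N + 2) s y
      = s * (∫ y in (0 : ℝ)..1, binomQuot (N + 1) (s + 1) y)
        + ∑ i ∈ Finset.range (N + 2), risingCoeff i s := by
  have hInt : ∀ (a : ℕ) (w : ℂ), w.re + a + 1 ≤ 0 →
      IntervalIntegrable (binomQuot a w) volume 0 1 := fun a w hw => by
    simpa using intervalIntegrable_one_sub_pow_mul_binomQuot 0 a hw
  have hInt₂ := (hInt (N + 2) s (by push_cast; linarith)).const_mul (-((N + 1 : ℕ) : ℂ))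
  have hInt₁ := (hInt (N + 1) (s + 1)
    (by rw [Complex.add_re, Complex.one_re]; push_cast; linarith)).const_mul s
  have hs0 : s ≠ 0 := by
    rintro rfl
    simp only [Complex.zero_re] at hs
    linarith [Nat.cast_nonneg (α := ℝ) N]
  have ftc := intervalIntegral.integral_eq_sub_of_hasDerivAt_of_le zero_le_one
    (continuousOn_binomQuot (N + 1) (by push_cast; linarith))
    (fun y hy => hasDerivAt_binomQuot_succ N s hy.1.ne' hy.2) (hInt₂.add hInt₁)
  rw [intervalIntegral.integral_add hInt₂ hInt₁, intervalIntegral.integral_const_mul,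
    intervalIntegral.integral_const_mul, binomQuot_zero_right, binomQuot_one_right _ hs0] at ftc
  rw [Finset.sum_range_succ]
  push_cast at ftc
  linear_combination -ftc

theorem add_one_mul_sum_risingCoeff_div (N : ℕ) (s : ℂ) :
    (N + 1) * ∑ i ∈ Finset.range (N + 1), risingCoeff i s / ((N : ℂ) + 1 - i)
      = s * ∑ i ∈ Finset.range N, risingCoeff i (s + 1) / ((N : ℂ) - i)
        + ∑ i ∈ Finset.range (N + 1), risingCoeff i s := by
  have hshift : s * ∑ i ∈ Finset.range N, risingCoeff i (s + 1) / ((N : ℂ) - i)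
      = ∑ i ∈ Finset.range (N + 1), i * risingCoeff i s / ((N : ℂ) + 1 - i) := by
    rw [Finset.sum_range_succ', Finset.mul_sum, Nat.cast_zero, zero_mul, zero_div, add_zero]
    refine Finset.sum_congr rfl fun i _ => ?_
    push_cast
    rw [add_one_mul_risingCoeff_succ', add_sub_add_right_eq_sub]
    ring
  rw [hshift, ← Finset.sum_add_distrib, Finset.mul_sum]
  refine Finset.sum_congr rfl fun i hi => ?_
  have hne : (N : ℂ) + 1 - i ≠ 0 := by
    rw [sub_ne_zero]
    exact_mod_cast (Finset.mem_range.1 hi).ne'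
  field_simp
  ring

theorem integral_binomQuot_succ (N : ℕ) {s : ℂ} (hs : s.re + N + 2 ≤ 0) :
    ∫ y in (0 : ℝ)..1, binomQuot (N + 1) s y
      = ∑ i ∈ Finset.range N, risingCoeff i s / ((N : ℂ) - i)
        + risingCoeff N s * ((harmonic N : ℂ) + harmonicSeries s) - deriv (risingCoeff N) s := by
  induction N generalizing s with
  | zero =>
    rw [integral_binomQuot_one (by simpa using hs),
      show risingCoeff 0 = fun _ => 1 from funext risingCoeff_zero]
    simp
  | succ N ih =>
    push_cast at hs
    have hs0 : s ≠ 0 := by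
      rintro rfl
      simp only [Complex.zero_re] at hs
      linarith [Nat.cast_nonneg (α := ℝ) N]
    have hre : (s + 1).re + N + 2 ≤ 0 := by rw [Complex.add_re, Complex.one_re]; linarith
    have hharm := harmonicSeries_sub_one (s := s + 1)
      (by linarith [Nat.cast_nonneg (α := ℝ) N])
    rw [add_sub_cancel_right, show 1 - (s + 1) = -s by ring] at hharm
    have hInt := add_one_mul_integral_binomQuot_add_two N (by linarith : s.re + N + 3 ≤ 0)
    rw [ih hre, Finset.sum_range_succ] at hInt
    have hN : (N : ℂ) + 1 ≠ 0 := by exact_mod_cast N.succ_ne_zero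
    apply mul_left_cancel₀ hN
    rw [hInt, harmonic_succ, hharm]
    push_cast
    have hsum := add_one_mul_sum_risingCoeff_div N s
    have hderiv := add_one_mul_deriv_risingCoeff_succ N s
    have hrec := add_one_mul_risingCoeff_succ' N s
    have hNinv := mul_inv_cancel₀ hN
    have hsinv : s * (1 / -s) = -1 := by field_simp
    linear_combination hderiv - hsum
      - ((harmonic N : ℂ) + (harmonicSeries (s + 1) - 1 / -s)) * hrec
      + risingCoeff N (s + 1) * hsinv - risingCoeff (N + 1) s * hNinv

end IntegralBinomQuot

section RiemannSum

open Set MeasureTheory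

variable {E : Type*} [NormedAddCommGroup E] [NormedSpace ℝ E]

theorem integral_norm_smul_comp_div_le {g : ℝ → E} {M : ℝ} (hg : ∀ y ∈ Icc (0 : ℝ) 1, ‖g y‖ ≤ M)
    (K : ℕ) {n : ℕ} (hn : 1 ≤ n) :
    ∫ x in (0 : ℝ)..n, ‖(1 / (n : ℝ) ^ (K + 1)) • g (x / n)‖ ≤ M * (1 / (n : ℝ) ^ K) := by
  have hn0 : (0 : ℝ) < n := by exact_mod_cast hn
  have hbound : ∀ x ∈ uIoc (0 : ℝ) n,
      ‖‖(1 / (n : ℝ) ^ (K + 1)) • g (x / n)‖‖ ≤ 1 / (n : ℝ) ^ (K + 1) * M := fun x hx => by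
    rw [uIoc_of_le hn0.le] at hx
    rw [norm_norm, norm_smul, Real.norm_of_nonneg (by positivity)]
    gcongr
    exact hg _ ⟨div_nonneg hx.1.le hn0.le, (div_le_one hn0).2 hx.2⟩
  refine (le_abs_self _).trans ((intervalIntegral.norm_integral_le_of_norm_le_const hbound).trans
    (le_of_eq ?_))
  rw [sub_zero, abs_of_pos hn0, pow_succ]
  field_simp

theorem exists_norm_sum_comp_div_sub_le [CompleteSpace E] (K : ℕ) : ∃ C : ℝ, 0 ≤ C ∧
    ∀ (f : ℕ → ℝ → E) (M : ℝ) (n : ℕ), (∀ j ≤ K + 1, ContinuousOn (f j) (Icc 0 1)) →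
    (∀ j ≤ K, ∀ y ∈ Ioo (0 : ℝ) 1, HasDerivAt (f j) (f (j + 1) y) y) →
    (∀ y ∈ Icc (0 : ℝ) 1, ‖f (K + 1) y‖ ≤ M) → 1 ≤ n →
    ‖(∑ k ∈ Finset.range n, f 0 (k / n)) - (n : ℝ) • (∫ y in (0 : ℝ)..1, f 0 y)
      - ∑ j ∈ Finset.range (K + 1), ((bernoulli (j + 1) : ℝ) / (j + 1)!) •
          (1 / (n : ℝ) ^ j) • (f j 1 - f j 0)‖ ≤ C * (M * (1 / (n : ℝ) ^ K)) := by
  obtain ⟨C, hC, hEM⟩ := exists_norm_eulerMaclaurin_le (E := E) K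
  refine ⟨C, hC, fun f M n hcont hderiv hM hn => ?_⟩
  have hn0 : (0 : ℝ) < n := by exact_mod_cast hn
  have hmaps : MapsTo (fun x : ℝ => x / n) (Icc ((0 : ℕ) : ℝ) n) (Icc 0 1) := fun x hx =>
    ⟨div_nonneg (by simpa using hx.1) hn0.le, (div_le_one hn0).2 hx.2⟩
  have h := hEM (fun j x => (1 / (n : ℝ) ^ j) • f j (x / n)) 0 n (Nat.zero_le n)
    (fun j hj => ((hcont j hj).comp (by fun_prop) hmaps).const_smul _)
    (fun j hj x hx => by
      have hx' : x / n ∈ Ioo (0 : ℝ) 1 :=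
        ⟨div_pos (by simpa using hx.1) hn0, (div_lt_one hn0).2 hx.2⟩
      refine (((hderiv j hj _ hx').scomp x ((hasDerivAt_id x).div_const (n : ℝ))).const_smul
        (1 / (n : ℝ) ^ j)).congr_deriv ?_
      rw [smul_smul, pow_succ]
      congr 1
      field_simp)
  have hInt : ∫ x in (0 : ℝ)..n, f 0 (x / n) = (n : ℝ) • ∫ y in (0 : ℝ)..1, f 0 y := by
    rw [intervalIntegral.integral_comp_div _ hn0.ne', zero_div, div_self hn0.ne']
  simp only [Nat.cast_zero, pow_zero, div_one, one_smul, ← smul_sub, zero_div,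
    div_self hn0.ne', hInt, ← Finset.range_eq_Ico] at h
  exact h.trans (mul_le_mul_of_nonneg_left (integral_norm_smul_comp_div_le hM K hn) hC)

end RiemannSum

section UniformBounds

theorem eventually_principal_prod_atTop {S : Set ℂ} {P : ℂ × ℕ → Prop}
    (h : ∀ s ∈ S, ∀ n, 1 ≤ n → P (s, n)) : ∀ᶠ p in 𝓟 S ×ˢ atTop, P p := by
  filter_upwards [prod_mem_prod (mem_principal_self S) (eventually_ge_atTop 1)] with p hp
  exact h p.1 hp.1 p.2 hp.2

theorem isBigO_principal_prod_of_norm_le {E F : Type*} [Norm E] [Norm F]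
    {S : Set ℂ} {f : ℂ × ℕ → E} {g : ℂ × ℕ → F} (C : ℝ)
    (h : ∀ s ∈ S, ∀ n, 1 ≤ n → ‖f (s, n)‖ ≤ C * ‖g (s, n)‖) : f =O[𝓟 S ×ˢ atTop] g :=
  IsBigO.of_bound C (eventually_principal_prod_atTop h)

theorem risingCoeff_isBigO_one (i : ℕ) {S : Set ℂ} (hS : Bornology.IsBounded S) :
    (fun p : ℂ × ℕ => risingCoeff i p.1) =O[𝓟 S ×ˢ atTop] fun _ => (1 : ℝ) :=
  (((differentiable_risingCoeff i).continuous.continuousOn.isBigO_principal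
    hS.isCompact_closure (by simp)).mono (principal_mono.2 subset_closure)).comp_tendsto tendsto_fst

end UniformBounds

section BinomQuotSum

open Set

theorem bernoulli_div_factorial_smul_factorial_mul (j : ℕ) (z : ℂ) :
    ((bernoulli (j + 1) : ℝ) / (j + 1)!) • ((j ! : ℂ) * z)
      = -(riemannZeta (-j) * z + if j = 0 then z else 0) := by
  have hfact : (j ! : ℂ) ≠ 0 := by exact_mod_cast j.factorial_ne_zero
  have hj1 : (j : ℂ) + 1 ≠ 0 := by exact_mod_cast j.succ_ne_zero
  rw [Complex.real_smul, Nat.factorial_succ]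
  push_cast
  rcases Nat.eq_zero_or_pos j with rfl | hj
  · norm_num [riemannZeta_zero]
    ring
  rw [riemannZeta_neg_nat_eq_bernoulli, if_neg hj.ne', add_zero]
  rcases Nat.even_or_odd j with h | h
  · simp [bernoulli_eq_zero_of_odd h.add_one (by lia)]
  · rw [h.neg_one_pow]
    field_simp

theorem bernoulli_div_factorial_smul_binomQuotDeriv_sub (q j n : ℕ) {s : ℂ} (hs : s.re + j < 0) :
    ((bernoulli (j + 1) : ℝ) / (j + 1)!) •
      (1 / (n : ℝ) ^ j) • (binomQuotDeriv j (q + 1) s 1 - binomQuotDeriv j (q + 1) s 0)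
      = riemannZeta (-j) * (risingCoeff (q + 1 + j) s - ∑ i ∈ Finset.range (q + 1),
          risingCoeff i s * risingCoeff j ((q + 1 : ℕ) - i)) * (1 / (n : ℂ) ^ j)
        + if j = 0 then risingCoeff (q + 1) s else 0 := by
  rw [smul_comm, smul_sub, binomQuotDeriv_zero_right, binomQuotDeriv_one_right j _ hs,
    bernoulli_div_factorial_smul_factorial_mul, smul_neg, Finset.smul_sum]
  simp only [mul_left_comm (risingCoeff _ s), bernoulli_div_factorial_smul]
  rw [← Finset.mul_sum, Complex.real_smul]
  rcases Nat.eq_zero_or_pos j with rfl | hj0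
  · simp
    ring
  · simp [hj0.ne']
    ring

theorem isBigO_sum_binomQuot_sub (q K : ℕ) {S : Set ℂ} (hS : Bornology.IsBounded S)
    (hre : ∀ s ∈ S, s.re + q + K + 3 ≤ 0) :
    (fun p : ℂ × ℕ => (∑ k ∈ Finset.Ico 1 p.2, binomQuot (q + 1) p.1 ((k : ℝ) / p.2))
      - (p.2 * (∫ y in (0 : ℝ)..1, binomQuot (q + 1) p.1 y)
        + ∑ j ∈ Finset.range (K + 1), riemannZeta (-j) * (risingCoeff (q + 1 + j) p.1
            - ∑ i ∈ Finset.range (q + 1), risingCoeff i p.1 * risingCoeff j ((q + 1 : ℕ) - i))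
              * (1 / (p.2 : ℂ) ^ j)))
      =O[𝓟 S ×ˢ atTop] fun p => 1 / (p.2 : ℝ) ^ K := by
  obtain ⟨C, -, hEM⟩ := exists_norm_sum_comp_div_sub_le (E := ℂ) K
  obtain ⟨R, hR⟩ := hS.exists_norm_le
  obtain ⟨M, hM⟩ := exists_norm_binomQuotDeriv_le (K + 1) (q + 1) R
  refine isBigO_principal_prod_of_norm_le (C * M) fun s hs n hn => ?_
  have hsre := hre s hs
  have h := hEM (fun j => binomQuotDeriv j (q + 1) s) M n
    (fun j hj => continuousOn_binomQuotDeriv j (q + 1) (by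
      have : (j : ℝ) ≤ K + 1 := by exact_mod_cast hj
      push_cast
      linarith))
    (fun j _ y hy => hasDerivAt_binomQuotDeriv_succ j q s hy.1.ne' hy.2)
    (hM s (hR s hs) (by push_cast; linarith)) hn
  rw [mul_assoc, Real.norm_of_nonneg (by positivity)]
  refine le_of_eq_of_le (congrArg norm ?_) h
  have hcoeff : ∀ j ∈ Finset.range (K + 1), _ := fun j hj =>
    bernoulli_div_factorial_smul_binomQuotDeriv_sub q j n (s := s) (by
      have hjK : (j : ℝ) ≤ K := by exact_mod_cast Nat.lt_succ_iff.1 (Finset.mem_range.1 hj)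
      linarith [q.cast_nonneg (α := ℝ)])
  have hsum : ∑ k ∈ Finset.range n, binomQuotDeriv 0 (q + 1) s (k / n) = risingCoeff (q + 1) s
      + ∑ k ∈ Finset.Ico 1 n, binomQuotDeriv 0 (q + 1) s (k / n) := by
    rw [Finset.range_eq_Ico, Finset.sum_eq_sum_Ico_succ_bot (by lia), Nat.cast_zero, zero_div,
      binomQuotDeriv_zero_right, Nat.factorial_zero, Nat.cast_one, one_mul, add_zero]
  rw [hsum, Finset.sum_congr rfl hcoeff, Finset.sum_add_distrib, Finset.sum_ite_eq',
    if_pos (Finset.mem_range.2 K.succ_pos), Complex.real_smul, Complex.ofReal_natCast]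
  simp only [binomQuotDeriv]
  ring

end BinomQuotSum

section PowConvExpansion

/-- The convolution `∑_{k=1}^{n-1} k ^ (-s) / (n - k) ^ q`, whose Taylor coefficients in `s` at `0`
are, up to the factor `(-1) ^ p / p!`, the sums `logPowSum p q n`. -/
noncomputable def powConv (q : ℕ) (s : ℂ) (n : ℕ) : ℂ :=
  ∑ k ∈ Finset.Ico 1 n, (k : ℂ) ^ (-s) / ((n : ℂ) - k) ^ q

/-- The coefficient of `n ^ (-s - N)` in the asymptotic expansion of `powConv (N + 1) s n`. It
replaces `risingCoeff N s * riemannZeta 1`, hence the term `Real.log n`. -/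
noncomputable def resonantCoeff (N : ℕ) (s : ℂ) (n : ℕ) : ℂ :=
  risingCoeff N s * (Real.log n + Real.eulerMascheroniConstant + (harmonic N : ℂ)
    + harmonicSeries s) - deriv (risingCoeff N) s

/-- The coefficient of `n ^ (-s - i)` in the asymptotic expansion of `powConv q s n`, coming from
the terms with `k` close to `n`. -/
noncomputable def expansionCoeff (q i : ℕ) (s : ℂ) (n : ℕ) : ℂ :=
  if i + 1 = q then resonantCoeff i s n else risingCoeff i s * riemannZeta ((q : ℂ) - i)

/-- The truncated asymptotic expansion of `powConv q s n`: the first sum comes from the terms with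
`k` close to `n`, the second one from those with `k` close to `0`. -/
noncomputable def powConvExpansion (q : ℕ) (s : ℂ) (n I J : ℕ) : ℂ :=
  (n : ℂ) ^ (-s) * (∑ i ∈ Finset.range I, expansionCoeff q i s n * (1 / (n : ℂ) ^ i)
      + if q = 0 then (n : ℂ) / (1 - s) else 0)
    + ∑ j ∈ Finset.range J,
        ((q + j - 1).choose j : ℂ) * riemannZeta (s - j) * (1 / (n : ℂ) ^ (q + j))

theorem natCast_cpow_neg_sub_one {n : ℕ} (hn : 1 ≤ n) (s : ℂ) :
    (n : ℂ) ^ (-(s - 1)) = n * (n : ℂ) ^ (-s) := by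
  have hn0 : (n : ℂ) ≠ 0 := by exact_mod_cast (by lia : n ≠ 0)
  rw [show -(s - 1) = 1 + -s by ring, Complex.cpow_add _ _ hn0, Complex.cpow_one]

theorem natCast_cpow_neg_sub_natCast {n : ℕ} (hn : 1 ≤ n) (s : ℂ) (i : ℕ) :
    (n : ℂ) ^ (-s - i) = (n : ℂ) ^ (-s) * (1 / (n : ℂ) ^ i) := by
  have hn0 : (n : ℂ) ≠ 0 := by exact_mod_cast (by lia : n ≠ 0)
  rw [Complex.cpow_sub _ _ hn0, Complex.cpow_natCast, div_eq_mul_one_div]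

theorem natCast_mul_powConv_succ (q : ℕ) (s : ℂ) (n : ℕ) :
    n * powConv (q + 1) s n = powConv (q + 1) (s - 1) n + powConv q s n := by
  simp only [powConv]
  rw [Finset.mul_sum, ← Finset.sum_add_distrib]
  refine Finset.sum_congr rfl fun k hk => ?_
  rw [Finset.mem_Ico] at hk
  have hnk : (n : ℂ) - k ≠ 0 := sub_ne_zero.2 (by exact_mod_cast hk.2.ne')
  rw [natCast_cpow_neg_sub_one hk.1, pow_succ]
  field_simp
  ring

theorem resonantCoeff_zero {s : ℂ} (hs : s.re ≤ 1 / 2) (n : ℕ) :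
    resonantCoeff 0 s n = resonantCoeff 0 (s - 1) n + 1 / (1 - s) := by
  have hone : risingCoeff 0 = fun _ => (1 : ℂ) := funext risingCoeff_zero
  simp only [resonantCoeff, harmonicSeries_sub_one hs, hone, deriv_const]
  ring

theorem deriv_risingCoeff_succ (N : ℕ) (s : ℂ) :
    deriv (risingCoeff (N + 1)) s
      = deriv (risingCoeff (N + 1)) (s - 1) + deriv (risingCoeff N) s := by
  have hshift : DifferentiableAt ℂ (fun z => risingCoeff (N + 1) (z - 1)) s :=
    (differentiable_risingCoeff _).comp (differentiable_id.sub_const 1) s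
  rw [← deriv_comp_sub_const, ← deriv_fun_add hshift (differentiable_risingCoeff N s)]
  exact congrArg (deriv · s) (funext (risingCoeff_succ_eq_add N))

theorem resonantCoeff_succ {s : ℂ} (hs : s.re ≤ 1 / 2) (N n : ℕ) :
    resonantCoeff (N + 1) s n = resonantCoeff (N + 1) (s - 1) n + resonantCoeff N s n := by
  have hpascal := risingCoeff_succ_eq_add N s
  have habsorb := add_one_mul_risingCoeff_succ' N (s - 1)
  rw [sub_add_cancel] at habsorb
  have hN : (N : ℂ) + 1 ≠ 0 := by exact_mod_cast N.succ_ne_zero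
  have hs1 : 1 - s ≠ 0 := by simpa using add_one_sub_ne_zero hs 0
  have hcancel : risingCoeff (N + 1) (s - 1) * (1 / (1 - s))
      + risingCoeff N s * ((N : ℂ) + 1)⁻¹ = 0 := by
    field_simp
    linear_combination habsorb
  simp only [resonantCoeff, harmonicSeries_sub_one hs, harmonic_succ, deriv_risingCoeff_succ N s]
  push_cast
  rw [hpascal]
  linear_combination hcancel

theorem expansionCoeff_succ_succ {s : ℂ} (hs : s.re ≤ 1 / 2) (q i n : ℕ) :
    expansionCoeff (q + 1) (i + 1) s n
      = expansionCoeff (q + 1) (i + 1) (s - 1) n + expansionCoeff q i s n := by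
  unfold expansionCoeff
  rcases eq_or_ne (i + 1) q with h | h
  · rw [if_pos (by lia), if_pos (by lia), if_pos h, resonantCoeff_succ hs]
  · rw [if_neg (by lia), if_neg (by lia), if_neg h, risingCoeff_succ_eq_add]
    push_cast
    rw [add_sub_add_right_eq_sub]
    ring

theorem expansionCoeff_succ_zero {s : ℂ} (hs : s.re ≤ 1 / 2) (q n : ℕ) :
    expansionCoeff (q + 1) 0 s n
      = expansionCoeff (q + 1) 0 (s - 1) n + if q = 0 then 1 / (1 - s) else 0 := by
  unfold expansionCoeff
  rcases eq_or_ne q 0 with rfl | h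
  · simpa using resonantCoeff_zero hs n
  · rw [if_neg (by lia), if_neg (by lia), if_neg h]
    simp

theorem natCast_mul_sum_expansionCoeff_succ {s : ℂ} (hs : s.re ≤ 1 / 2) (q I : ℕ) {n : ℕ}
    (hn : 1 ≤ n) :
    n * ∑ i ∈ Finset.range (I + 1), expansionCoeff (q + 1) i s n * (1 / (n : ℂ) ^ i)
      = n * (∑ i ∈ Finset.range (I + 1), expansionCoeff (q + 1) i (s - 1) n * (1 / (n : ℂ) ^ i))
        + (∑ i ∈ Finset.range I, expansionCoeff q i s n * (1 / (n : ℂ) ^ i)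
          + if q = 0 then (n : ℂ) / (1 - s) else 0) := by
  have hn0 : (n : ℂ) ≠ 0 := by exact_mod_cast (by lia : n ≠ 0)
  have hshift : ∑ i ∈ Finset.range I, expansionCoeff q i s n * (1 / (n : ℂ) ^ i)
      = n * ∑ i ∈ Finset.range I, expansionCoeff q i s n * (1 / (n : ℂ) ^ (i + 1)) := by
    rw [Finset.mul_sum]
    refine Finset.sum_congr rfl fun i _ => ?_
    rw [pow_succ]
    field_simp
  rw [hshift]
  simp only [Finset.sum_range_succ', expansionCoeff_succ_succ hs, expansionCoeff_succ_zero hs,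
    add_mul, Finset.sum_add_distrib]
  split_ifs <;> simp <;> ring

theorem natCast_mul_sum_choose_mul_zeta (q J : ℕ) (s : ℂ) {n : ℕ} (hn : 1 ≤ n) :
    (n : ℂ) * ∑ j ∈ Finset.range (J + 1),
        ((q + 1 + j - 1).choose j : ℂ) * riemannZeta (s - j) * (1 / (n : ℂ) ^ (q + 1 + j))
      = ∑ j ∈ Finset.range J,
          ((q + 1 + j - 1).choose j : ℂ) * riemannZeta (s - 1 - j) * (1 / (n : ℂ) ^ (q + 1 + j))
        + ∑ j ∈ Finset.range (J + 1),
          ((q + j - 1).choose j : ℂ) * riemannZeta (s - j) * (1 / (n : ℂ) ^ (q + j)) := by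
  have hn0 : (n : ℂ) ≠ 0 := by exact_mod_cast (by lia : n ≠ 0)
  rw [Finset.sum_range_succ', Finset.sum_range_succ', ← add_assoc, ← Finset.sum_add_distrib,
    mul_add, Finset.mul_sum]
  congr 1
  · refine Finset.sum_congr rfl fun j _ => ?_
    rw [show q + 1 + (j + 1) - 1 = q + j + 1 by lia, show q + 1 + j - 1 = q + j by lia,
      show q + (j + 1) - 1 = q + j by lia, show q + (j + 1) = q + 1 + j by ring,
      show q + 1 + (j + 1) = q + 1 + j + 1 by ring, pow_succ (n : ℂ) (q + 1 + j),
      show s - 1 - (j : ℂ) = s - ((j + 1 : ℕ) : ℂ) by push_cast; ring, Nat.choose_succ_succ]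
    push_cast
    field_simp
  · simp only [Nat.choose_zero_right, add_zero, pow_succ]
    field_simp

theorem natCast_mul_powConvExpansion_succ {s : ℂ} (hs : s.re ≤ 1 / 2) (q I J : ℕ) {n : ℕ}
    (hn : 1 ≤ n) :
    n * powConvExpansion (q + 1) s n (I + 1) (J + 1)
      = powConvExpansion (q + 1) (s - 1) n (I + 1) J + powConvExpansion q s n I (J + 1) := by
  simp only [powConvExpansion, if_neg q.succ_ne_zero, add_zero]
  rw [mul_add, natCast_mul_sum_choose_mul_zeta q J s hn, mul_left_comm,
    natCast_mul_sum_expansionCoeff_succ hs q I hn, natCast_cpow_neg_sub_one hn]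
  ring

end PowConvExpansion

section PowConvVeryNegativeRe

theorem powConv_eq_sum_reflect (q : ℕ) (s : ℂ) (n : ℕ) :
    powConv q s n = ∑ k ∈ Finset.Ico 1 n, ((n : ℂ) - k) ^ (-s) / (k : ℂ) ^ q := by
  have hreflect := Finset.sum_Ico_reflect (fun k : ℕ => (k : ℂ) ^ (-s) / ((n : ℂ) - k) ^ q) 1
    n.le_succ
  rw [Nat.add_sub_cancel_left, Nat.add_sub_cancel] at hreflect
  rw [powConv, ← hreflect]
  refine Finset.sum_congr rfl fun k hk => ?_
  rw [Nat.cast_sub (Finset.mem_Ico.1 hk).2.le, sub_sub_cancel]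

theorem sub_natCast_cpow_neg_div_pow (q : ℕ) (s : ℂ) {k n : ℕ} (hk : 1 ≤ k) (hkn : k ≤ n) :
    ((n : ℂ) - k) ^ (-s) / (k : ℂ) ^ q = (n : ℂ) ^ (-s) * (1 / (n : ℂ) ^ q) *
      (binomQuot q s ((k : ℝ) / n)
        + ∑ i ∈ Finset.range q, risingCoeff i s * ((n : ℂ) ^ (q - i) / (k : ℂ) ^ (q - i))) := by
  have hn0 : (0 : ℝ) < n := by exact_mod_cast hk.trans hkn
  have hnc : (n : ℂ) ≠ 0 := by exact_mod_cast hn0.ne'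
  have hkc : (k : ℂ) ≠ 0 := by exact_mod_cast (by lia : k ≠ 0)
  have hy : (k : ℝ) / n ≠ 0 := div_ne_zero (by exact_mod_cast (by lia : k ≠ 0)) hn0.ne'
  have hy1 : (k : ℝ) / n ≤ 1 := (div_le_one hn0).2 (by exact_mod_cast hkn)
  have hscale : ((n : ℂ) - k) ^ (-s) = (n : ℂ) ^ (-s) * ((1 - (k : ℝ) / n : ℝ) : ℂ) ^ (-s) := by
    rw [show (n : ℂ) - k = (n : ℝ) * ((1 - (k : ℝ) / n : ℝ) : ℂ) by push_cast; field_simp,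
      Complex.mul_cpow_ofReal_nonneg hn0.le (by linarith), Complex.ofReal_natCast]
  have htaylor : ∑ i ∈ Finset.range q, risingCoeff i s * ((n : ℂ) ^ (q - i) / (k : ℂ) ^ (q - i))
      = (∑ i ∈ Finset.range q, risingCoeff i s * (((k : ℝ) / n : ℝ) : ℂ) ^ i)
          / (((k : ℝ) / n : ℝ) : ℂ) ^ q := by
    rw [Finset.sum_div]
    refine Finset.sum_congr rfl fun i hi => ?_
    obtain ⟨d, rfl⟩ := Nat.exists_eq_add_of_le (Finset.mem_range.1 hi).le
    rw [Nat.add_sub_cancel_left]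
    push_cast
    rw [pow_add, div_pow, div_pow]
    field_simp
  rw [hscale, htaylor, binomQuot_of_ne_zero q s hy, binomRem, ← add_div, sub_add_cancel]
  push_cast
  rw [div_pow]
  field_simp

theorem powConv_eq_sum_binomQuot (q : ℕ) (s : ℂ) (n : ℕ) :
    powConv q s n = (n : ℂ) ^ (-s) * (1 / (n : ℂ) ^ q) *
      (∑ k ∈ Finset.Ico 1 n, binomQuot q s ((k : ℝ) / n)
        + ∑ i ∈ Finset.range q, risingCoeff i s *
            ((n : ℂ) ^ (q - i) * ∑ k ∈ Finset.Ico 1 n, (k : ℂ) ^ (-((q - i : ℕ) : ℂ)))) := by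
  have hterm : ∀ k ∈ Finset.Ico 1 n, ((n : ℂ) - k) ^ (-s) / (k : ℂ) ^ q
      = (n : ℂ) ^ (-s) * (1 / (n : ℂ) ^ q) * (binomQuot q s ((k : ℝ) / n)
        + ∑ i ∈ Finset.range q, risingCoeff i s * ((n : ℂ) ^ (q - i) / (k : ℂ) ^ (q - i))) :=
    fun k hk => sub_natCast_cpow_neg_div_pow q s (Finset.mem_Ico.1 hk).1 (Finset.mem_Ico.1 hk).2.le
  rw [powConv_eq_sum_reflect, Finset.sum_congr rfl hterm, ← Finset.mul_sum,
    Finset.sum_add_distrib, Finset.sum_comm]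
  simp only [← Finset.mul_sum, Complex.cpow_neg, Complex.cpow_natCast, div_eq_mul_inv]

/-- The main part of the Euler–Maclaurin expansion of `n ^ a * ∑_{k < n} k ^ (-a)`. -/
noncomputable def powMulZetaSumMain (K a n : ℕ) : ℂ :=
  (n : ℂ) ^ a * zetaSumMain n a
    + ∑ j ∈ Finset.range (K + 1), riemannZeta (-j) * risingCoeff j a * (1 / (n : ℂ) ^ j)

theorem isBigO_natCast_pow_mul_sum_cpow_sub {a K : ℕ} (ha : 1 ≤ a) (hK : 1 ≤ K) :
    (fun n : ℕ => (n : ℂ) ^ a * (∑ k ∈ Finset.Ico 1 n, (k : ℂ) ^ (-(a : ℂ)))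
      - powMulZetaSumMain K a n) =O[atTop] fun n => 1 / (n : ℝ) ^ K := by
  obtain ⟨C, -, hzeta⟩ := exists_norm_sum_Ico_cpow_sub_zetaSumMain_le K
  refine IsBigO.of_bound (C * ‖risingCoeff (K + 1) a‖) ?_
  filter_upwards [eventually_ge_atTop 1] with n hn
  have hn0 : (0 : ℝ) < n := by exact_mod_cast hn
  have hnc : (n : ℂ) ≠ 0 := by exact_mod_cast hn0.ne'
  have h := hzeta a n (by rw [Complex.natCast_re]; exact_mod_cast (by lia : 1 < a + K)) hn
  have hpow : ∀ j : ℕ, (n : ℂ) ^ a * (n : ℂ) ^ (-(a : ℂ) - j) = 1 / (n : ℂ) ^ j := fun j => by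
    rw [natCast_cpow_neg_sub_natCast hn, Complex.cpow_neg, Complex.cpow_natCast]
    field_simp
  have hmain : powMulZetaSumMain K a n = (n : ℂ) ^ a * (zetaSumMain n a
      + ∑ j ∈ Finset.range (K + 1),
          riemannZeta (-j) * risingCoeff j a * (n : ℂ) ^ (-(a : ℂ) - j)) := by
    rw [mul_add, Finset.mul_sum, powMulZetaSumMain]
    simp only [← hpow]
    congr 1
    exact Finset.sum_congr rfl fun j _ => by ring
  rw [hmain, ← mul_sub, norm_mul, norm_pow, Complex.norm_natCast,
    Real.norm_of_nonneg (by positivity)]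
  refine (mul_le_mul_of_nonneg_left h (by positivity)).trans_eq ?_
  rw [Complex.natCast_re, Real.rpow_neg hn0.le, Real.rpow_add hn0, Real.rpow_natCast,
    Real.rpow_natCast]
  field_simp

theorem sum_risingCoeff_mul_pow_mul_zetaSumMain (N : ℕ) (s : ℂ) {n : ℕ} (hn : 1 ≤ n) :
    ∑ i ∈ Finset.range (N + 1), risingCoeff i s *
        ((n : ℂ) ^ (N + 1 - i) * zetaSumMain n (N + 1 - i : ℕ))
      = (∑ i ∈ Finset.range N,
            risingCoeff i s * riemannZeta ((N + 1 : ℕ) - i : ℂ) * (n : ℂ) ^ (N + 1 - i))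
        + n * (risingCoeff N s * (Real.log n + Real.eulerMascheroniConstant)
          - ∑ i ∈ Finset.range N, risingCoeff i s / ((N : ℂ) - i)) := by
  have hn0 : (n : ℂ) ≠ 0 := by exact_mod_cast (by lia : n ≠ 0)
  have hterm : ∀ i ∈ Finset.range N, risingCoeff i s *
      ((n : ℂ) ^ (N + 1 - i) * zetaSumMain n (N + 1 - i : ℕ))
      = risingCoeff i s * riemannZeta ((N + 1 : ℕ) - i : ℂ) * (n : ℂ) ^ (N + 1 - i)
        - n * (risingCoeff i s / ((N : ℂ) - i)) := fun i hi => by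
    have hi' := Finset.mem_range.1 hi
    have hne : ((N + 1 - i : ℕ) : ℂ) ≠ 1 := by exact_mod_cast (by lia : N + 1 - i ≠ 1)
    have hNi : (N : ℂ) - i ≠ 0 := sub_ne_zero.2 (by exact_mod_cast hi'.ne')
    rw [zetaSumMain, if_neg hne, Complex.cpow_sub _ _ hn0, Complex.cpow_one, Complex.cpow_natCast,
      Nat.cast_sub (by lia)]
    have hsub : 1 - (((N + 1 : ℕ) : ℂ) - i) = -((N : ℂ) - i) := by push_cast; ring
    rw [hsub]
    field_simp
    ring
  rw [Finset.sum_range_succ, Finset.sum_congr rfl hterm, Finset.sum_sub_distrib, ← Finset.mul_sum,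
    Nat.add_sub_cancel_left, zetaSumMain, if_pos Nat.cast_one]
  ring

theorem sum_range_expansionCoeff (N K : ℕ) (s : ℂ) {n : ℕ} (hn : 1 ≤ n) :
    ∑ i ∈ Finset.range (N + 1 + K + 1), expansionCoeff (N + 1) i s n * (1 / (n : ℂ) ^ i)
      = (1 / (n : ℂ) ^ (N + 1)) * (∑ i ∈ Finset.range N,
            risingCoeff i s * riemannZeta ((N + 1 : ℕ) - i : ℂ) * (n : ℂ) ^ (N + 1 - i)
          + n * resonantCoeff N s n
          + ∑ j ∈ Finset.range (K + 1),
              riemannZeta (-j) * risingCoeff (N + 1 + j) s * (1 / (n : ℂ) ^ j)) := by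
  have hn0 : (n : ℂ) ≠ 0 := by exact_mod_cast (by lia : n ≠ 0)
  rw [add_assoc (N + 1) K 1, Finset.sum_range_add, Finset.sum_range_succ, mul_add, mul_add,
    Finset.mul_sum, Finset.mul_sum]
  congr 1
  · congr 1
    · refine Finset.sum_congr rfl fun i hi => ?_
      have hi' := Finset.mem_range.1 hi
      rw [expansionCoeff, if_neg (by lia)]
      obtain ⟨d, hd⟩ := Nat.exists_eq_add_of_le (show i ≤ N + 1 by lia)
      rw [hd, Nat.add_sub_cancel_left, pow_add]
      field_simp
    · rw [expansionCoeff, if_pos rfl, pow_succ]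
      field_simp
  · refine Finset.sum_congr rfl fun j _ => ?_
    rw [expansionCoeff, if_neg (by lia), pow_add,
      show ((N + 1 : ℕ) : ℂ) - (N + 1 + j : ℕ) = -j by push_cast; ring]
    field_simp

theorem powConvExpansion_succ_eq_of_re_le (N K : ℕ) {s : ℂ} (hs : s.re + N + 2 ≤ 0) {n : ℕ}
    (hn : 1 ≤ n) :
    powConvExpansion (N + 1) s n (N + 1 + K + 1) 0 = (n : ℂ) ^ (-s) * (1 / (n : ℂ) ^ (N + 1)) *
      (n * (∫ y in (0 : ℝ)..1, binomQuot (N + 1) s y)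
        + ∑ j ∈ Finset.range (K + 1), riemannZeta (-j) * (risingCoeff (N + 1 + j) s
            - ∑ i ∈ Finset.range (N + 1), risingCoeff i s * risingCoeff j ((N + 1 : ℕ) - i))
              * (1 / (n : ℂ) ^ j)
        + ∑ i ∈ Finset.range (N + 1), risingCoeff i s * powMulZetaSumMain K (N + 1 - i) n) := by
  have hcross : ∑ i ∈ Finset.range (N + 1), risingCoeff i s * ∑ j ∈ Finset.range (K + 1),
        riemannZeta (-j) * risingCoeff j (N + 1 - i : ℕ) * (1 / (n : ℂ) ^ j)
      = ∑ j ∈ Finset.range (K + 1), riemannZeta (-j) *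
          (∑ i ∈ Finset.range (N + 1), risingCoeff i s * risingCoeff j ((N + 1 : ℕ) - i))
            * (1 / (n : ℂ) ^ j) := by
    simp only [Finset.mul_sum, Finset.sum_mul]
    rw [Finset.sum_comm]
    refine Finset.sum_congr rfl fun j _ => Finset.sum_congr rfl fun i hi => ?_
    rw [Nat.cast_sub (Finset.mem_range.1 hi).le]
    ring
  simp only [powMulZetaSumMain, mul_add (risingCoeff _ s), Finset.sum_add_distrib,
    sum_risingCoeff_mul_pow_mul_zetaSumMain N s hn, hcross]
  rw [powConvExpansion, if_neg N.succ_ne_zero, add_zero, Finset.sum_range_zero, add_zero,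
    sum_range_expansionCoeff N K s hn, integral_binomQuot_succ N hs, resonantCoeff]
  simp only [mul_sub, sub_mul, Finset.sum_sub_distrib]
  ring

theorem isBigO_powConv_succ_sub_of_re_le (N : ℕ) {K : ℕ} (hK : 1 ≤ K) {S : Set ℂ}
    (hS : Bornology.IsBounded S) (hre : ∀ s ∈ S, s.re + N + K + 3 ≤ 0) :
    (fun p : ℂ × ℕ => powConv (N + 1) p.1 p.2
        - powConvExpansion (N + 1) p.1 p.2 (N + 1 + K + 1) 0)
      =O[𝓟 S ×ˢ atTop] fun p => (p.2 : ℝ) ^ (-p.1.re - (N + 1 + K : ℕ)) := by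
  have hprefactor : (fun p : ℂ × ℕ => (p.2 : ℂ) ^ (-p.1) * (1 / (p.2 : ℂ) ^ (N + 1)))
      =O[𝓟 S ×ˢ atTop] fun p => (p.2 : ℝ) ^ (-p.1.re - (N + 1 : ℕ)) :=
    isBigO_principal_prod_of_norm_le 1 fun s _ n hn => by
      rw [← natCast_cpow_neg_sub_natCast hn, Complex.norm_natCast_cpow_of_pos hn, one_mul]
      simpa using le_abs_self _
  have hterm : ∀ i ∈ Finset.range (N + 1), (fun p : ℂ × ℕ => risingCoeff i p.1 *
      ((p.2 : ℂ) ^ (N + 1 - i) * (∑ k ∈ Finset.Ico 1 p.2, (k : ℂ) ^ (-((N + 1 - i : ℕ) : ℂ)))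
        - powMulZetaSumMain K (N + 1 - i) p.2)) =O[𝓟 S ×ˢ atTop] fun p => 1 / (p.2 : ℝ) ^ K :=
    fun i hi => by
      have ha : 1 ≤ N + 1 - i := Nat.sub_pos_of_lt (Finset.mem_range.1 hi)
      simpa using (risingCoeff_isBigO_one i hS).mul
        ((isBigO_natCast_pow_mul_sum_cpow_sub ha hK).comp_tendsto tendsto_snd)
  refine (hprefactor.mul ((isBigO_sum_binomQuot_sub N K hS hre).add
    (IsBigO.sum hterm))).congr' ?_ ?_
  · refine eventually_principal_prod_atTop fun s hs n hn => ?_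
    dsimp only
    rw [powConvExpansion_succ_eq_of_re_le N K (by linarith [hre s hs, K.cast_nonneg (α := ℝ)]) hn,
      powConv_eq_sum_binomQuot]
    simp only [Finset.sum_apply, mul_sub, Finset.sum_sub_distrib]
    ring
  · refine eventually_principal_prod_atTop fun s _ n hn => ?_
    have hn0 : (0 : ℝ) < n := by exact_mod_cast hn
    dsimp only
    rw [one_div, ← Real.rpow_natCast (n : ℝ) K, ← Real.rpow_neg hn0.le, ← Real.rpow_add hn0]
    push_cast
    ring_nf

end PowConvVeryNegativeRe

section PowConvUniform

theorem isBigO_rpow_neg_re_sub_natCast (S : Set ℂ) {I I' : ℕ} (hI : I ≤ I') :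
    (fun p : ℂ × ℕ => (p.2 : ℝ) ^ (-p.1.re - I')) =O[𝓟 S ×ˢ atTop]
      fun p => (p.2 : ℝ) ^ (-p.1.re - I) :=
  isBigO_principal_prod_of_norm_le 1 fun s _ n hn => by
    have hexp : -s.re - (I' : ℝ) ≤ -s.re - I := sub_le_sub_left (by exact_mod_cast hI) _
    rw [one_mul, Real.norm_of_nonneg (by positivity), Real.norm_of_nonneg (by positivity)]
    exact Real.rpow_le_rpow_of_exponent_le (by exact_mod_cast hn) hexp

theorem isBigO_expansionCoeff_mul {q i : ℕ} (hi : q ≤ i) {S : Set ℂ} (hS : Bornology.IsBounded S) :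
    (fun p : ℂ × ℕ => (p.2 : ℂ) ^ (-p.1) * (expansionCoeff q i p.1 p.2 * (1 / (p.2 : ℂ) ^ i)))
      =O[𝓟 S ×ˢ atTop] fun p => (p.2 : ℝ) ^ (-p.1.re - i) := by
  have hpow : (fun p : ℂ × ℕ => (p.2 : ℂ) ^ (-p.1 - i)) =O[𝓟 S ×ˢ atTop]
      fun p => (p.2 : ℝ) ^ (-p.1.re - i) :=
    isBigO_principal_prod_of_norm_le 1 fun s _ n hn => by
      rw [Complex.norm_natCast_cpow_of_pos hn, one_mul]
      simpa using le_abs_self _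
  refine (((risingCoeff_isBigO_one i hS).const_mul_left (riemannZeta ((q : ℂ) - i))).mul
    hpow).congr' (eventually_principal_prod_atTop fun s _ n hn => ?_) (by simp)
  simp only [natCast_cpow_neg_sub_natCast hn, expansionCoeff, if_neg (by lia : ¬i + 1 = q)]
  ring

theorem isBigO_powConvExpansion_sub {q I I' : ℕ} (hq : q ≤ I) (hI : I ≤ I') (J : ℕ) {S : Set ℂ}
    (hS : Bornology.IsBounded S) :
    (fun p : ℂ × ℕ => powConvExpansion q p.1 p.2 I' J - powConvExpansion q p.1 p.2 I J)
      =O[𝓟 S ×ˢ atTop] fun p => (p.2 : ℝ) ^ (-p.1.re - I) := by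
  have hterm : ∀ i ∈ Finset.Ico I I', (fun p : ℂ × ℕ => (p.2 : ℂ) ^ (-p.1) *
      (expansionCoeff q i p.1 p.2 * (1 / (p.2 : ℂ) ^ i))) =O[𝓟 S ×ˢ atTop]
      fun p => (p.2 : ℝ) ^ (-p.1.re - I) := fun i hi =>
    (isBigO_expansionCoeff_mul (hq.trans (Finset.mem_Ico.1 hi).1) hS).trans
      (isBigO_rpow_neg_re_sub_natCast S (Finset.mem_Ico.1 hi).1)
  refine (IsBigO.sum hterm).congr_left fun p => ?_
  rw [Finset.sum_apply, ← Finset.mul_sum, Finset.sum_Ico_eq_sub _ hI, powConvExpansion,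
    powConvExpansion]
  ring

theorem powConv_zero_sub_powConvExpansion (s : ℂ) (n I J : ℕ) :
    powConv 0 s n - powConvExpansion 0 s n I (J + 1)
      = (∑ k ∈ Finset.Ico 1 n, (k : ℂ) ^ (-s)) - (riemannZeta s + n * (n : ℂ) ^ (-s) / (1 - s)
        + ∑ j ∈ Finset.range I,
            riemannZeta (-j) * risingCoeff j s * ((n : ℂ) ^ (-s) * (1 / (n : ℂ) ^ j))) := by
  have hzeta : ∑ j ∈ Finset.range (J + 1),
      ((0 + j - 1).choose j : ℂ) * riemannZeta (s - j) * (1 / (n : ℂ) ^ (0 + j))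
      = riemannZeta s := by
    rw [Finset.sum_range_succ', Finset.sum_eq_zero fun j _ => by simp]
    simp
  rw [powConv, powConvExpansion, hzeta, if_pos rfl, mul_add, Finset.mul_sum]
  simp only [expansionCoeff, if_neg (Nat.succ_ne_zero _), pow_zero, div_one, Nat.cast_zero,
    zero_sub]
  have hcomm : ∀ j : ℕ, (n : ℂ) ^ (-s) * (risingCoeff j s * riemannZeta (-j) * (1 / (n : ℂ) ^ j))
      = riemannZeta (-j) * risingCoeff j s * ((n : ℂ) ^ (-s) * (1 / (n : ℂ) ^ j)) := fun j => by
    ring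
  simp only [hcomm]
  ring

theorem isBigO_powConv_zero_sub (I J : ℕ) {S : Set ℂ} (hS : Bornology.IsBounded S)
    (hre : ∀ s ∈ S, s.re ≤ 1 / 2) :
    (fun p : ℂ × ℕ => powConv 0 p.1 p.2 - powConvExpansion 0 p.1 p.2 I (J + 1))
      =O[𝓟 S ×ˢ atTop] fun p => (p.2 : ℝ) ^ (-p.1.re - I) := by
  obtain ⟨R, hR⟩ := hS.exists_norm_le
  set K := I + ⌈R⌉₊ + 2 with hKdef
  obtain ⟨C, -, hzeta⟩ := exists_norm_sum_Ico_cpow_sub_riemannZeta_le K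
  have hK : ∀ s ∈ S, 1 < s.re + K := fun s hs => by
    have hceil := Nat.le_ceil R
    have hre' := neg_le_of_abs_le ((Complex.abs_re_le_norm s).trans (hR s hs))
    rw [hKdef]
    push_cast
    linarith [I.cast_nonneg (α := ℝ)]
  have hmain : (fun p : ℂ × ℕ => powConv 0 p.1 p.2 - powConvExpansion 0 p.1 p.2 (K + 1) (J + 1))
      =O[𝓟 S ×ˢ atTop] fun p => risingCoeff (K + 1) p.1 * ((p.2 : ℝ) ^ (-p.1.re - K) : ℝ) := by
    refine isBigO_principal_prod_of_norm_le C fun s hs n hn => ?_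
    have hs1 : s ≠ 1 := by
      rintro rfl
      have := hre 1 hs
      norm_num at this
    have h := hzeta s n (hK s hs) hs1 hn
    simp only [natCast_cpow_neg_sub_natCast hn] at h
    rw [show 1 - s = -(s - 1) by ring, natCast_cpow_neg_sub_one hn, neg_sub] at h
    rw [powConv_zero_sub_powConvExpansion, norm_mul, Complex.norm_real,
      Real.norm_of_nonneg (by positivity), ← mul_assoc, ← neg_add']
    exact h
  have hdrop := isBigO_powConvExpansion_sub I.zero_le (by lia : I ≤ K + 1) (J + 1) hS
  have hbound : (fun p : ℂ × ℕ => risingCoeff (K + 1) p.1 * ((p.2 : ℝ) ^ (-p.1.re - K) : ℝ))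
      =O[𝓟 S ×ˢ atTop] fun p => (p.2 : ℝ) ^ (-p.1.re - I) := by
    simpa using (risingCoeff_isBigO_one (K + 1) hS).mul (Complex.isBigO_ofReal_left.2
      (isBigO_rpow_neg_re_sub_natCast S (by lia : I ≤ K)))
  simpa using (hmain.trans hbound).add hdrop

theorem isBigO_powConv_succ_sub_succ {q I J : ℕ} {S : Set ℂ} (hre : ∀ s ∈ S, s.re ≤ 1 / 2)
    (hshift : (fun p : ℂ × ℕ =>
        powConv (q + 1) p.1 p.2 - powConvExpansion (q + 1) p.1 p.2 (I + 1) J)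
      =O[𝓟 ((· - 1) '' S) ×ˢ atTop] fun p => (p.2 : ℝ) ^ (-p.1.re - (I + 1 : ℕ)))
    (hlower : (fun p : ℂ × ℕ => powConv q p.1 p.2 - powConvExpansion q p.1 p.2 I (J + 1))
      =O[𝓟 S ×ˢ atTop] fun p => (p.2 : ℝ) ^ (-p.1.re - I)) :
    (fun p : ℂ × ℕ => powConv (q + 1) p.1 p.2
        - powConvExpansion (q + 1) p.1 p.2 (I + 1) (J + 1))
      =O[𝓟 S ×ˢ atTop] fun p => (p.2 : ℝ) ^ (-p.1.re - (I + 1 : ℕ)) := by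
  have hmap : Tendsto (fun p : ℂ × ℕ => (p.1 - 1, p.2)) (𝓟 S ×ˢ atTop)
      (𝓟 ((· - 1) '' S) ×ˢ atTop) :=
    (tendsto_principal_principal.2 fun s hs => Set.mem_image_of_mem _ hs).prodMap tendsto_id
  have hshift' := (hshift.comp_tendsto hmap).congr_right
    (g₂ := fun p : ℂ × ℕ => (p.2 : ℝ) ^ (-p.1.re - I)) fun p => by
      simp only [Function.comp_apply, Complex.sub_re, Complex.one_re]
      push_cast
      ring_nf
  have hinv : (fun p : ℂ × ℕ => (p.2 : ℂ)⁻¹) =O[𝓟 S ×ˢ atTop] fun p => (p.2 : ℝ)⁻¹ :=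
    isBigO_principal_prod_of_norm_le 1 fun s _ n _ => by simp
  refine (hinv.mul (hshift'.add hlower)).congr'
    (eventually_principal_prod_atTop fun s hs n hn => ?_)
    (eventually_principal_prod_atTop fun s _ n hn => ?_)
  · have hn0 : (n : ℂ) ≠ 0 := by exact_mod_cast (by lia : n ≠ 0)
    simp only [Function.comp_apply]
    rw [inv_mul_eq_iff_eq_mul₀ hn0, mul_sub, natCast_mul_powConv_succ,
      natCast_mul_powConvExpansion_succ (hre s hs) q I J hn]
    ring
  · have hn0 : (0 : ℝ) < n := by exact_mod_cast hn
    dsimp only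
    rw [← Real.rpow_neg_one, ← Real.rpow_add hn0]
    push_cast
    ring_nf

theorem isBigO_powConv_succ_sub_zero {q I : ℕ} (hI : q + 1 ≤ I) {S : Set ℂ}
    (hS : Bornology.IsBounded S) (hre : ∀ s ∈ S, s.re + I + 3 ≤ 0) :
    (fun p : ℂ × ℕ => powConv (q + 1) p.1 p.2 - powConvExpansion (q + 1) p.1 p.2 I 0)
      =O[𝓟 S ×ˢ atTop] fun p => (p.2 : ℝ) ^ (-p.1.re - I) := by
  obtain ⟨d, rfl⟩ := Nat.exists_eq_add_of_le hI
  have hmain := isBigO_powConv_succ_sub_of_re_le q (K := d + 1) (by lia) hS fun s hs => by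
    have := hre s hs
    push_cast at this ⊢
    linarith
  simpa using (hmain.trans (isBigO_rpow_neg_re_sub_natCast S (I := q + 1 + d) (by lia))).add
    (isBigO_powConvExpansion_sub (I := q + 1 + d) (I' := q + 1 + (d + 1) + 1) hI (by lia) 0 hS)

theorem isBigO_powConv_sub {q I : ℕ} (hI : q ≤ I) (J : ℕ) {S : Set ℂ}
    (hS : Bornology.IsBounded S) (hre : ∀ s ∈ S, s.re ≤ 1 / 2)
    (hJ : ∀ s ∈ S, s.re + I + 3 ≤ J + 1) :
    (fun p : ℂ × ℕ => powConv q p.1 p.2 - powConvExpansion q p.1 p.2 I (J + 1))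
      =O[𝓟 S ×ˢ atTop] fun p => (p.2 : ℝ) ^ (-p.1.re - I) := by
  induction q generalizing I J S with
  | zero => exact isBigO_powConv_zero_sub I J hS hre
  | succ q ih =>
    obtain ⟨I, rfl⟩ := Nat.exists_eq_add_of_le' (q.succ_pos.trans_le hI)
    suffices hall : ∀ J : ℕ, ∀ {S : Set ℂ}, Bornology.IsBounded S → (∀ s ∈ S, s.re ≤ 1 / 2) →
        (∀ s ∈ S, s.re + (I + 1 : ℕ) + 3 ≤ J) →
        (fun p : ℂ × ℕ => powConv (q + 1) p.1 p.2 - powConvExpansion (q + 1) p.1 p.2 (I + 1) J)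
          =O[𝓟 S ×ˢ atTop] fun p => (p.2 : ℝ) ^ (-p.1.re - (I + 1 : ℕ)) from
      hall (J + 1) hS hre (by exact_mod_cast hJ)
    clear hJ hre hS S J
    intro J
    induction J with
    | zero => exact fun hS _ hJ => isBigO_powConv_succ_sub_zero hI hS (by simpa using hJ)
    | succ J ihJ =>
      intro S hS hre hJ
      push_cast at hJ
      refine isBigO_powConv_succ_sub_succ hre (ihJ ?_ ?_ ?_)
        (ih (by lia) J hS hre fun s hs => by linarith [hJ s hs])
      · exact (LipschitzWith.id.sub (LipschitzWith.const 1)).isBounded_image hS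
      · rintro _ ⟨s, hs, rfl⟩
        simp only [Complex.sub_re, Complex.one_re]
        linarith [hre s hs]
      · rintro _ ⟨s, hs, rfl⟩
        simp only [Complex.sub_re, Complex.one_re]
        push_cast
        linarith [hJ s hs]

end PowConvUniform

section TaylorCoeff

/-- The `r`-th Taylor coefficient of `f` at `0`. -/
noncomputable def taylorCoeff (r : ℕ) (f : ℂ → ℂ) : ℂ := iteratedDeriv r f 0 / (r ! : ℂ)

theorem factorial_mul_taylorCoeff (r : ℕ) (f : ℂ → ℂ) :
    (r ! : ℂ) * taylorCoeff r f = iteratedDeriv r f 0 :=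
  mul_div_cancel₀ _ (by exact_mod_cast r.factorial_ne_zero)

theorem taylorCoeff_eq_of_hasSum {f : ℂ → ℂ} {c : ℕ → ℂ}
    (h : ∀ᶠ s in nhds 0, HasSum (fun r => s ^ r * c r) (f s)) (r : ℕ) : taylorCoeff r f = c r := by
  have hseries : HasFPowerSeriesAt f (FormalMultilinearSeries.ofScalars ℂ c) 0 := by
    rw [hasFPowerSeriesAt_iff']
    simpa using h
  have heq := congrArg (fun p => p.coeff r)
    (hseries.analyticAt.hasFPowerSeriesAt.eq_formalMultilinearSeries hseries)
  simpa [FormalMultilinearSeries.coeff_ofScalars, taylorCoeff] using heq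

theorem taylorCoeff_const_mul (r : ℕ) (c : ℂ) (f : ℂ → ℂ) :
    taylorCoeff r (fun s => c * f s) = c * taylorCoeff r f := by
  rw [taylorCoeff, iteratedDeriv_const_mul_field, taylorCoeff, mul_div_assoc]

theorem taylorCoeff_mul_const (r : ℕ) (f : ℂ → ℂ) (c : ℂ) :
    taylorCoeff r (fun s => f s * c) = taylorCoeff r f * c := by
  simp only [mul_comm _ c, taylorCoeff_const_mul]

theorem taylorCoeff_add (r : ℕ) {f g : ℂ → ℂ} (hf : AnalyticAt ℂ f 0) (hg : AnalyticAt ℂ g 0) :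
    taylorCoeff r (fun s => f s + g s) = taylorCoeff r f + taylorCoeff r g := by
  rw [taylorCoeff, iteratedDeriv_fun_add hf.contDiffAt hg.contDiffAt, add_div]
  rfl

theorem taylorCoeff_sub (r : ℕ) {f g : ℂ → ℂ} (hf : AnalyticAt ℂ f 0) (hg : AnalyticAt ℂ g 0) :
    taylorCoeff r (fun s => f s - g s) = taylorCoeff r f - taylorCoeff r g := by
  rw [taylorCoeff, iteratedDeriv_fun_sub hf.contDiffAt hg.contDiffAt, sub_div]
  rfl

theorem taylorCoeff_sum (r : ℕ) {ι : Type*} (I : Finset ι) {f : ι → ℂ → ℂ}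
    (hf : ∀ i ∈ I, AnalyticAt ℂ (f i) 0) :
    taylorCoeff r (fun s => ∑ i ∈ I, f i s) = ∑ i ∈ I, taylorCoeff r (f i) := by
  simp only [taylorCoeff]
  rw [iteratedDeriv_fun_sum fun i hi => (hf i hi).contDiffAt, Finset.sum_div]

theorem taylorCoeff_mul (r : ℕ) {f g : ℂ → ℂ} (hf : AnalyticAt ℂ f 0) (hg : AnalyticAt ℂ g 0) :
    taylorCoeff r (fun s => f s * g s)
      = ∑ i ∈ Finset.range (r + 1), taylorCoeff i f * taylorCoeff (r - i) g := by
  rw [taylorCoeff, iteratedDeriv_fun_mul hf.contDiffAt hg.contDiffAt, Finset.sum_div]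
  refine Finset.sum_congr rfl fun i hi => ?_
  have hir : i ≤ r := Nat.lt_succ_iff.1 (Finset.mem_range.1 hi)
  have hr : (r ! : ℂ) ≠ 0 := by exact_mod_cast r.factorial_ne_zero
  have hi0 : (i ! : ℂ) ≠ 0 := by exact_mod_cast i.factorial_ne_zero
  have hri : ((r - i)! : ℂ) ≠ 0 := by exact_mod_cast (r - i).factorial_ne_zero
  rw [taylorCoeff, taylorCoeff, Nat.cast_choose ℂ hir]
  field_simp

theorem taylorCoeff_deriv (r : ℕ) (f : ℂ → ℂ) :
    taylorCoeff r (deriv f) = (r + 1) * taylorCoeff (r + 1) f := by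
  have hr : (r ! : ℂ) ≠ 0 := by exact_mod_cast r.factorial_ne_zero
  have hr1 : (r : ℂ) + 1 ≠ 0 := by exact_mod_cast r.succ_ne_zero
  rw [taylorCoeff, taylorCoeff, iteratedDeriv_succ', Nat.factorial_succ]
  push_cast
  field_simp

theorem taylorCoeff_natCast_cpow_neg {k : ℕ} (hk : 1 ≤ k) (r : ℕ) :
    taylorCoeff r (fun s : ℂ => (k : ℂ) ^ (-s)) = (-1) ^ r * (Real.log k : ℂ) ^ r / (r ! : ℂ) := by
  have hk0 : (k : ℂ) ≠ 0 := by exact_mod_cast (by lia : k ≠ 0)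
  have hexp : (fun s : ℂ => (k : ℂ) ^ (-s)) = fun s => Complex.exp (-(Real.log k : ℂ) * s) := by
    funext s
    rw [Complex.cpow_def_of_ne_zero hk0, Complex.natCast_log, mul_neg, neg_mul]
  rw [taylorCoeff, hexp, iteratedDeriv_cexp_const_mul]
  simp [neg_pow (Complex.log k)]

theorem taylorCoeff_aeval (P : Polynomial ℚ) (r : ℕ) :
    taylorCoeff r (fun s => Polynomial.aeval s P) = (P.coeff r : ℂ) := by
  refine taylorCoeff_eq_of_hasSum (c := fun r => P.coeff r) (.of_forall fun s => ?_) r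
  simp only [Polynomial.aeval_eq_sum_range, Rat.smul_def, mul_comm _ (s ^ _)]
  refine hasSum_sum_of_ne_finset_zero fun i hi => ?_
  rw [Polynomial.coeff_eq_zero_of_natDegree_lt (by simpa [Nat.lt_succ_iff] using hi)]
  simp

theorem isBigO_taylorCoeff {f : ℂ → ℕ → ℂ} {g : ℕ → ℝ} {R : ℝ} (hR : 0 < R)
    (hf : ∀ᶠ n in atTop, DiffContOnCl ℂ (f · n) (Metric.ball 0 R))
    (h : (fun p : ℂ × ℕ => f p.1 p.2) =O[𝓟 (Metric.sphere 0 R) ×ˢ atTop] fun p => g p.2) (r : ℕ) :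
    (fun n => taylorCoeff r (f · n)) =O[atTop] g := by
  obtain ⟨C, hC⟩ := h.bound
  rw [prod_comm, eventually_map] at hC
  refine IsBigO.of_bound (C / R ^ r) ?_
  filter_upwards [eventually_prod_principal_iff.1 hC, hf] with n hn hdiff
  have hcauchy := Complex.norm_iteratedDeriv_le_of_forall_mem_sphere_norm_le r hR hdiff
    (C := C * ‖g n‖) hn
  rw [taylorCoeff, norm_div, Complex.norm_natCast, div_le_iff₀ (by positivity)]
  exact hcauchy.trans_eq (by ring)

end TaylorCoeff

section TaylorCoeffHarmonicSeries

theorem hasSum_pow_succ_mul_one_div {s : ℂ} (hs : ‖s‖ < 1) (k : ℕ) :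
    HasSum (fun j : ℕ => s ^ (j + 1) * (1 / ((k : ℂ) + 1) ^ (j + 2)))
      (1 / ((k : ℂ) + 1 - s) - 1 / ((k : ℂ) + 1)) := by
  have hk0 : (k : ℂ) + 1 ≠ 0 := by exact_mod_cast k.succ_ne_zero
  have hk1 : ‖(k : ℂ) + 1‖ = k + 1 := by exact_mod_cast Complex.norm_natCast (k + 1)
  have hlt : ‖s‖ < ‖(k : ℂ) + 1‖ := by
    rw [hk1]
    linarith [k.cast_nonneg (α := ℝ)]
  have hks : (k : ℂ) + 1 - s ≠ 0 := fun h => hlt.ne' (by rw [sub_eq_zero.1 h])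
  have hratio : ‖s / ((k : ℂ) + 1)‖ < 1 := by
    rwa [norm_div, div_lt_one (norm_pos_iff.2 hk0)]
  have hlimit : s / ((k : ℂ) + 1) ^ 2 * (1 - s / ((k : ℂ) + 1))⁻¹
      = 1 / ((k : ℂ) + 1 - s) - 1 / ((k : ℂ) + 1) := by
    rw [one_sub_div hk0, inv_div]
    field_simp
    ring
  rw [← hlimit]
  refine ((hasSum_geometric_of_norm_lt_one hratio).mul_left _).congr_fun fun j => ?_
  rw [div_pow, pow_add ((k : ℂ) + 1) j 2, pow_succ s]
  field_simp

theorem summable_pow_succ_mul_one_div {s : ℂ} (hs : ‖s‖ < 1) :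
    Summable fun p : ℕ × ℕ => s ^ (p.2 + 1) * (1 / ((p.1 : ℂ) + 1) ^ (p.2 + 2)) := by
  have hsq : Summable fun k : ℕ => 1 / ((k : ℝ) + 1) ^ 2 := by
    exact_mod_cast (summable_nat_add_iff 1).2 (Real.summable_one_div_nat_pow.2 one_lt_two)
  have hgeom : Summable fun j : ℕ => ‖s‖ ^ (j + 1) :=
    (summable_nat_add_iff 1).2 (summable_geometric_of_lt_one (norm_nonneg _) hs)
  refine .of_norm_bounded (hsq.mul_of_nonneg hgeom (fun k => by positivity)
    fun j => by positivity) fun p => ?_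
  have hnorm : ‖(p.1 : ℂ) + 1‖ = p.1 + 1 := by exact_mod_cast Complex.norm_natCast (p.1 + 1)
  rw [norm_mul, norm_div, norm_one, norm_pow, norm_pow, hnorm, mul_comm]
  gcongr
  · linarith [p.1.cast_nonneg (α := ℝ)]
  · lia

theorem hasSum_one_div_nat_add_one_pow {m : ℕ} (hm : 1 < m) :
    HasSum (fun k : ℕ => 1 / ((k : ℂ) + 1) ^ m) (riemannZeta m) := by
  have hre : 1 < (m : ℂ).re := by exact_mod_cast hm
  have hsum := ((summable_nat_add_iff 1).2 (Complex.summable_one_div_nat_cpow.2 hre)).hasSum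
  simp only [Complex.cpow_natCast, Nat.cast_add, Nat.cast_one] at hsum
  simpa only [zeta_eq_tsum_one_div_nat_add_one_cpow hre, Complex.cpow_natCast] using hsum

theorem hasSum_pow_succ_mul_riemannZeta {s : ℂ} (hs : ‖s‖ < 1 / 2) :
    HasSum (fun j : ℕ => s ^ (j + 1) * riemannZeta (j + 2 : ℕ)) (harmonicSeries s) := by
  have hs1 : ‖s‖ < 1 := hs.trans one_half_lt_one
  have hre : s.re ≤ 1 / 2 := (Complex.re_le_norm s).trans hs.le
  have hsum := summable_pow_succ_mul_one_div hs1
  have hrows := hsum.hasSum.prod_fiberwise (hasSum_pow_succ_mul_one_div hs1)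
  have hcols := hsum.prod_symm.hasSum.prod_fiberwise fun j =>
    (hasSum_one_div_nat_add_one_pow (m := j + 2) (by lia)).mul_left (s ^ (j + 1))
  rw [(hasSum_harmonicSeries hre).unique hrows]
  rwa [← (Equiv.prodComm ℕ ℕ).tsum_eq]

theorem taylorCoeff_harmonicSeries (r : ℕ) :
    taylorCoeff r harmonicSeries = if r = 0 then 0 else riemannZeta (r + 1 : ℕ) := by
  refine taylorCoeff_eq_of_hasSum
    (c := fun r => if r = 0 then 0 else riemannZeta (r + 1 : ℕ)) ?_ r
  filter_upwards [Metric.ball_mem_nhds (0 : ℂ) one_half_pos] with s hs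
  rw [← hasSum_nat_add_iff' 1]
  simpa [add_assoc, one_add_one_eq_two] using
    hasSum_pow_succ_mul_riemannZeta (s := s) (by simpa using hs)

end TaylorCoeffHarmonicSeries

section MultHarm

theorem multHarm_of_neg {r : ℤ} (hr : r < 0) (s t : ℤ) : multHarm r s t = 0 := by
  rw [multHarm, if_pos (Or.inl hr)]

theorem multHarm_of_lt {r s t : ℤ} (h : t < r + s - 1) : multHarm r s t = 0 := by
  rw [multHarm]
  split_ifs
  · rfl
  · rw [Finset.powersetCard_eq_empty.2 (by rw [Int.card_Icc]; lia), Finset.sum_empty]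

theorem multHarm_zero {s t : ℤ} (h : s - 1 ≤ t) : multHarm 0 s t = 1 := by
  rw [multHarm, if_neg (by lia)]
  simp

@[to_additive]
theorem prod_Icc_int_eq_prod_range {M : Type*} [CommMonoid M] (f : ℤ → M) {a b : ℤ} {n : ℕ}
    (h : a + n = b + 1) : ∏ j ∈ Finset.Icc a b, f j = ∏ i ∈ Finset.range n, f (a + i) := by
  refine (Finset.prod_bij (fun (i : ℕ) _ => a + (i : ℤ)) ?_ ?_ ?_ ?_).symm
  · intro i hi
    simp only [Finset.mem_range, Finset.mem_Icc] at *
    lia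
  · intro i _ j _ hij
    simpa using hij
  · intro j hj
    simp only [Finset.mem_range, Finset.mem_Icc] at *
    exact ⟨(j - a).toNat, by lia, by lia⟩
  · intro i _
    rfl

end MultHarm

section HarmPoly

open Polynomial

/-- The polynomial `∏_{l=1}^m (1 + X / l)`, the generating function of `multHarm · 1 m`. -/
noncomputable def harmPoly (m : ℕ) : ℚ[X] :=
  ∏ l ∈ Finset.range m, (1 + C (1 / ((l : ℚ) + 1)) * X)

theorem coeff_harmPoly (m r : ℕ) : (harmPoly m).coeff r = multHarm r 1 m := by
  have hprod : harmPoly m = ∏ i ∈ Finset.Icc (1 : ℤ) m, (1 + C (1 / (i : ℚ)) * X) := by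
    rw [prod_Icc_int_eq_prod_range _ (add_comm 1 (m : ℤ)), harmPoly]
    push_cast
    simp only [add_comm (1 : ℚ)]
  rw [hprod, Finset.prod_one_add, finsetSum_coeff, multHarm, if_neg (by lia), Int.toNat_natCast,
    Finset.powersetCard_eq_filter, Finset.sum_filter]
  refine Finset.sum_congr rfl fun A _ => ?_
  rw [Finset.prod_mul_distrib, Finset.prod_const, ← map_prod, coeff_C_mul_X_pow]
  simp only [eq_comm]

theorem natDegree_harmPoly_le (m : ℕ) : (harmPoly m).natDegree ≤ m :=
  natDegree_le_iff_coeff_eq_zero.2 fun r hr => by rw [coeff_harmPoly, multHarm_of_lt (by lia)]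

theorem add_one_mul_harmPoly_succ (m : ℕ) :
    C ((m : ℚ) + 1) * harmPoly (m + 1) = (C ((m : ℚ) + 1) + X) * harmPoly m := by
  have hm : (m : ℚ) + 1 ≠ 0 := by exact_mod_cast m.succ_ne_zero
  have hC : (C ((m : ℚ) + 1) * C (1 / ((m : ℚ) + 1)) : ℚ[X]) = 1 := by
    rw [← C_mul, mul_one_div_cancel hm, C_1]
  rw [harmPoly, Finset.prod_range_succ, ← harmPoly]
  linear_combination X * harmPoly m * hC

theorem add_one_mul_aeval_harmPoly_succ (m : ℕ) (s : ℂ) :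
    (m + 1) * aeval s (harmPoly (m + 1)) = (m + 1 + s) * aeval s (harmPoly m) := by
  simpa using congrArg (aeval s) (add_one_mul_harmPoly_succ m)

theorem add_one_mul_aeval_derivative_harmPoly_succ (m : ℕ) (s : ℂ) :
    (m + 1) * aeval s (derivative (harmPoly (m + 1)))
      = aeval s (harmPoly m) + (m + 1 + s) * aeval s (derivative (harmPoly m)) := by
  simpa using congrArg (fun P => aeval s (derivative P)) (add_one_mul_harmPoly_succ m)

theorem add_one_mul_risingCoeff_succ_eq_mul_aeval_harmPoly (m : ℕ) (s : ℂ) :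
    (m + 1) * risingCoeff (m + 1) s = s * aeval s (harmPoly m) := by
  induction m with
  | zero => simp [risingCoeff, harmPoly]
  | succ m ih =>
    have hm : (m : ℂ) + 1 ≠ 0 := by exact_mod_cast m.succ_ne_zero
    have hrising := add_one_mul_risingCoeff_succ (m + 1) s
    have hharm := add_one_mul_aeval_harmPoly_succ m s
    apply mul_left_cancel₀ hm
    push_cast at *
    linear_combination (m + 1) * hrising + (s + (m + 1)) * ih - s * hharm

theorem aeval_harmPoly_succ_sub (m : ℕ) (s : ℂ) :
    aeval s (harmPoly (m + 1)) - aeval s (harmPoly m) = risingCoeff (m + 1) s := by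
  have hm : (m : ℂ) + 1 ≠ 0 := by exact_mod_cast m.succ_ne_zero
  apply mul_left_cancel₀ hm
  linear_combination add_one_mul_aeval_harmPoly_succ m s
    - add_one_mul_risingCoeff_succ_eq_mul_aeval_harmPoly m s

theorem taylorCoeff_risingCoeff_succ (m r : ℕ) :
    taylorCoeff r (risingCoeff (m + 1)) = (multHarm ((r : ℤ) - 1) 1 m : ℂ) / (m + 1) := by
  have hm : (m : ℂ) + 1 ≠ 0 := by exact_mod_cast m.succ_ne_zero
  have hrising : risingCoeff (m + 1) = fun s => aeval s (X * harmPoly m) * (1 / ((m : ℂ) + 1)) := by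
    funext s
    rw [map_mul, aeval_X, ← add_one_mul_risingCoeff_succ_eq_mul_aeval_harmPoly]
    field_simp
  rw [hrising, taylorCoeff_mul_const, taylorCoeff_aeval, mul_one_div]
  rcases r with _ | r
  · simp [multHarm_of_neg]
  · simp [coeff_X_mul, coeff_harmPoly]

theorem taylorCoeff_risingCoeff_zero (r : ℕ) :
    taylorCoeff r (risingCoeff 0) = if r = 0 then 1 else 0 := by
  simpa [coeff_one, funext risingCoeff_zero, apply_ite] using taylorCoeff_aeval 1 r

end HarmPoly

section RisingCoeffConvolution

open Polynomial Finset.HasAntidiagonal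

theorem add_one_mul_sum_antidiagonal_risingCoeff_mul_neg (N : ℕ) (s : ℂ) :
    (N + 1) * ∑ p ∈ antidiagonal (N + 1), risingCoeff p.1 s * risingCoeff p.2 (-s)
      = N * ∑ p ∈ antidiagonal N, risingCoeff p.1 s * risingCoeff p.2 (-s) := by
  have hsplit : (N + 1) * ∑ p ∈ antidiagonal (N + 1), risingCoeff p.1 s * risingCoeff p.2 (-s)
      = ∑ p ∈ antidiagonal (N + 1), (p.1 : ℂ) * (risingCoeff p.1 s * risingCoeff p.2 (-s))
        + ∑ p ∈ antidiagonal (N + 1), (p.2 : ℂ) * (risingCoeff p.1 s * risingCoeff p.2 (-s)) := by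
    rw [← Finset.sum_add_distrib, Finset.mul_sum]
    refine Finset.sum_congr rfl fun p hp => ?_
    have hp : (p.1 : ℂ) + p.2 = N + 1 := by exact_mod_cast mem_antidiagonal.1 hp
    rw [← hp]
    ring
  rw [hsplit, Finset.Nat.sum_antidiagonal_succ, Finset.Nat.sum_antidiagonal_succ', Finset.mul_sum]
  simp only [Nat.cast_zero, zero_mul, zero_add]
  rw [← Finset.sum_add_distrib]
  refine Finset.sum_congr rfl fun p hp => ?_
  have hp : (p.1 : ℂ) + p.2 = N := by exact_mod_cast mem_antidiagonal.1 hp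
  rw [← hp]
  push_cast
  linear_combination risingCoeff p.2 (-s) * add_one_mul_risingCoeff_succ p.1 s
    + risingCoeff p.1 s * add_one_mul_risingCoeff_succ p.2 (-s)

/-- `(1 - x) ^ (-s) * (1 - x) ^ s = 1`. -/
theorem sum_antidiagonal_risingCoeff_mul_neg (N : ℕ) (s : ℂ) :
    ∑ p ∈ antidiagonal (N + 1), risingCoeff p.1 s * risingCoeff p.2 (-s) = 0 := by
  have hstep := add_one_mul_sum_antidiagonal_risingCoeff_mul_neg
  induction N with
  | zero => simpa using hstep 0 s
  | succ N ih =>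
    have hN := hstep (N + 1) s
    rw [ih, mul_zero] at hN
    exact (mul_eq_zero.1 hN).resolve_left (by exact_mod_cast (N + 1).succ_ne_zero)

theorem sum_range_risingCoeff_succ_mul_neg (N : ℕ) (s : ℂ) :
    ∑ k ∈ Finset.range (N + 1), risingCoeff (k + 1) s * risingCoeff (N - k) (-s)
      = -risingCoeff (N + 1) (-s) := by
  have h := sum_antidiagonal_risingCoeff_mul_neg N s
  rw [Finset.Nat.sum_antidiagonal_eq_sum_range_succ
    (fun i j => risingCoeff i s * risingCoeff j (-s)), Finset.sum_range_succ'] at h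
  simp only [risingCoeff_zero, one_mul, Nat.sub_zero, Nat.add_sub_add_right] at h
  linear_combination h

/-- `(1 - x) ^ s * (1 - x) ^ (-1 - s) = 1 / (1 - x)`. -/
theorem sum_antidiagonal_risingCoeff_neg_mul_harmPoly (Q : ℕ) (s : ℂ) :
    ∑ p ∈ antidiagonal Q, risingCoeff p.1 (-s) * aeval s (harmPoly p.2) = 1 := by
  induction Q with
  | zero => simp [harmPoly]
  | succ Q ih =>
    have hrising := sum_antidiagonal_risingCoeff_mul_neg Q (-s)
    rw [neg_neg, Finset.Nat.sum_antidiagonal_succ'] at hrising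
    rw [Finset.Nat.sum_antidiagonal_succ', ← ih, ← sub_eq_zero, add_sub_assoc,
      ← Finset.sum_sub_distrib, ← hrising]
    simp only [← mul_sub, aeval_harmPoly_succ_sub, risingCoeff_zero]
    simp [harmPoly]

theorem sum_range_risingCoeff_succ_neg_mul_harmPoly (Q : ℕ) (s : ℂ) :
    ∑ N ∈ Finset.range Q, risingCoeff (N + 1) (-s) * aeval s (harmPoly (Q - 1 - N))
      = 1 - aeval s (harmPoly Q) := by
  have h := sum_antidiagonal_risingCoeff_neg_mul_harmPoly Q s
  rw [Finset.Nat.sum_antidiagonal_eq_sum_range_succ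
    (fun i j => risingCoeff i (-s) * aeval s (harmPoly j)), Finset.sum_range_succ'] at h
  simp only [risingCoeff_zero, one_mul, Nat.sub_zero, Nat.sub_add_eq, Nat.sub_right_comm _ _ 1] at h
  linear_combination h

theorem add_one_mul_sum_risingCoeff_neg_div_mul_harmPoly (Q : ℕ) (s : ℂ) :
    (Q + 1) * ∑ N ∈ Finset.range (Q + 1),
        -(risingCoeff (N + 1) (-s) / (N + 1)) * aeval s (harmPoly (Q - N))
      = (Q + 1 + s) * ∑ N ∈ Finset.range Q,
          -(risingCoeff (N + 1) (-s) / (N + 1)) * aeval s (harmPoly (Q - 1 - N))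
        + risingCoeff (Q + 1) s := by
  have hterm : ∀ N ∈ Finset.range Q,
      (Q + 1) * (-(risingCoeff (N + 1) (-s) / (N + 1)) * aeval s (harmPoly (Q - N)))
        = (Q + 1 + s) * (-(risingCoeff (N + 1) (-s) / (N + 1)) * aeval s (harmPoly (Q - 1 - N)))
          + risingCoeff (N + 1) (-s) * aeval s (harmPoly (Q - 1 - N))
          - risingCoeff (N + 1) (-s) * aeval s (harmPoly (Q - N)) := by
    intro N hN
    obtain ⟨M, rfl⟩ := Nat.exists_eq_add_of_lt (Finset.mem_range.1 hN)
    have hN0 : (N : ℂ) + 1 ≠ 0 := by exact_mod_cast N.succ_ne_zero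
    rw [show N + M + 1 - N = M + 1 by lia, show N + M + 1 - 1 - N = M by lia]
    push_cast
    field_simp
    linear_combination -risingCoeff (N + 1) (-s) * add_one_mul_aeval_harmPoly_succ M s
  have hlast : ((Q : ℂ) + 1) * (-(risingCoeff (Q + 1) (-s) / (Q + 1)) * aeval s (harmPoly (Q - Q)))
      = -(risingCoeff (Q + 1) (-s) * aeval s (harmPoly (Q - Q))) := by
    have hQ0 : (Q : ℂ) + 1 ≠ 0 := by exact_mod_cast Q.succ_ne_zero
    field_simp
  have hQ := sum_range_risingCoeff_succ_neg_mul_harmPoly Q s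
  have hQ1 := sum_range_risingCoeff_succ_neg_mul_harmPoly (Q + 1) s
  rw [Finset.sum_range_succ, Nat.add_sub_cancel] at hQ1
  rw [Finset.sum_range_succ, mul_add, hlast, Finset.mul_sum, Finset.sum_congr rfl hterm,
    Finset.sum_sub_distrib, Finset.sum_add_distrib, ← Finset.mul_sum, hQ,
    ← aeval_harmPoly_succ_sub Q s, eq_sub_of_add_eq hQ1]
  ring

theorem sum_risingCoeff_neg_div_mul_harmPoly (Q : ℕ) (s : ℂ) :
    ∑ N ∈ Finset.range Q, -(risingCoeff (N + 1) (-s) / (N + 1)) * aeval s (harmPoly (Q - 1 - N))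
      = (harmonic Q : ℂ) * aeval s (harmPoly Q) - aeval s (derivative (harmPoly Q)) := by
  induction Q with
  | zero => simp [harmPoly]
  | succ Q ih =>
    have hQ0 : (Q : ℂ) + 1 ≠ 0 := by exact_mod_cast Q.succ_ne_zero
    apply mul_left_cancel₀ hQ0
    rw [Nat.add_sub_cancel, add_one_mul_sum_risingCoeff_neg_div_mul_harmPoly, ih,
      ← aeval_harmPoly_succ_sub, harmonic_succ]
    push_cast
    field_simp
    linear_combination add_one_mul_aeval_derivative_harmPoly_succ Q s
      - (harmonic Q : ℂ) * add_one_mul_aeval_harmPoly_succ Q s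

end RisingCoeffConvolution

section RatD

open Polynomial

/-- The polynomial in `X` whose coefficients are the inner brackets in the definition of `ratD`,
with `M = q - j - 2` and with `j + 1` in place of the index `j` used there. -/
noncomputable def bracketPoly (M j : ℕ) : ℚ[X] :=
  C (1 / ((j : ℚ) + 1)) * harmPoly M
    - ∑ v ∈ Finset.range M, C (1 / (((v : ℚ) + 1) * (v + 1 + (j + 1)))) *
        (X * ((harmPoly v).comp (-X) * harmPoly (M - 1 - v)))

theorem aeval_bracketPoly (M j : ℕ) (s : ℂ) :
    aeval s (bracketPoly M j) = ∑ v ∈ Finset.range (M + 1),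
      risingCoeff v (-s) / (v + j + 1) * aeval s (harmPoly (M - v)) := by
  rw [Finset.sum_range_succ', bracketPoly, map_sub, map_sum, sub_eq_neg_add,
    ← Finset.sum_neg_distrib]
  congr 1
  · refine Finset.sum_congr rfl fun v _ => ?_
    have hv : (v : ℂ) + 1 ≠ 0 := by exact_mod_cast v.succ_ne_zero
    have hvj : (v : ℂ) + 1 + (j + 1) ≠ 0 := by exact_mod_cast (v + 1 + j).succ_ne_zero
    have hrising := add_one_mul_risingCoeff_succ_eq_mul_aeval_harmPoly v (-s)
    simp only [map_mul, aeval_C, aeval_X, aeval_comp, map_neg, Nat.sub_sub, add_comm 1 v]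
    simp only [eq_ratCast, Rat.cast_div, Rat.cast_mul, Rat.cast_add, Rat.cast_one,
      Rat.cast_natCast, Nat.cast_add, Nat.cast_one]
    rw [add_assoc ((v : ℂ) + 1)]
    field_simp
    linear_combination -aeval s (harmPoly (M - (v + 1))) * hrising
  · simp

theorem mul_sum_aeval_harmPoly_mul_aeval_bracketPoly (Q : ℕ) (s : ℂ) :
    s * ∑ j ∈ Finset.range Q, 1 / ((j : ℂ) + 1) *
        (aeval s (harmPoly j) * aeval s (bracketPoly (Q - 1 - j) j))
      = (harmonic Q : ℂ) * aeval s (harmPoly Q) - aeval s (derivative (harmPoly Q)) := by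
  have hterm : ∀ j ∈ Finset.range Q, s * (1 / ((j : ℂ) + 1) *
        (aeval s (harmPoly j) * aeval s (bracketPoly (Q - 1 - j) j)))
      = ∑ v ∈ Finset.range (Q - j), risingCoeff (j + 1) s *
          (risingCoeff v (-s) / (v + j + 1) * aeval s (harmPoly (Q - 1 - (j + v)))) := by
    intro j hj
    have hjQ : Q - 1 - j + 1 = Q - j := by
      have := Finset.mem_range.1 hj
      lia
    have hj0 : (j : ℂ) + 1 ≠ 0 := by exact_mod_cast j.succ_ne_zero
    simp only [aeval_bracketPoly, ← Finset.mul_sum, hjQ, ← Nat.sub_sub]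
    field_simp
    rw [← add_one_mul_risingCoeff_succ_eq_mul_aeval_harmPoly]
    ring
  rw [← sum_risingCoeff_neg_div_mul_harmPoly, Finset.mul_sum, Finset.sum_congr rfl hterm,
    ← Finset.sum_range_diag_flip]
  refine Finset.sum_congr rfl fun N _ => ?_
  rw [neg_div', ← sum_range_risingCoeff_succ_mul_neg, Finset.sum_div, Finset.sum_mul]
  refine Finset.sum_congr rfl fun k hk => ?_
  have hkN : k ≤ N := Nat.lt_succ_iff.1 (Finset.mem_range.1 hk)
  rw [Nat.add_sub_cancel' hkN, Nat.cast_sub hkN, sub_add_cancel]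
  ring

theorem X_mul_sum_harmPoly_mul_bracketPoly (Q : ℕ) :
    X * ∑ j ∈ Finset.range Q, C (1 / ((j : ℚ) + 1)) * (harmPoly j * bracketPoly (Q - 1 - j) j)
      = C (harmonic Q) * harmPoly Q - derivative (harmPoly Q) := by
  refine Polynomial.funext fun x => (algebraMap ℚ ℂ).injective ?_
  simp only [← aeval_algebraMap_apply_eq_algebraMap_eval]
  simpa [map_sum] using mul_sum_aeval_harmPoly_mul_aeval_bracketPoly Q (algebraMap ℚ ℂ x)

theorem natDegree_harmPoly_comp_neg_X_le (m : ℕ) : ((harmPoly m).comp (-X)).natDegree ≤ m := by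
  simpa [natDegree_comp] using natDegree_harmPoly_le m

theorem natDegree_bracketPoly_le (M j : ℕ) : (bracketPoly M j).natDegree ≤ M := by
  refine (natDegree_sub_le _ _).trans (max_le ?_ ?_)
  · exact (natDegree_C_mul_le _ _).trans (natDegree_harmPoly_le M)
  · refine natDegree_sum_le_of_forall_le _ _ fun v hv => ?_
    have hvM : 1 + (v + (M - 1 - v)) = M := by
      have := Finset.mem_range.1 hv
      lia
    refine (natDegree_C_mul_le _ _).trans (natDegree_mul_le.trans ?_)
    rw [natDegree_X]
    nth_rw 2 [← hvM]
    gcongr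
    exact natDegree_mul_le.trans
      (add_le_add (natDegree_harmPoly_comp_neg_X_le v) (natDegree_harmPoly_le _))

theorem coeff_X_mul_mul_harmPoly {P : ℚ[X]} {d : ℕ} (hP : P.natDegree ≤ d) (m T : ℕ) :
    (X * (P * harmPoly m)).coeff T
      = ∑ i ∈ Finset.range (d + 1), P.coeff i * multHarm ((T : ℤ) - 1 - i) 1 m := by
  have hexpand : X * (P * harmPoly m)
      = ∑ i ∈ Finset.range (d + 1), C (P.coeff i) * (X ^ (i + 1) * harmPoly m) := by
    conv_lhs => rw [P.as_sum_range_C_mul_X_pow' (Nat.lt_succ_of_le hP)]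
    rw [Finset.sum_mul, Finset.mul_sum]
    refine Finset.sum_congr rfl fun i _ => ?_
    ring
  rw [hexpand, finsetSum_coeff]
  refine Finset.sum_congr rfl fun i _ => ?_
  rw [coeff_C_mul, coeff_X_pow_mul']
  congr 1
  split_ifs with hi
  · rw [coeff_harmPoly]
    congr 1
    lia
  · rw [multHarm_of_neg (by lia)]

theorem coeff_bracketPoly (M j T : ℕ) :
    (bracketPoly M j).coeff T = multHarm T 1 M / ((j : ℚ) + 1)
      - ∑ v ∈ Finset.Icc (1 : ℤ) M, (∑ i ∈ Finset.Icc 0 (v - 1),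
          (-1) ^ i * multHarm i 1 (v - 1) * multHarm ((T : ℤ) - 1 - i) 1 (M - v)) /
        ((v : ℚ) * (v + (j + 1))) := by
  rw [bracketPoly, coeff_sub, coeff_C_mul, coeff_harmPoly, finsetSum_coeff, one_div_mul_eq_div,
    sum_Icc_int_eq_sum_range _ (add_comm 1 (M : ℤ))]
  congr 1
  refine Finset.sum_congr rfl fun v hv => ?_
  have hvM : ((M - 1 - v : ℕ) : ℤ) = M - (1 + v) := by
    have := Finset.mem_range.1 hv
    lia
  rw [coeff_C_mul, coeff_X_mul_mul_harmPoly (natDegree_harmPoly_comp_neg_X_le v),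
    one_div_mul_eq_div, sum_Icc_int_eq_sum_range (n := v + 1) _ (by push_cast; ring), hvM]
  congr 1
  · refine Finset.sum_congr rfl fun i _ => ?_
    rw [← neg_one_mul (X : ℚ[X]), ← C_1, ← C_neg, comp_C_mul_X_coeff, coeff_harmPoly, zero_add,
      add_sub_cancel_left, zpow_natCast, mul_comm (multHarm i 1 v)]
  · push_cast
    ring

theorem coeff_sum_harmPoly_mul_bracketPoly (Q R : ℕ) :
    (∑ j ∈ Finset.range Q, C (1 / ((j : ℚ) + 1)) *
        (harmPoly j * bracketPoly (Q - 1 - j) j)).coeff R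
      = ∑ u ∈ Finset.range (R + 1), ∑ j ∈ Finset.range (Q + u - R),
          multHarm u 1 j / ((j : ℚ) + 1) * (bracketPoly (Q - 1 - j) j).coeff (R - u) := by
  have hterm : ∀ j : ℕ, (C (1 / ((j : ℚ) + 1)) * (harmPoly j * bracketPoly (Q - 1 - j) j)).coeff R
      = ∑ u ∈ Finset.range (R + 1),
          multHarm u 1 j / ((j : ℚ) + 1) * (bracketPoly (Q - 1 - j) j).coeff (R - u) := by
    intro j
    rw [coeff_C_mul, coeff_mul, Finset.Nat.sum_antidiagonal_eq_sum_range_succ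
      (fun a b => (harmPoly j).coeff a * (bracketPoly (Q - 1 - j) j).coeff b), Finset.mul_sum]
    refine Finset.sum_congr rfl fun u _ => ?_
    rw [coeff_harmPoly]
    ring
  rw [finsetSum_coeff, Finset.sum_congr rfl fun j _ => hterm j, Finset.sum_comm]
  refine Finset.sum_congr rfl fun u hu => ?_
  have huR := Finset.mem_range.1 hu
  refine (Finset.sum_subset (Finset.range_subset_range.2 (by lia)) fun j hj hj' => ?_).symm
  rw [Finset.mem_range] at hj hj'
  rw [coeff_eq_zero_of_natDegree_lt ((natDegree_bracketPoly_le _ _).trans_lt (by lia)), mul_zero]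

theorem ratD_add_two {R Q : ℕ} (h : R ≤ Q) : ratD (R + 2) (Q + 2)
    = (∑ j ∈ Finset.range Q, C (1 / ((j : ℚ) + 1)) *
        (harmPoly j * bracketPoly (Q - 1 - j) j)).coeff R
      + multHarm (R + 1) 1 Q / ((Q : ℚ) + 1) - multHarm (R + 2) 1 Q := by
  rw [coeff_sum_harmPoly_mul_bracketPoly, ratD,
    sum_Icc_int_eq_sum_range (n := R + 1) _ (by push_cast; ring)]
  congr 2
  · refine Finset.sum_congr rfl fun u hu => ?_
    have huR : u ≤ R := Nat.lt_succ_iff.1 (Finset.mem_range.1 hu)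
    rw [sum_Icc_int_eq_sum_range (n := Q + u - R) _ (by lia)]
    refine Finset.sum_congr rfl fun j hj => ?_
    have hjQ : (Q : ℤ) + 2 - (1 + j) - 2 = (Q - 1 - j : ℕ) := by
      have := Finset.mem_range.1 hj
      lia
    have hRu : (R : ℤ) + 2 - 2 - (0 + u) = (R - u : ℕ) := by lia
    have hRu' : (R : ℤ) + 2 - 3 - (0 + u) = (R - u : ℕ) - 1 := by lia
    rw [coeff_bracketPoly, hjQ, hRu, hRu', zero_add, add_sub_cancel_left]
    push_cast
    simp only [add_comm (1 : ℚ)]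
  · push_cast
    ring_nf
  · ring_nf

theorem harmonic_eq_multHarm (Q : ℕ) : harmonic Q = multHarm 1 1 Q := by
  have h := congrArg (coeff · 0) (X_mul_sum_harmPoly_mul_bracketPoly Q)
  simp only [mul_coeff_zero, coeff_X_zero, zero_mul, coeff_sub, coeff_C_zero, coeff_derivative,
    coeff_harmPoly, Nat.cast_zero, zero_add, Nat.cast_one, mul_one] at h
  rw [multHarm_zero (by lia), mul_one] at h
  exact (sub_eq_zero.1 h.symm)

theorem ratD_eq {r q : ℕ} (hq : 2 ≤ q) (hr : r < q) : ratD r q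
    = harmonic (q - 1) * multHarm ((r : ℤ) - 1) 1 ((q : ℤ) - 2)
      - (r + 1) * multHarm r 1 ((q : ℤ) - 2) := by
  obtain ⟨Q, rfl⟩ := Nat.exists_eq_add_of_le' hq
  have hQ : ((Q + 2 : ℕ) : ℤ) - 2 = Q := by simp
  have hQ1 : Q + 2 - 1 = Q + 1 := rfl
  rw [hQ, hQ1, harmonic_succ]
  rcases r with _ | _ | R
  · simp [ratD, multHarm_of_neg, multHarm_zero]
  · simp [ratD, multHarm_zero, harmonic_eq_multHarm]
    ring
  · have h := congrArg (coeff · (R + 1)) (X_mul_sum_harmPoly_mul_bracketPoly Q)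
    simp only [coeff_X_mul, coeff_sub, coeff_C_mul, coeff_derivative, coeff_harmPoly] at h
    have hratD := ratD_add_two (show R ≤ Q by lia)
    push_cast at h ⊢
    rw [add_assoc (R : ℤ) 1 1, one_add_one_eq_two] at h ⊢
    rw [hratD, h, show (R : ℤ) + 2 - 1 = R + 1 by ring]
    ring

end RatD

section LogPowSum

open Metric

theorem analyticAt_natCast_cpow_neg {k : ℕ} (hk : 1 ≤ k) (z : ℂ) :
    AnalyticAt ℂ (fun s : ℂ => (k : ℂ) ^ (-s)) z :=
  (differentiable_natCast_cpow hk differentiable_neg).analyticAt z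

theorem analyticAt_harmonicSeries {z : ℂ} (hz : z ∈ ball (0 : ℂ) (1 / 2)) :
    AnalyticAt ℂ harmonicSeries z :=
  differentiableOn_harmonicSeries.analyticAt (isOpen_ball.mem_nhds hz)

theorem analyticAt_expansionCoeff (q i n : ℕ) {z : ℂ} (hz : z ∈ ball (0 : ℂ) (1 / 2)) :
    AnalyticAt ℂ (fun s => expansionCoeff q i s n) z := by
  have hrising := (differentiable_risingCoeff i).analyticAt z
  unfold expansionCoeff resonantCoeff
  split_ifs
  · exact (hrising.fun_mul (analyticAt_const.fun_add (analyticAt_harmonicSeries hz))).fun_sub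
      hrising.deriv
  · exact hrising.fun_mul analyticAt_const

theorem analyticAt_riemannZeta_sub_natCast (j : ℕ) {z : ℂ} (hz : z ∈ ball (0 : ℂ) (1 / 2)) :
    AnalyticAt ℂ (fun s => riemannZeta (s - j)) z := by
  refine DifferentiableOn.analyticAt (fun s hs => ?_) (isOpen_ball.mem_nhds hz)
  have hre : s.re ≤ 1 / 2 := (Complex.re_le_norm s).trans (by simpa using (mem_ball.1 hs).le)
  have hne : s - j ≠ 1 := fun h => add_one_sub_ne_zero hre j (by linear_combination -h)
  exact ((differentiableAt_riemannZeta hne).comp s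
    (differentiableAt_id.sub_const _)).differentiableWithinAt

theorem powConvExpansion_eq {q : ℕ} (hq : 1 ≤ q) (s : ℂ) (n I J : ℕ) :
    powConvExpansion q s n I J
      = ∑ i ∈ Finset.range I, expansionCoeff q i s n * (n : ℂ) ^ (-s) * (1 / (n : ℂ) ^ i)
        + ∑ j ∈ Finset.range J, ((q + j - 1).choose j : ℂ) * riemannZeta (s - j)
          * (1 / (n : ℂ) ^ (q + j)) := by
  rw [powConvExpansion, if_neg (by lia), add_zero, Finset.mul_sum]
  exact congrArg (· + _) (Finset.sum_congr rfl fun i _ => by ring)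

theorem analyticAt_powConvExpansion {q : ℕ} (hq : 1 ≤ q) {n : ℕ} (hn : 1 ≤ n) (I J : ℕ) {z : ℂ}
    (hz : z ∈ ball (0 : ℂ) (1 / 2)) :
    AnalyticAt ℂ (fun s => powConvExpansion q s n I J) z := by
  simp only [powConvExpansion_eq hq]
  refine AnalyticAt.fun_add (Finset.analyticAt_fun_sum _ fun i _ => ?_)
    (Finset.analyticAt_fun_sum _ fun j _ => ?_)
  · exact ((analyticAt_expansionCoeff q i n hz).fun_mul
      (analyticAt_natCast_cpow_neg hn z)).fun_mul analyticAt_const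
  · exact (analyticAt_const.fun_mul
      (analyticAt_riemannZeta_sub_natCast j hz)).fun_mul analyticAt_const

theorem analyticAt_powConv (q n : ℕ) (z : ℂ) : AnalyticAt ℂ (fun s => powConv q s n) z := by
  unfold powConv
  refine Finset.analyticAt_fun_sum _ fun k hk => ?_
  simp only [div_eq_mul_inv]
  exact (analyticAt_natCast_cpow_neg (Finset.mem_Ico.1 hk).1 z).fun_mul analyticAt_const

theorem logPowSum_eq_taylorCoeff (p q n : ℕ) :
    (logPowSum p q n : ℂ) = (-1) ^ p * (p ! : ℂ) * taylorCoeff p (fun s => powConv q s n) := by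
  have hp : (p ! : ℂ) ≠ 0 := by exact_mod_cast p.factorial_ne_zero
  have hsign : (-1 : ℂ) ^ p * (-1) ^ p = 1 := by rw [← mul_pow]; simp
  unfold powConv
  simp only [div_eq_mul_inv]
  rw [taylorCoeff_sum _ _ fun k hk =>
    (analyticAt_natCast_cpow_neg (Finset.mem_Ico.1 hk).1 0).fun_mul analyticAt_const, logPowSum]
  push_cast
  rw [Finset.mul_sum]
  refine Finset.sum_congr rfl fun k hk => ?_
  rw [taylorCoeff_mul_const, taylorCoeff_natCast_cpow_neg (Finset.mem_Ico.1 hk).1,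
    ← Complex.natCast_log]
  field_simp
  linear_combination (-((Real.log k : ℂ) ^ p * (((n : ℂ) - k) ^ q)⁻¹)) * hsign

/-- The coefficient of `1 / n ^ i`, a polynomial in `log n`, in the expansion of `logPowSum p q n`:
`(-1) ^ p * p!` times the `p`-th Taylor coefficient of `expansionCoeff q i s n * n ^ (-s)`. -/
noncomputable def logPoly (p q i n : ℕ) : ℂ :=
  ∑ r ∈ Finset.range (p + 1), (-1) ^ r * ((p ! : ℂ) / ((p - r)! : ℂ)) *
    taylorCoeff r (fun s => expansionCoeff q i s n) * (Real.log n : ℂ) ^ (p - r)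

/-- The truncated asymptotic expansion of `logPowSum p q n`, obtained from `powConvExpansion` by
taking Taylor coefficients. -/
noncomputable def logPowExpansion (p q n I J : ℕ) : ℂ :=
  ∑ i ∈ Finset.range I, logPoly p q i n * (1 / (n : ℂ) ^ i)
    + ∑ j ∈ Finset.range J, (-1) ^ p * ((q + j - 1).choose j : ℂ) * zetaDeriv p (-(j : ℂ))
      * (1 / (n : ℂ) ^ (q + j))

theorem taylorCoeff_expansionCoeff_mul_cpow (p q i : ℕ) {n : ℕ} (hn : 1 ≤ n) :
    (-1) ^ p * (p ! : ℂ) * taylorCoeff p (fun s => expansionCoeff q i s n * (n : ℂ) ^ (-s))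
      = logPoly p q i n := by
  rw [taylorCoeff_mul p (analyticAt_expansionCoeff q i n (by simp))
    (analyticAt_natCast_cpow_neg hn 0), logPoly, Finset.mul_sum]
  refine Finset.sum_congr rfl fun r hr => ?_
  obtain ⟨d, rfl⟩ := Nat.exists_eq_add_of_le (Nat.lt_succ_iff.1 (Finset.mem_range.1 hr))
  have hsign : (-1 : ℂ) ^ d * (-1) ^ d = 1 := by rw [← mul_pow]; simp
  rw [taylorCoeff_natCast_cpow_neg hn, Nat.add_sub_cancel_left, pow_add]
  linear_combination ((-1) ^ r * (((r + d)! : ℂ) / (d ! : ℂ)) *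
    taylorCoeff r (fun s => expansionCoeff q i s n) * (Real.log n : ℂ) ^ d) * hsign

theorem factorial_mul_taylorCoeff_riemannZeta_sub (p j : ℕ) :
    (p ! : ℂ) * taylorCoeff p (fun s => riemannZeta (s - j)) = zetaDeriv p (-(j : ℂ)) := by
  rw [factorial_mul_taylorCoeff, iteratedDeriv_comp_sub_const, zetaDeriv]
  simp only [zero_sub]

theorem taylorCoeff_powConvExpansion (p : ℕ) {q : ℕ} (hq : 1 ≤ q) {n : ℕ} (hn : 1 ≤ n) (I J : ℕ) :
    (-1) ^ p * (p ! : ℂ) * taylorCoeff p (fun s => powConvExpansion q s n I J)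
      = logPowExpansion p q n I J := by
  have h0 : (0 : ℂ) ∈ ball (0 : ℂ) (1 / 2) := by simp
  have hnear := fun i => ((analyticAt_expansionCoeff q i n h0).fun_mul
    (analyticAt_natCast_cpow_neg hn 0)).fun_mul (analyticAt_const (v := 1 / (n : ℂ) ^ i))
  have hfar := fun j => ((analyticAt_const (v := ((q + j - 1).choose j : ℂ))).fun_mul
    (analyticAt_riemannZeta_sub_natCast j h0)).fun_mul
      (analyticAt_const (v := 1 / (n : ℂ) ^ (q + j)))
  simp only [powConvExpansion_eq hq]
  rw [taylorCoeff_add p (Finset.analyticAt_fun_sum _ fun i _ => hnear i)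
      (Finset.analyticAt_fun_sum _ fun j _ => hfar j),
    taylorCoeff_sum _ _ fun i _ => hnear i, taylorCoeff_sum _ _ fun j _ => hfar j,
    mul_add, Finset.mul_sum, Finset.mul_sum, logPowExpansion]
  congr 1
  · refine Finset.sum_congr rfl fun i _ => ?_
    rw [taylorCoeff_mul_const, ← taylorCoeff_expansionCoeff_mul_cpow p q i hn, ← mul_assoc]
  · refine Finset.sum_congr rfl fun j _ => ?_
    rw [taylorCoeff_mul_const, taylorCoeff_const_mul,
      ← factorial_mul_taylorCoeff_riemannZeta_sub p j]
    ring

theorem diffContOnCl_powConv_sub {q : ℕ} (hq : 1 ≤ q) {n : ℕ} (hn : 1 ≤ n) (I J : ℕ) :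
    DiffContOnCl ℂ (fun s => powConv q s n - powConvExpansion q s n I J) (ball 0 (1 / 4)) :=
  DifferentiableOn.diffContOnCl_ball (U := ball 0 (1 / 2))
    (fun z hz => ((analyticAt_powConv q n z).fun_sub
      (analyticAt_powConvExpansion hq hn I J hz)).differentiableAt.differentiableWithinAt)
    (closedBall_subset_ball (by norm_num))

theorem isBigO_powConv_sub_sphere (q m : ℕ) :
    (fun x : ℂ × ℕ =>
        powConv q x.1 x.2 - powConvExpansion q x.1 x.2 (q + m + 1) (q + m + 5))
      =O[𝓟 (sphere 0 (1 / 4)) ×ˢ atTop] fun x => 1 / (x.2 : ℝ) ^ (m + q) := by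
  have hre : ∀ s ∈ sphere (0 : ℂ) (1 / 4), |s.re| ≤ 1 / 4 := fun s hs =>
    (Complex.abs_re_le_norm s).trans (mem_sphere_zero_iff_norm.1 hs).le
  refine (isBigO_powConv_sub (I := q + m + 1) (by lia) (q + m + 4) isBounded_sphere
    (fun s hs => ?_) (fun s hs => ?_)).trans
    (isBigO_principal_prod_of_norm_le 1 fun s hs n hn => ?_)
  · linarith [(abs_le.1 (hre s hs)).2]
  · push_cast
    linarith [(abs_le.1 (hre s hs)).2]
  · have hexp : -s.re - ((q + m + 1 : ℕ) : ℝ) ≤ -((m + q : ℕ) : ℝ) := by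
      push_cast
      linarith [(abs_le.1 (hre s hs)).1]
    have hn' : (1 : ℝ) ≤ n := by exact_mod_cast hn
    rw [Real.norm_of_nonneg (by positivity), Real.norm_of_nonneg (by positivity), one_mul, one_div,
      ← Real.rpow_natCast, ← Real.rpow_neg (by positivity)]
    exact Real.rpow_le_rpow_of_exponent_le hn' hexp

theorem isBigO_logPowSum_sub_logPowExpansion_add (p : ℕ) {q : ℕ} (hq : 1 ≤ q) (m : ℕ) :
    (fun n : ℕ => (logPowSum p q n : ℂ) - logPowExpansion p q n (q + m + 1) (q + m + 5))
      =O[atTop] fun n : ℕ => 1 / (n : ℝ) ^ (m + q) := by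
  have hcauchy := isBigO_taylorCoeff (g := fun n => 1 / (n : ℝ) ^ (m + q)) (by norm_num)
    ((eventually_ge_atTop 1).mono fun n hn =>
      diffContOnCl_powConv_sub hq hn (q + m + 1) (q + m + 5))
    (isBigO_powConv_sub_sphere q m) p
  refine (hcauchy.const_mul_left ((-1) ^ p * (p ! : ℂ))).congr' ?_ EventuallyEq.rfl
  filter_upwards [eventually_ge_atTop 1] with n hn
  rw [taylorCoeff_sub p (analyticAt_powConv q n 0)
      (analyticAt_powConvExpansion hq hn _ _ (by simp)), mul_sub, ← logPowSum_eq_taylorCoeff,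
    taylorCoeff_powConvExpansion p hq hn]

end LogPowSum

section LogPolyCoefficients

theorem logPoly_zero (p : ℕ) {q : ℕ} (hq : 2 ≤ q) (n : ℕ) :
    logPoly p q 0 n = riemannZeta q * (Real.log n : ℂ) ^ p := by
  have hcoeff : (fun s => expansionCoeff q 0 s n) = fun s => risingCoeff 0 s * riemannZeta q := by
    funext s
    rw [expansionCoeff, if_neg (by lia), Nat.cast_zero, sub_zero]
  have hp : (p ! : ℂ) ≠ 0 := by exact_mod_cast p.factorial_ne_zero
  simp only [logPoly, hcoeff, taylorCoeff_mul_const, taylorCoeff_risingCoeff_zero]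
  rw [Finset.sum_range_succ', Finset.sum_eq_zero fun r _ => by simp]
  simp [hp]

theorem coeffC_zero (p i : ℕ) : coeffC p i 0 = 0 := by
  rw [coeffC, multHarm_of_neg (by simp), mul_zero]

theorem coeffC_of_lt (p : ℕ) {i r : ℕ} (h : i < r) : coeffC p i r = 0 := by
  rw [coeffC, multHarm_of_lt (by lia), mul_zero]

theorem sum_coeffC_min (p i : ℕ) (x : ℂ) :
    ∑ r ∈ Finset.Icc 1 (min i p), (coeffC p i r : ℂ) * x ^ (p - r)
      = ∑ r ∈ Finset.Icc 1 p, (coeffC p i r : ℂ) * x ^ (p - r) := by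
  refine Finset.sum_subset (Finset.Icc_subset_Icc_right (min_le_right _ _)) fun r hr hr' => ?_
  rw [Finset.mem_Icc] at hr hr'
  simp [coeffC_of_lt p (by lia : i < r)]

theorem logPoly_of_ne (p : ℕ) {q i : ℕ} (hi : 1 ≤ i) (hiq : i + 1 ≠ q) (n : ℕ) :
    logPoly p q i n = riemannZeta ((q : ℂ) - i) / i *
      ∑ r ∈ Finset.Icc 1 p, (coeffC p i r : ℂ) * (Real.log n : ℂ) ^ (p - r) := by
  have hcoeff : (fun s => expansionCoeff q i s n)
      = fun s => risingCoeff i s * riemannZeta ((q : ℂ) - i) :=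
    funext fun s => if_neg hiq
  have hrange : Finset.range (p + 1) = insert 0 (Finset.Icc 1 p) := by
    ext r
    simp only [Finset.mem_range, Finset.mem_insert, Finset.mem_Icc]
    lia
  have hzero : ∑ r ∈ Finset.Icc 1 p, (coeffC p i r : ℂ) * (Real.log n : ℂ) ^ (p - r)
      = ∑ r ∈ Finset.range (p + 1), (coeffC p i r : ℂ) * (Real.log n : ℂ) ^ (p - r) := by
    rw [hrange, Finset.sum_insert (by simp), coeffC_zero, Rat.cast_zero, zero_mul, zero_add]
  obtain ⟨m, rfl⟩ := Nat.exists_eq_add_of_le' hi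
  rw [hzero, logPoly, Finset.mul_sum]
  refine Finset.sum_congr rfl fun r _ => ?_
  rw [hcoeff, taylorCoeff_mul_const, taylorCoeff_risingCoeff_succ, coeffC,
    show ((m + 1 : ℕ) : ℤ) - 1 = m by simp]
  push_cast
  ring

theorem sum_multHarm_mul_taylorCoeff_harmonicSeries (Q r : ℕ) :
    ∑ i ∈ Finset.range (r + 1),
      (multHarm ((i : ℤ) - 1) 1 Q : ℂ) * taylorCoeff (r - i) harmonicSeries
    = ∑ s ∈ Finset.Icc 2 r, (multHarm ((r : ℤ) - (s : ℤ)) 1 Q : ℂ) * riemannZeta s := by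
  have hsub : Finset.Ico 1 r ⊆ Finset.range (r + 1) := fun x hx => by
    simp only [Finset.mem_Ico, Finset.mem_range] at *
    lia
  rw [← Finset.sum_range_reflect, ← Finset.sum_subset hsub]
  · rw [show Finset.Icc 2 r = Finset.Ico (1 + 1) (r + 1) from rfl, ← Finset.sum_Ico_add']
    refine Finset.sum_congr rfl fun k hk => ?_
    rw [Finset.mem_Ico] at hk
    rw [show r - (r + 1 - 1 - k) = k by lia, taylorCoeff_harmonicSeries, if_neg (by lia),
      show ((r + 1 - 1 - k : ℕ) : ℤ) - 1 = (r : ℤ) - ((k + 1 : ℕ) : ℤ) by lia]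
  · intro k hk hk'
    rw [Finset.mem_range] at hk
    rw [Finset.mem_Ico] at hk'
    rcases k.eq_zero_or_pos with rfl | hk0
    · rw [show r - (r + 1 - 1 - 0) = 0 by lia, taylorCoeff_harmonicSeries, if_pos rfl, mul_zero]
    · rw [multHarm_of_neg (by lia), Rat.cast_zero, zero_mul]

theorem add_one_mul_taylorCoeff_resonantCoeff (Q n r : ℕ) :
    ((Q : ℂ) + 1) * taylorCoeff r (fun s => resonantCoeff (Q + 1) s n)
      = (multHarm ((r : ℤ) - 1) 1 Q : ℂ) *
          (Real.log n + Real.eulerMascheroniConstant + (harmonic (Q + 1) : ℂ))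
        + ∑ s ∈ Finset.Icc 2 r, (multHarm ((r : ℤ) - (s : ℤ)) 1 Q : ℂ) * riemannZeta s
        - (r + 1) * (multHarm r 1 Q : ℂ) := by
  have hQ : (Q : ℂ) + 1 ≠ 0 := by exact_mod_cast Q.succ_ne_zero
  have hrising := (differentiable_risingCoeff (Q + 1)).analyticAt 0
  have hseries : AnalyticAt ℂ harmonicSeries 0 := analyticAt_harmonicSeries (by simp)
  have hexpand : (fun s => resonantCoeff (Q + 1) s n) = fun s => (risingCoeff (Q + 1) s *
      (Real.log n + Real.eulerMascheroniConstant + (harmonic (Q + 1) : ℂ))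
      + risingCoeff (Q + 1) s * harmonicSeries s) - deriv (risingCoeff (Q + 1)) s := by
    funext s
    rw [resonantCoeff]
    ring
  rw [hexpand, taylorCoeff_sub r ((hrising.fun_mul analyticAt_const).fun_add
      (hrising.fun_mul hseries)) hrising.deriv,
    taylorCoeff_add r (hrising.fun_mul analyticAt_const) (hrising.fun_mul hseries),
    taylorCoeff_mul_const, taylorCoeff_mul r hrising hseries, taylorCoeff_deriv]
  simp only [taylorCoeff_risingCoeff_succ, div_mul_eq_mul_div]
  rw [← Finset.sum_div, sum_multHarm_mul_taylorCoeff_harmonicSeries,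
    show ((r + 1 : ℕ) : ℤ) - 1 = r by simp]
  field_simp

theorem coeffD_eq (p r : ℕ) {q : ℕ} (hq : 2 ≤ q) : coeffD p q r
    = (-1) ^ r * ((p ! : ℂ) / ((p - r)! : ℂ)) *
      ((multHarm ((r : ℤ) - 1) 1 ((q : ℤ) - 2) : ℂ) *
          (Real.eulerMascheroniConstant + (harmonic (q - 1) : ℂ))
        + ∑ s ∈ Finset.Icc 2 r, (multHarm ((r : ℤ) - (s : ℤ)) 1 ((q : ℤ) - 2) : ℂ) * riemannZeta s
        - (r + 1) * (multHarm r 1 ((q : ℤ) - 2) : ℂ)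
        - ((p : ℂ) - r) * (multHarm r 1 ((q : ℤ) - 2) : ℂ)) := by
  rw [coeffD]
  congr 1
  split_ifs with h
  · rw [ratD_eq hq h]
    push_cast
    ring
  · rw [multHarm_of_lt (by lia : (q : ℤ) - 2 < r + 1 - 1),
      multHarm_of_lt (by lia : (q : ℤ) - 2 < r - 1 + 1 - 1)]
    simp only [Rat.cast_zero, zero_mul, mul_zero, sub_zero, zero_add]
    refine Finset.sum_subset (Finset.Icc_subset_Icc_left (by lia)) fun s hs hs' => ?_
    rw [Finset.mem_Icc] at hs hs'
    rw [multHarm_of_lt (by lia), Rat.cast_zero, zero_mul]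

/- Source of the summand `-(p - r) S_{r,1,q-2}` in `d_{p,q,r}`, with `x = log n`. -/
theorem sum_multHarm_mul_pow_add_one (p Q : ℕ) (x : ℂ) :
    ∑ r ∈ Finset.range (p + 1), (-1) ^ r * ((p ! : ℂ) / ((p - r)! : ℂ)) *
        (multHarm ((r : ℤ) - 1) 1 Q : ℂ) * x ^ (p - r + 1)
      = -∑ r ∈ Finset.range (p + 1), (-1) ^ r * ((p ! : ℂ) / ((p - r)! : ℂ)) *
        (((p : ℂ) - r) * (multHarm r 1 Q : ℂ)) * x ^ (p - r) := by
  rw [Finset.sum_range_succ', Finset.sum_range_succ, multHarm_of_neg (by simp)]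
  simp only [sub_self, Rat.cast_zero, mul_zero, zero_mul, add_zero]
  rw [← Finset.sum_neg_distrib]
  refine Finset.sum_congr rfl fun r hr => ?_
  obtain ⟨d, rfl⟩ := Nat.exists_eq_add_of_lt (Finset.mem_range.1 hr)
  have hd : (d ! : ℂ) ≠ 0 := by exact_mod_cast d.factorial_ne_zero
  have hd1 : (d : ℂ) + 1 ≠ 0 := by exact_mod_cast d.succ_ne_zero
  rw [show r + d + 1 - (r + 1) = d by lia, show r + d + 1 - r = d + 1 by lia,
    show ((r + 1 : ℕ) : ℤ) - 1 = r by simp, Nat.factorial_succ d]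
  push_cast
  field_simp
  ring

theorem logPoly_pred (p : ℕ) {q : ℕ} (hq : 2 ≤ q) (n : ℕ) :
    logPoly p q (q - 1) n = 1 / ((q : ℂ) - 1) *
      ∑ r ∈ Finset.Icc 0 p, coeffD p q r * (Real.log n : ℂ) ^ (p - r) := by
  obtain ⟨Q, rfl⟩ := Nat.exists_eq_add_of_le' hq
  have hQ : (Q : ℂ) + 1 ≠ 0 := by exact_mod_cast Q.succ_ne_zero
  have hresonant : (fun s => expansionCoeff (Q + 2) (Q + 1) s n)
      = fun s => resonantCoeff (Q + 1) s n := funext fun s => if_pos rfl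
  simp only [coeffD_eq p _ hq, show ((Q + 2 : ℕ) : ℤ) - 2 = Q by simp,
    show ((Q + 2 : ℕ) : ℂ) - 1 = Q + 1 by push_cast; ring, show Q + 2 - 1 = Q + 1 from rfl,
    ← Nat.range_succ_eq_Icc_zero]
  rw [eq_comm, one_div, inv_mul_eq_iff_eq_mul₀ hQ, logPoly, hresonant, ← sub_eq_zero,
    Finset.mul_sum, ← Finset.sum_sub_distrib, ← neg_eq_zero, ← Finset.sum_neg_distrib]
  have hshift := sum_multHarm_mul_pow_add_one p Q (Real.log n)
  rw [← sub_eq_zero, sub_neg_eq_add, ← Finset.sum_add_distrib] at hshift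
  rw [← hshift]
  refine Finset.sum_congr rfl fun r _ => ?_
  rw [pow_succ]
  linear_combination ((-1) ^ r * ((p ! : ℂ) / ((p - r)! : ℂ)) * (Real.log n : ℂ) ^ (p - r)) *
    add_one_mul_taylorCoeff_resonantCoeff Q n r

theorem coeffC_one_one {i : ℕ} (hi : 1 ≤ i) : coeffC 1 i 1 = -1 := by
  simp [coeffC, multHarm_zero (by lia : (1 : ℤ) - 1 ≤ i - 1)]

theorem coeffD_one_zero {q : ℕ} (hq : 2 ≤ q) : coeffD 1 q 0 = -2 := by
  rw [coeffD_eq _ _ hq, Nat.cast_zero, multHarm_of_neg (by simp), multHarm_zero (by lia)]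
  norm_num

theorem coeffD_one_one {q : ℕ} (hq : 2 ≤ q) : coeffD 1 q 1 = -(constC (q - 1) : ℂ) := by
  obtain ⟨Q, rfl⟩ := Nat.exists_eq_add_of_le' hq
  have hQ : (Q : ℂ) + 1 ≠ 0 := by exact_mod_cast Q.succ_ne_zero
  rw [coeffD_eq _ _ hq, Nat.cast_one, sub_self, multHarm_zero (by lia),
    show ((Q + 2 : ℕ) : ℤ) - 2 = Q by simp, ← harmonic_eq_multHarm,
    show Q + 2 - 1 = Q + 1 from rfl, constC, harmonic_succ, Finset.Icc_eq_empty (by simp),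
    Finset.sum_empty]
  push_cast
  rw [Nat.factorial_zero, Nat.factorial_one]
  field_simp
  ring

end LogPolyCoefficients

section LogPowExpansion

theorem sum_Icc_one_eq_sum_range {M : Type*} [AddCommMonoid M] (f : ℕ → M) (n : ℕ) :
    ∑ i ∈ Finset.Icc 1 n, f i = ∑ i ∈ Finset.range n, f (i + 1) := by
  rw [Finset.range_eq_Ico, Finset.sum_Ico_add']
  rfl

theorem riemannZeta_one_sub_natCast {k : ℕ} (hk : 1 ≤ k) :
    riemannZeta (1 - (k : ℂ)) = -((-1) ^ k * (bernoulli k : ℂ) / k) := by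
  obtain ⟨j, rfl⟩ := Nat.exists_eq_add_of_le' hk
  rw [show (1 : ℂ) - ((j + 1 : ℕ) : ℂ) = -(j : ℂ) by push_cast; ring,
    riemannZeta_neg_nat_eq_bernoulli, pow_succ]
  push_cast
  ring

theorem sum_range_logPoly_mul (p n : ℕ) {q : ℕ} (hq : 2 ≤ q) :
    ∑ i ∈ Finset.range q, logPoly p q i n * (1 / (n : ℂ) ^ i)
      = riemannZeta q * (Real.log n : ℂ) ^ p
        + ∑ i ∈ Finset.Icc 1 (q - 2),
            riemannZeta ((q : ℂ) - (i : ℂ)) / ((i : ℂ) * (n : ℂ) ^ i) *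
              ∑ r ∈ Finset.Icc 1 (min i p), (coeffC p i r : ℂ) * (Real.log n : ℂ) ^ (p - r)
        + 1 / (((q : ℂ) - 1) * (n : ℂ) ^ (q - 1)) *
            ∑ r ∈ Finset.Icc 0 p, coeffD p q r * (Real.log n : ℂ) ^ (p - r) := by
  have hlast : logPoly p q (q - 1) n * (1 / (n : ℂ) ^ (q - 1))
      = 1 / (((q : ℂ) - 1) * (n : ℂ) ^ (q - 1)) *
          ∑ r ∈ Finset.Icc 0 p, coeffD p q r * (Real.log n : ℂ) ^ (p - r) := by
    rw [logPoly_pred p hq, mul_right_comm, one_div_mul_one_div]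
  have hmiddle : ∀ i ∈ Finset.Icc 1 (q - 2), logPoly p q i n * (1 / (n : ℂ) ^ i)
      = riemannZeta ((q : ℂ) - (i : ℂ)) / ((i : ℂ) * (n : ℂ) ^ i) *
          ∑ r ∈ Finset.Icc 1 (min i p), (coeffC p i r : ℂ) * (Real.log n : ℂ) ^ (p - r) := by
    intro i hi
    rw [Finset.mem_Icc] at hi
    rw [logPoly_of_ne p hi.1 (by lia), sum_coeffC_min, mul_right_comm, div_mul_div_comm, mul_one]
  rw [← hlast, ← Finset.sum_congr rfl hmiddle, sum_Icc_one_eq_sum_range, ← logPoly_zero p hq]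
  obtain ⟨Q, rfl⟩ := Nat.exists_eq_add_of_le' hq
  rw [Finset.sum_range_succ, Finset.sum_range_succ']
  simp [add_comm]

theorem logPoly_add_mul (p k n : ℕ) {q : ℕ} (hq : 1 ≤ q) (hk : 1 ≤ k) :
    logPoly p q (k + q - 1) n * (1 / (n : ℂ) ^ (k + q - 1))
      = -((-1) ^ k * (bernoulli k : ℂ) / ((k : ℂ) * ((k : ℂ) + (q : ℂ) - 1)) *
          ∑ r ∈ Finset.Icc 1 p, (coeffC p (k + q - 1) r : ℂ) * (Real.log n : ℂ) ^ (p - r))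
        * (1 / (n : ℂ) ^ (k + q - 1)) := by
  have hcast : ((k + q - 1 : ℕ) : ℂ) = k + q - 1 := by
    rw [Nat.cast_sub (by lia)]
    push_cast
    ring
  rw [logPoly_of_ne p (by lia) (by lia), hcast,
    show (q : ℂ) - (k + q - 1) = 1 - k by ring, riemannZeta_one_sub_natCast hk, ← div_div]
  ring

theorem logPowExpansion_add_eq (p m n : ℕ) {q : ℕ} (hq : 2 ≤ q) :
    logPowExpansion p q n (q + m) m
      = riemannZeta q * (Real.log n : ℂ) ^ p
        + ∑ i ∈ Finset.Icc 1 (q - 2),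
            riemannZeta ((q : ℂ) - (i : ℂ)) / ((i : ℂ) * (n : ℂ) ^ i) *
              ∑ r ∈ Finset.Icc 1 (min i p), (coeffC p i r : ℂ) * (Real.log n : ℂ) ^ (p - r)
        + 1 / (((q : ℂ) - 1) * (n : ℂ) ^ (q - 1)) *
            ∑ r ∈ Finset.Icc 0 p, coeffD p q r * (Real.log n : ℂ) ^ (p - r)
        - ∑ k ∈ Finset.Icc 1 m,
            ((-1) ^ k * (bernoulli k : ℂ) / ((k : ℂ) * ((k : ℂ) + (q : ℂ) - 1)) *
                ∑ r ∈ Finset.Icc 1 p,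
                  (coeffC p (k + q - 1) r : ℂ) * (Real.log n : ℂ) ^ (p - r)
              - (-1) ^ p * ((k + q - 2).choose (q - 1) : ℂ) * zetaDeriv p (1 - (k : ℂ)))
            * (1 / (n : ℂ) ^ (k + q - 1)) := by
  rw [logPowExpansion, Finset.sum_range_add, sum_range_logPoly_mul p n hq, add_assoc,
    ← Finset.sum_add_distrib, sub_eq_add_neg (_ + _ + _), ← Finset.sum_neg_distrib,
    sum_Icc_one_eq_sum_range _ m]
  congr 1
  refine Finset.sum_congr rfl fun k _ => ?_
  have hnear := logPoly_add_mul p (k + 1) n (by lia : 1 ≤ q) (by lia)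
  rw [show k + 1 + q - 1 = q + k by lia] at hnear ⊢
  rw [hnear, show k + 1 + q - 2 = q + k - 1 by lia,
    show (1 : ℂ) - ((k + 1 : ℕ) : ℂ) = -(k : ℂ) by push_cast; ring,
    ← Nat.choose_symm_of_eq_add (show q + k - 1 = k + (q - 1) by lia)]
  ring

theorem logPowExpansion_one_add_eq (m n : ℕ) {q : ℕ} (hq : 2 ≤ q) :
    logPowExpansion 1 q n (q + m) m
      = riemannZeta q * (Real.log n : ℂ)
        - ∑ i ∈ Finset.Icc 1 (q - 2), riemannZeta ((q : ℂ) - (i : ℂ)) / ((i : ℂ) * (n : ℂ) ^ i)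
        - (2 * (Real.log n : ℂ) + (constC (q - 1) : ℂ)) / (((q : ℂ) - 1) * (n : ℂ) ^ (q - 1))
        + ∑ k ∈ Finset.Icc 1 m,
            ((-1) ^ k * (bernoulli k : ℂ) / ((k : ℂ) * ((k : ℂ) + (q : ℂ) - 1))
              - ((k + q - 2).choose (q - 1) : ℂ) * zetaDeriv 1 (1 - (k : ℂ)))
            * (1 / (n : ℂ) ^ (k + q - 1)) := by
  rw [logPowExpansion_add_eq 1 m n hq, pow_one, ← Nat.range_succ_eq_Icc_zero,
    Finset.sum_range_succ, Finset.sum_range_one, coeffD_one_zero hq, coeffD_one_one hq]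
  have hmiddle : ∀ i ∈ Finset.Icc 1 (q - 2),
      riemannZeta ((q : ℂ) - (i : ℂ)) / ((i : ℂ) * (n : ℂ) ^ i) *
        ∑ r ∈ Finset.Icc 1 (min i 1), (coeffC 1 i r : ℂ) * (Real.log n : ℂ) ^ (1 - r)
      = -(riemannZeta ((q : ℂ) - (i : ℂ)) / ((i : ℂ) * (n : ℂ) ^ i)) := by
    intro i hi
    simp [sum_coeffC_min, coeffC_one_one (Finset.mem_Icc.1 hi).1]
  have htail : ∀ k ∈ Finset.Icc 1 m,
      ((-1) ^ k * (bernoulli k : ℂ) / ((k : ℂ) * ((k : ℂ) + (q : ℂ) - 1)) *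
          ∑ r ∈ Finset.Icc 1 1, (coeffC 1 (k + q - 1) r : ℂ) * (Real.log n : ℂ) ^ (1 - r)
        - (-1) ^ 1 * ((k + q - 2).choose (q - 1) : ℂ) * zetaDeriv 1 (1 - (k : ℂ)))
        * (1 / (n : ℂ) ^ (k + q - 1))
      = -(((-1) ^ k * (bernoulli k : ℂ) / ((k : ℂ) * ((k : ℂ) + (q : ℂ) - 1))
          - ((k + q - 2).choose (q - 1) : ℂ) * zetaDeriv 1 (1 - (k : ℂ)))
          * (1 / (n : ℂ) ^ (k + q - 1))) := by
    intro k _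
    rw [Finset.Icc_self, Finset.sum_singleton, coeffC_one_one (by lia)]
    push_cast
    ring
  rw [Finset.sum_congr rfl hmiddle, Finset.sum_congr rfl htail, Finset.sum_neg_distrib,
    Finset.sum_neg_distrib]
  simp only [tsub_zero, tsub_self, pow_one, pow_zero]
  ring

end LogPowExpansion

section Asymptotics

theorem eventually_one_le_log_natCast : ∀ᶠ n : ℕ in atTop, 1 ≤ Real.log n :=
  (Real.tendsto_log_atTop.comp tendsto_natCast_atTop_atTop).eventually_ge_atTop 1

theorem isBigO_log_pow_mul_one_div_pow {a b N N' : ℕ} (hab : a ≤ b) (hN : N ≤ N') :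
    (fun n : ℕ => (Real.log n : ℂ) ^ a * (1 / (n : ℂ) ^ N'))
      =O[atTop] fun n : ℕ => Real.log n ^ b / (n : ℝ) ^ N := by
  refine IsBigO.of_norm_eventuallyLE ?_
  filter_upwards [eventually_one_le_log_natCast, eventually_ge_atTop 1] with n hlog hn
  have hn' : (1 : ℝ) ≤ n := by exact_mod_cast hn
  rw [norm_mul, norm_div, norm_one, norm_pow, norm_pow, Complex.norm_natCast,
    Complex.norm_real, Real.norm_of_nonneg (by linarith), div_eq_mul_one_div (Real.log n ^ b)]
  gcongr

theorem isBigO_logPoly_mul (p : ℕ) {q i N : ℕ} (hi : 1 ≤ i) (hiq : i + 1 ≠ q) (hN : N ≤ i) :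
    (fun n : ℕ => logPoly p q i n * (1 / (n : ℂ) ^ i))
      =O[atTop] fun n : ℕ => Real.log n ^ (p - 1) / (n : ℝ) ^ N := by
  have hterm : ∀ r ∈ Finset.Icc 1 p, (fun n : ℕ => (riemannZeta ((q : ℂ) - i) / i *
      (coeffC p i r : ℂ)) * ((Real.log n : ℂ) ^ (p - r) * (1 / (n : ℂ) ^ i)))
      =O[atTop] fun n : ℕ => Real.log n ^ (p - 1) / (n : ℝ) ^ N := fun r hr =>
    (isBigO_log_pow_mul_one_div_pow
      (Nat.sub_le_sub_left (Finset.mem_Icc.1 hr).1 p) hN).const_mul_left _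
  refine (IsBigO.fun_sum hterm).congr_left fun n => ?_
  rw [logPoly_of_ne p hi hiq, Finset.mul_sum, Finset.sum_mul]
  exact Finset.sum_congr rfl fun r _ => by ring

theorem isBigO_logPowExpansion_sub (p m : ℕ) {q I J : ℕ} (hq : 1 ≤ q) (hI : q + m ≤ I)
    (hJ : m ≤ J) :
    (fun n : ℕ => logPowExpansion p q n I J - logPowExpansion p q n (q + m) m)
      =O[atTop] fun n : ℕ => Real.log n ^ (p - 1) / (n : ℝ) ^ (m + q) := by
  have hnear : (fun n : ℕ => ∑ i ∈ Finset.Ico (q + m) I, logPoly p q i n * (1 / (n : ℂ) ^ i))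
      =O[atTop] fun n : ℕ => Real.log n ^ (p - 1) / (n : ℝ) ^ (m + q) :=
    IsBigO.fun_sum fun i hi => by
      rw [Finset.mem_Ico] at hi
      exact isBigO_logPoly_mul p (by lia) (by lia) (by lia)
  have hfar : (fun n : ℕ => ∑ j ∈ Finset.Ico m J, (-1) ^ p * ((q + j - 1).choose j : ℂ) *
        zetaDeriv p (-(j : ℂ)) * (1 / (n : ℂ) ^ (q + j)))
      =O[atTop] fun n : ℕ => Real.log n ^ (p - 1) / (n : ℝ) ^ (m + q) :=
    IsBigO.fun_sum fun j hj => by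
      rw [Finset.mem_Ico] at hj
      simpa only [pow_zero, one_mul] using (isBigO_log_pow_mul_one_div_pow (Nat.zero_le (p - 1))
        (by lia : m + q ≤ q + j)).const_mul_left
        ((-1) ^ p * ((q + j - 1).choose j : ℂ) * zetaDeriv p (-(j : ℂ)))
  refine (hnear.add hfar).congr_left fun n => ?_
  rw [Finset.sum_Ico_eq_sub _ hI, Finset.sum_Ico_eq_sub _ hJ, logPowExpansion, logPowExpansion]
  ring

theorem isBigO_logPowSum_sub_logPowExpansion (p m : ℕ) {q : ℕ} (hq : 1 ≤ q) :
    (fun n : ℕ => (logPowSum p q n : ℂ) - logPowExpansion p q n (q + m) m)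
      =O[atTop] fun n : ℕ => Real.log n ^ (p - 1) / (n : ℝ) ^ (m + q) := by
  have hpow : (fun n : ℕ => 1 / (n : ℝ) ^ (m + q))
      =O[atTop] fun n : ℕ => Real.log n ^ (p - 1) / (n : ℝ) ^ (m + q) := by
    refine IsBigO.of_norm_left ?_
    simpa using (isBigO_log_pow_mul_one_div_pow (Nat.zero_le (p - 1)) le_rfl).norm_left
  simpa using ((isBigO_logPowSum_sub_logPowExpansion_add p hq m).trans hpow).add
    (isBigO_logPowExpansion_sub p m hq (by lia : q + m ≤ q + m + 1) (by lia : m ≤ q + m + 5))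

theorem tendsto_log_pow_div_pow (a : ℕ) {N : ℕ} (hN : 1 ≤ N) :
    Tendsto (fun n : ℕ => Real.log n ^ a / (n : ℝ) ^ N) atTop (nhds 0) := by
  have hlog : (fun n : ℕ => Real.log n ^ a) =o[atTop] fun n : ℕ => (n : ℝ) :=
    Real.isLittleO_pow_log_id_atTop.comp_tendsto tendsto_natCast_atTop_atTop
  have hpow : (fun n : ℕ => (n : ℝ)) =O[atTop] fun n : ℕ => (n : ℝ) ^ N := by
    refine IsBigO.of_norm_eventuallyLE ?_
    filter_upwards [eventually_ge_atTop 1] with n hn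
    have hn' : (1 : ℝ) ≤ n := by exact_mod_cast hn
    simpa using le_self_pow₀ hn' (by lia : N ≠ 0)
  exact (hlog.trans_isBigO hpow).tendsto_div_nhds_zero

theorem tendsto_logPoly_mul (p : ℕ) {q i : ℕ} (hi : 1 ≤ i) :
    Tendsto (fun n : ℕ => logPoly p q i n * (1 / (n : ℂ) ^ i)) atTop (nhds 0) := by
  have hterm : ∀ r : ℕ,
      Tendsto (fun n : ℕ => (Real.log n : ℂ) ^ r * (1 / (n : ℂ) ^ i)) atTop (nhds 0) := fun r =>
    (isBigO_log_pow_mul_one_div_pow le_rfl le_rfl).trans_tendsto (tendsto_log_pow_div_pow r hi)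
  by_cases hiq : i + 1 = q
  · obtain rfl : i = q - 1 := by lia
    have hsum := tendsto_finsetSum (Finset.Icc 0 p) fun r _ =>
      (hterm (p - r)).const_mul (1 / ((q : ℂ) - 1) * coeffD p q r)
    simp only [mul_zero, Finset.sum_const_zero] at hsum
    refine hsum.congr fun n => ?_
    rw [logPoly_pred p (by lia), Finset.mul_sum, Finset.sum_mul]
    exact Finset.sum_congr rfl fun r _ => by ring
  · exact (isBigO_logPoly_mul p hi hiq le_rfl).trans_tendsto (tendsto_log_pow_div_pow (p - 1) hi)

theorem tendsto_logPowSum_sub (p : ℕ) {q : ℕ} (hq : 2 ≤ q) :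
    Tendsto (fun n : ℕ => (logPowSum p q n : ℂ) - riemannZeta q * (Real.log n : ℂ) ^ p)
      atTop (nhds 0) := by
  have herror := (isBigO_logPowSum_sub_logPowExpansion p 0 (by lia : 1 ≤ q)).trans_tendsto
    (tendsto_log_pow_div_pow (p - 1) (by lia))
  have hterms := tendsto_finsetSum (Finset.Ico 1 q) fun i hi =>
    tendsto_logPoly_mul p (q := q) (Finset.mem_Ico.1 hi).1
  have hsum := herror.add hterms
  simp only [Finset.sum_const_zero, add_zero] at hsum
  refine hsum.congr fun n => ?_
  rw [logPowExpansion, Finset.sum_range_zero, Finset.sum_Ico_eq_sub _ (by lia : 1 ≤ q),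
    Finset.sum_range_one, logPoly_zero p hq]
  simp

end Asymptotics

theorem mainTheorem6 :
    -- the case `p = 1`
    (∀ q : ℕ, 2 ≤ q →
      (∀ m : ℕ,
        (fun n : ℕ => (logPowSum 1 q n : ℂ) -
          (riemannZeta q * (Real.log n : ℂ)
            - ∑ i ∈ Finset.Icc 1 (q - 2),
                riemannZeta ((q : ℂ) - (i : ℂ)) / ((i : ℂ) * (n : ℂ) ^ i)
            - (2 * (Real.log n : ℂ) + (constC (q - 1) : ℂ)) / (((q : ℂ) - 1) * (n : ℂ) ^ (q - 1))
            + ∑ k ∈ Finset.Icc 1 m,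
                ((-1) ^ k * (bernoulli k : ℂ) / ((k : ℂ) * ((k : ℂ) + (q : ℂ) - 1))
                  - ((k + q - 2).choose (q - 1) : ℂ) * zetaDeriv 1 (1 - (k : ℂ)))
                * (1 / (n : ℂ) ^ (k + q - 1))))
          =O[atTop] fun n : ℕ => 1 / (n : ℝ) ^ (m + q)) ∧
      Tendsto (fun n : ℕ => (logPowSum 1 q n : ℂ) - riemannZeta q * (Real.log n : ℂ))
        atTop (nhds 0)) ∧
    -- the general case
    (∀ p q : ℕ, 1 ≤ p → 2 ≤ q →
      (∀ m : ℕ,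
        (fun n : ℕ => (logPowSum p q n : ℂ) -
          (riemannZeta q * (Real.log n : ℂ) ^ p
            + ∑ i ∈ Finset.Icc 1 (q - 2),
                riemannZeta ((q : ℂ) - (i : ℂ)) / ((i : ℂ) * (n : ℂ) ^ i) *
                  ∑ r ∈ Finset.Icc 1 (min i p), (coeffC p i r : ℂ) * (Real.log n : ℂ) ^ (p - r)
            + 1 / (((q : ℂ) - 1) * (n : ℂ) ^ (q - 1)) *
                ∑ r ∈ Finset.Icc 0 p, coeffD p q r * (Real.log n : ℂ) ^ (p - r)
            - ∑ k ∈ Finset.Icc 1 m,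
                ((-1) ^ k * (bernoulli k : ℂ) / ((k : ℂ) * ((k : ℂ) + (q : ℂ) - 1)) *
                    ∑ r ∈ Finset.Icc 1 p,
                      (coeffC p (k + q - 1) r : ℂ) * (Real.log n : ℂ) ^ (p - r)
                  - (-1) ^ p * ((k + q - 2).choose (q - 1) : ℂ) * zetaDeriv p (1 - (k : ℂ)))
                * (1 / (n : ℂ) ^ (k + q - 1))))
          =O[atTop] fun n : ℕ => Real.log (n : ℝ) ^ (p - 1) / (n : ℝ) ^ (m + q)) ∧
      Tendsto (fun n : ℕ => (logPowSum p q n : ℂ) - riemannZeta q * (Real.log n : ℂ) ^ p)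
        atTop (nhds 0)) := by
  refine ⟨fun q hq => ⟨fun m => ?_, ?_⟩, fun p q _ hq => ⟨fun m => ?_, tendsto_logPowSum_sub p hq⟩⟩
  · simpa only [logPowExpansion_one_add_eq m _ hq, tsub_self, pow_zero] using
      isBigO_logPowSum_sub_logPowExpansion 1 m (by lia : 1 ≤ q)
  · simpa only [pow_one] using tendsto_logPowSum_sub 1 hq
  · simpa only [logPowExpansion_add_eq p m _ hq] using
      isBigO_logPowSum_sub_logPowExpansion p m (by lia : 1 ≤ q)
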